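/- **Setting.** Let $1\le d\le n$, $A\in\mathbb R^{n\times n}$, $B\in\mathbb R^{n\times d}$, let $S\in\mathbb R^{n\times n}$ and $R\in\mathbb R^{d\times d}$ be symmetric positive definite, and $\sigma_w>0$. Consider $x_{t+1}=Ax_t+Bu_t+w_t$ with i.i.d. $w_t\sim\mathcal N(0,\sigma_w^2I)$ and $x_0=0$. $J_\star$ is the infimum, over all causal policies, of the average cost $\limsup_{T}\frac1T\sum_{t=1}^T\mathbb E[x_t^{\mathsf T}Sx_t+u_t^{\mathsf T}Ru_t]$, and $\mathsf{Regret}(T)=\sum_{t=1}^T(x_t^{\mathsf T}Sx_t+u_t^{\mathsf T}Ru_t)-TJ_\star$. $\|\cdot\|$ is the operator norm. A controller $K\in\mathbb R^{d\times n}$ stabilizes $(A,B)$ if $A+BK$ has spectral radius $<1$; its value function is the unique solution $V(K)$ of $V=(A+BK)^{\mathsf T}V(A+BK)+S+K^{\mathsf T}RK$. A matrix $L$ is $(\tau,\rho)$-stable, where $\tau\ge1$ and $\rho\in(0,1)$, if $\|L^k\|\le\tau\rho^k$ for all $k\ge0$. Let $K_\star$ be the optimal LQR controller (stabilizing, with $u_t=K_\star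 x_t$ attaining $J_\star$), $V_\star=V(K_\star)$. We write $\mathrm{polylog}(z_1,\dots,z_r)$ for $c\,(1+\sum_j\max\{0,\log z_j\})^p$ with constants $c>0$, $p\in\mathbb N$. **Algorithm.** Given a stabilizing $K^{(0)}$, an epoch multiplier $T_{\mathrm{mult}}\in\mathbb N$ and $\alpha\ge1$, epoch $i=0,1,\dots$ lasts $T_i=T_{\mathrm{mult}}2^i$ steps and uses $u_t^{(i)}=K^{(i)}x_t^{(i)}+\eta_t^{(i)}$ with $\eta_t^{(i)}\sim\mathcal N(0,\sigma_{\eta,i}^2I)$, $\sigma_{\eta,i}^2=\sigma_w^2(1/2^i)^{1/(1+\alpha)}$, all noise independent. From the $T_i$ transitions $\mathcal D_i=\{(x_t^{(i)},u_t^{(i)},x_{t+1}^{(i)})\}_{0\le t<T_i}$ of the epoch it computes $K^{(i+1)}=\mathsf{EstimateK}(K^{(i)},\mathcal D_i)$ (a measurable function). The system is not reset: $x_0^{(0)}=0$ and $x_0^{(i+1)}=x_{T_i}^{(i)}$. Put $V^{(i)}=V(K^{(i)})$. **Assumption on $\mathsf{EstimateK}$.** There are a decreasing $C_{\mathrm{req}}>0$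 and a $C_{\mathrm{err}}\ge0$ that is increasing in each argument (both may depend on the problem parameters) and a fixed $\mathrm{polylog}$ (constants $c,p$) such that for every epoch $i$: let $G$ be an event of positive probability, determined by the noise before epoch $i$, on which $K^{(i)}$ stabilizes $(A,B)$ and given which $x^{(i)}_0$ is square integrable, and let $\Sigma_0^{(i)}=\mathbb E[x_0^{(i)}(x_0^{(i)})^{\mathsf T}\mid G]$. If $\varepsilon>0$ and $\delta'\in(0,1)$ are such that everywhere on $G$ one has $\varepsilon<C_{\mathrm{req}}(\|V^{(i)}\|)$ and $$T_i\ \ge\ \frac{C_{\mathrm{err}}(\|V^{(i)}\|,\|\Sigma_0^{(i)}\|)}{\varepsilon^2}\,\frac1{\sigma_{\eta,i}^{2\alpha}}\,\mathrm{polylog}(T_i,1/\sigma_{\eta,i}^{\alpha},1/\delta',1/\varepsilon),$$ then $\mathbb P(G\cap\{\|K^{(i+1)}-K_\star\|>\varepsilon\})\le\delta'$. **Claim.** Let $\lambda=\lambda_{\min}(S)$, $\Gamma_\star=1+\max\{\|A\|,\|B\|,\|V^{(0)}\|,\|V_\star\|,\|K^{(0)}\|,\|K_\star\|,\|S\|,\|R\|\}$,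 $V_{\max}=4\Gamma_\star^5/\lambda^2$, $\Sigma_{\max}=4\sigma_w^2n\Gamma_\star^4/\lambda^2$, $C_{\mathrm{req}}=C_{\mathrm{req}}(V_{\max})$, $C_{\mathrm{err}}=C_{\mathrm{err}}(V_{\max},\Sigma_{\max})$, $\tau=\sqrt{\|V^{(0)}\|/\lambda}$, $\rho=\sqrt{1-\lambda/\|V^{(0)}\|}$, $\bar\rho=(1+\rho)/2$. There are constants $C>0$ and $k,q\in\mathbb N$ depending only on the constants $c,p$ of the Assumption such that the following holds, with $\mathrm{polylog}(\cdot)$ now formed with $C,q$. Let $\delta\in(0,1)$, $E\ge1$, let $T$ be a time with $T_{\mathrm{mult}}(2^{E-1}-1)<T\le T_{\mathrm{mult}}(2^E-1)$ (so $T$ lies in the $E$-th epoch), and suppose $$T_{\mathrm{mult}}\ \ge\ \max\Big\{1,\frac{\Gamma_\star^8}{\lambda^4},\frac1{C_{\mathrm{req}}^4}\Big\}\max\Big\{1,\frac{C_{\mathrm{err}}^2}{\sigma_w^{4\alpha}}\Big\}\,\alpha^k\,\mathrm{polylog}(1/\sigma_w,E/\delta).$$ Then with probability at least $1-\delta$,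 the matrices $A+BK^{(i)}$, $0\le i\le E$, are all $(\tau,\bar\rho)$-stable and $$\begin{aligned}\mathsf{Regret}(T)\ \le\ &\sigma_w^{2(1-\alpha)}\,d\,\frac{\Gamma_\star^7}{\lambda^2}\,C_{\mathrm{err}}\Big(\frac{T+1}{T_{\mathrm{mult}}}\Big)^{\frac{\alpha}{\alpha+1}}\mathrm{polylog}(T/\delta,1/\sigma_w^{\alpha})\\&+C\,T_{\mathrm{mult}}\big(\Gamma_\star^2J_\star+\sigma_w^2\operatorname{Tr}R\big)\Big(\frac{T+1}{T_{\mathrm{mult}}}\Big)^{\frac{\alpha}{\alpha+1}}\\&+C\,n^{3/2}\sqrt T\,\sigma_w^2\,\frac{\Gamma_\star^9}{\lambda^4}\big(1+\log(T/\delta)\big)+C\,T_{\mathrm{mult}}\,\sigma_w^2\,n\,\Gamma_\star^3 .\end{aligned}$$ -/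

import Mathlib

open MeasureTheory ProbabilityTheory Filter
open scoped Matrix Matrix.Norms.L2Operator ENNReal

namespace AdaptiveLQR

/-! Matrices carry the operator norm induced by the Euclidean norms (`Matrix.Norms.L2Operator`).
States are vectors `Fin n → ℝ`, inputs are vectors `Fin d → ℝ`, and a controller is a `d × n`
matrix `K`, played as `u = K x`. -/

/-- The data of an LQR problem: dynamics `x' = A x + B u + w` with `w ∼ N(0, σw² I)`, and stage cost
`xᵀ S x + uᵀ R u`. -/
structure System (n d : ℕ) where
  A : Matrix (Fin n) (Fin n) ℝ
  B : Matrix (Fin n) (Fin d) ℝ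
  S : Matrix (Fin n) (Fin n) ℝ
  R : Matrix (Fin d) (Fin d) ℝ
  σw : ℝ

/-- The Gaussian law `N(0, σ² I)` on `ℝᵐ`: independent `N(0, σ²)` coordinates. -/
noncomputable def isoGaussian (m : ℕ) (σ : ℝ) : Measure (Fin m → ℝ) :=
  Measure.pi fun _ => gaussianReal 0 (σ ^ 2).toNNReal

/-- Smallest eigenvalue of a symmetric matrix. -/
noncomputable def lamMin {m : ℕ} (M : Matrix (Fin m) (Fin m) ℝ) : ℝ := sInf (spectrum ℝ M)

/-- A square real matrix is stable if its (complex) spectral radius is less than one. -/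
def IsStable {m : ℕ} (L : Matrix (Fin m) (Fin m) ℝ) : Prop :=
  spectralRadius ℂ (L.map (fun x : ℝ => (x : ℂ))) < 1

/-- `(τ, ρ)`-stability. -/
def TauRhoStable {m : ℕ} (τ ρ : ℝ) (L : Matrix (Fin m) (Fin m) ℝ) : Prop :=
  1 ≤ τ ∧ 0 < ρ ∧ ρ < 1 ∧ ∀ k : ℕ, ‖L ^ k‖ ≤ τ * ρ ^ k

open Classical in
/-- The unique solution `P` of the discrete Lyapunov equation `P = Lᵀ P L + M`
(`0` if there is no unique solution; there is one whenever `L` is stable). -/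
noncomputable def dlyap {m : ℕ} (L M : Matrix (Fin m) (Fin m) ℝ) : Matrix (Fin m) (Fin m) ℝ :=
  if h : ∃! P : Matrix (Fin m) (Fin m) ℝ, P = Lᵀ * P * L + M then h.choose else 0

/-- `polylog c p [x₁, …, x_r] = c (1 + log⁺ x₁ + ⋯ + log⁺ x_r) ^ p`. -/
noncomputable def polylog (c : ℝ) (p : ℕ) (l : List ℝ) : ℝ :=
  c * (1 + (l.map Real.posLog).sum) ^ p

section System

variable {n d : ℕ} (sys : System n d)

/-- `A + B K`. -/
def closedLoop (K : Matrix (Fin d) (Fin n) ℝ) : Matrix (Fin n) (Fin n) ℝ := sys.A + sys.B * K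

/-- `K` stabilizes `(A, B)`. -/
def Stabilizes (K : Matrix (Fin d) (Fin n) ℝ) : Prop := IsStable (closedLoop sys K)

/-- The (matrix of the) value function of `K`: `V = dlyap (A + B K, S + Kᵀ R K)`. -/
noncomputable def valueFn (K : Matrix (Fin d) (Fin n) ℝ) : Matrix (Fin n) (Fin n) ℝ :=
  dlyap (closedLoop sys K) (sys.S + Kᵀ * sys.R * K)

/-- The stage cost `xᵀ S x + uᵀ R u`. -/
def cost (x : Fin n → ℝ) (u : Fin d → ℝ) : ℝ := x ⬝ᵥ (sys.S *ᵥ x) + u ⬝ᵥ (sys.R *ᵥ u)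

/-- One step of the dynamics. -/
def step (x : Fin n → ℝ) (u : Fin d → ℝ) (w : Fin n → ℝ) : Fin n → ℝ :=
  sys.A *ᵥ x + sys.B *ᵥ u + w

/-! ### The optimal average cost -/

/-- A causal policy: `u_t` is a measurable function of the states `x_0, …, x_t`. -/
structure Policy (n d : ℕ) where
  act : (t : ℕ) → (Fin (t + 1) → Fin n → ℝ) → (Fin d → ℝ)
  measurable_act : ∀ t, Measurable (act t)

/-- The states `x_0, …, x_t` under a policy, started at `x_0 = 0`, for a given noise sequence. -/
def policyHist (π : Policy n d) (w : ℕ → Fin n → ℝ) : (t : ℕ) → Fin (t + 1) → Fin n → ℝ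
  | 0 => fun _ => 0
  | t + 1 =>
    Fin.snoc (α := fun _ => Fin n → ℝ) (policyHist π w t)
      (step sys (policyHist π w t (Fin.last t)) (π.act t (policyHist π w t)) (w t))

/-- The cost that a policy incurs at time `t`. -/
def policyCost (π : Policy n d) (w : ℕ → Fin n → ℝ) (t : ℕ) : ℝ :=
  cost sys (policyHist sys π w t (Fin.last t)) (π.act t (policyHist sys π w t))

/-- Infinite-horizon average cost of a policy (upper limit), when `w_t ∼ N(0, σw² I)` i.i.d. -/
noncomputable def avgCost (π : Policy n d) : ℝ≥0∞ :=
  limsup (fun T : ℕ =>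
    (∑ t ∈ Finset.Icc 1 T, ∫⁻ w, ENNReal.ofReal (policyCost sys π w t)
      ∂(Measure.infinitePi fun _ : ℕ => isoGaussian n sys.σw)) / (T : ℝ≥0∞)) atTop

/-- The optimal average cost over all causal policies. -/
noncomputable def optCost : ℝ≥0∞ := ⨅ π : Policy n d, avgCost sys π

/-- `J_⋆` as a real number. -/
noncomputable def Jstar : ℝ := (optCost sys).toReal

/-- The static linear policy `u_t = K x_t`. -/
def linearPolicy (K : Matrix (Fin d) (Fin n) ℝ) : Policy n d where
  act t h := K *ᵥ h (Fin.last t)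
  measurable_act t :=
    ((Matrix.mulVecLin K).continuous_of_finiteDimensional.measurable).comp
      (measurable_pi_apply (Fin.last t))

/-- `K` is the optimal LQR controller: it is stabilizing, and `u_t = K x_t` attains the optimal
average cost. -/
def IsOptimalController (K : Matrix (Fin d) (Fin n) ℝ) : Prop :=
  Stabilizes sys K ∧ avgCost sys (linearPolicy K) = optCost sys

/-! ### The general adaptive algorithm -/

/-- Length `T_i = Tmult 2^i` of epoch `i`. -/
def epochLen (Tmult i : ℕ) : ℕ := Tmult * 2 ^ i

/-- First time step `T_0 + ⋯ + T_{i-1} = Tmult (2^i - 1)` of epoch `i`. -/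
def epochStart (Tmult i : ℕ) : ℕ := Tmult * (2 ^ i - 1)

/-- The epoch that contains time step `t`. -/
def epochOf (Tmult t : ℕ) : ℕ := Nat.log 2 (t / Tmult + 1)

/-- Exploration standard deviation in epoch `i`: `σ_{η,i}² = σw² (1 / 2^i)^{1/(1+α)}`. -/
noncomputable def sigEta (α : ℝ) (i : ℕ) : ℝ :=
  Real.sqrt (sys.σw ^ 2 * (1 / 2 ^ i : ℝ) ^ (1 / (1 + α)))

/-- States of the system started at `x0` with inputs `u_t = K x_t + η_t`. -/
def rollout (K : Matrix (Fin d) (Fin n) ℝ) (x0 : Fin n → ℝ) (w : ℕ → Fin n → ℝ)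
    (η : ℕ → Fin d → ℝ) : ℕ → Fin n → ℝ
  | 0 => x0
  | t + 1 => step sys (rollout K x0 w η t) (K *ᵥ rollout K x0 w η t + η t) (w t)

/-- The data set `{(x_t, u_t, x_{t+1})}` of a rollout of `T` steps. -/
def dataset (K : Matrix (Fin d) (Fin n) ℝ) (x0 : Fin n → ℝ) (w : ℕ → Fin n → ℝ)
    (η : ℕ → Fin d → ℝ) (T : ℕ) : Fin T → (Fin n → ℝ) × (Fin d → ℝ) × (Fin n → ℝ) :=
  fun t => (rollout sys K x0 w η t, K *ᵥ rollout sys K x0 w η t + η t, rollout sys K x0 w η (t + 1))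

/-- The type of the subroutine `EstimateK`: from the controller that generated the data, and a data
set of any length, it computes a controller. -/
abbrev Estimator (n d : ℕ) : Type :=
  (T : ℕ) → Matrix (Fin d) (Fin n) ℝ → (Fin T → (Fin n → ℝ) × (Fin d → ℝ) × (Fin n → ℝ)) →
    Matrix (Fin d) (Fin n) ℝ

/-- All entries of the output of the subroutine depend measurably on its input. -/
def Estimator.IsMeasurable (Est : Estimator n d) : Prop :=
  ∀ (T : ℕ) (a : Fin d) (b : Fin n), Measurable
    fun z : (Fin d → Fin n → ℝ) × (Fin T → (Fin n → ℝ) × (Fin d → ℝ) × (Fin n → ℝ)) =>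
      Est T (Matrix.of z.1) z.2 a b

/-- Controller `K^{(i)}` and state `x_0^{(i)}` at the beginning of epoch `i` of the algorithm, for
given sequences `w`, `η` of process and exploration noise; `x_0^{(0)} = 0`. -/
def epoch (Est : Estimator n d) (Tmult : ℕ) (K0 : Matrix (Fin d) (Fin n) ℝ) (w : ℕ → Fin n → ℝ)
    (η : ℕ → Fin d → ℝ) : ℕ → Matrix (Fin d) (Fin n) ℝ × (Fin n → ℝ)
  | 0 => (K0, 0)
  | i + 1 =>
    let K := (epoch Est Tmult K0 w η i).1
    let x := (epoch Est Tmult K0 w η i).2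
    let w' : ℕ → Fin n → ℝ := fun t => w (epochStart Tmult i + t)
    let η' : ℕ → Fin d → ℝ := fun t => η (epochStart Tmult i + t)
    (Est (epochLen Tmult i) K (dataset sys K x w' η' (epochLen Tmult i)),
      rollout sys K x w' η' (epochLen Tmult i))

/-- The state `x_t` along the whole run (global time). -/
def stateAt (Est : Estimator n d) (Tmult : ℕ) (K0 : Matrix (Fin d) (Fin n) ℝ) (w : ℕ → Fin n → ℝ)
    (η : ℕ → Fin d → ℝ) (t : ℕ) : Fin n → ℝ :=
  let i := epochOf Tmult t
  let s := epochStart Tmult i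
  rollout sys (epoch sys Est Tmult K0 w η i).1 (epoch sys Est Tmult K0 w η i).2
    (fun k => w (s + k)) (fun k => η (s + k)) (t - s)

/-- The input `u_t = K^{(i)} x_t + η_t` along the whole run, with `i` the epoch of `t`. -/
def inputAt (Est : Estimator n d) (Tmult : ℕ) (K0 : Matrix (Fin d) (Fin n) ℝ) (w : ℕ → Fin n → ℝ)
    (η : ℕ → Fin d → ℝ) (t : ℕ) : Fin d → ℝ :=
  (epoch sys Est Tmult K0 w η (epochOf Tmult t)).1 *ᵥ stateAt sys Est Tmult K0 w η t + η t

/-- `Regret(T) = ∑_{t=1}^T (x_tᵀ S x_t + u_tᵀ R u_t) - T J_⋆`. -/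
noncomputable def regret (Est : Estimator n d) (Tmult : ℕ) (K0 : Matrix (Fin d) (Fin n) ℝ)
    (w : ℕ → Fin n → ℝ) (η : ℕ → Fin d → ℝ) (T : ℕ) : ℝ :=
  ∑ t ∈ Finset.Icc 1 T,
      cost sys (stateAt sys Est Tmult K0 w η t) (inputAt sys Est Tmult K0 w η t)
    - T * Jstar sys

/-! ### Randomness -/

variable {Ω : Type*} [MeasurableSpace Ω]

/-- The process noise `w_t ∼ N(0, σw² I)` and the exploration noise `η_t ∼ N(0, σ_{η,i}² I)`, with
`i` the epoch of `t`, all independent. -/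
structure IsNoise (μ : Measure Ω) (Tmult : ℕ) (α : ℝ) (w : ℕ → Ω → Fin n → ℝ)
    (η : ℕ → Ω → Fin d → ℝ) : Prop where
  measurable_w : ∀ t, Measurable (w t)
  measurable_η : ∀ t, Measurable (η t)
  law_w : ∀ t, μ.map (w t) = isoGaussian n sys.σw
  law_η : ∀ t, μ.map (η t) = isoGaussian d (sigEta sys α (epochOf Tmult t))
  indep_pair : ∀ t, IndepFun (w t) (η t) μ
  indep_time : iIndepFun (fun t ω => (w t ω, η t ω)) μ

/-- The σ-algebra generated by all noise before time `s`. -/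
abbrev past (w : ℕ → Ω → Fin n → ℝ) (η : ℕ → Ω → Fin d → ℝ) (s : ℕ) : MeasurableSpace Ω :=
  ⨆ t : Fin s, MeasurableSpace.comap (fun ω => (w t ω, η t ω)) inferInstance

/-- The random controller `K^{(i)}`. -/
def ctrl (Est : Estimator n d) (Tmult : ℕ) (K0 : Matrix (Fin d) (Fin n) ℝ)
    (w : ℕ → Ω → Fin n → ℝ) (η : ℕ → Ω → Fin d → ℝ) (i : ℕ) (ω : Ω) : Matrix (Fin d) (Fin n) ℝ :=
  (epoch sys Est Tmult K0 (fun t => w t ω) (fun t => η t ω) i).1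

/-- The random initial state `x_0^{(i)}` of epoch `i`. -/
def initState (Est : Estimator n d) (Tmult : ℕ) (K0 : Matrix (Fin d) (Fin n) ℝ)
    (w : ℕ → Ω → Fin n → ℝ) (η : ℕ → Ω → Fin d → ℝ) (i : ℕ) (ω : Ω) : Fin n → ℝ :=
  (epoch sys Est Tmult K0 (fun t => w t ω) (fun t => η t ω) i).2

/-- The matrix `E[x xᵀ | G]` of conditional second moments of a random vector. -/
noncomputable def condSecondMoment (μ : Measure Ω) (G : Set Ω) (x : Ω → Fin n → ℝ) :
    Matrix (Fin n) (Fin n) ℝ :=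
  Matrix.of fun a b => ∫ ω, x ω a * x ω b ∂(cond μ G)

/-- The assumption on the subroutine `EstimateK`. There are `C_req > 0` (decreasing), `C_err ≥ 0`
(increasing in both arguments) and `α ≥ 1` such that at every epoch `i` the following holds. Let `G`
be an event that is decided by the noise before the epoch, and on which `K^{(i)}` stabilizes
`(A, B)`; let `Σ_0^{(i)}` be the second-moment matrix of the initial state `x_0^{(i)}` given `G`.
If `ε < C_req(‖V^{(i)}‖)` and
`|D_i| ≥ C_err(‖V^{(i)}‖, ‖Σ_0^{(i)}‖) ε⁻² σ_{η,i}^{-2α} polylog(|D_i|, σ_{η,i}^{-α}, 1/δ, 1/ε)`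
on `G`, then `‖K^{(i+1)} - K_⋆‖ ≤ ε` on `G` up to an event of probability at most `δ`. -/
structure EstimateKAssumption (Est : Estimator n d) (Tmult : ℕ) (K0 Kstar : Matrix (Fin d) (Fin n) ℝ)
    (μ : Measure Ω) (w : ℕ → Ω → Fin n → ℝ) (η : ℕ → Ω → Fin d → ℝ)
    (Creq : ℝ → ℝ) (Cerr : ℝ → ℝ → ℝ) (α c : ℝ) (p : ℕ) : Prop where
  one_le_alpha : 1 ≤ α
  creq_pos : ∀ v, 0 ≤ v → 0 < Creq v
  creq_anti : ∀ v v', 0 ≤ v → v ≤ v' → Creq v' ≤ Creq v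
  cerr_nonneg : ∀ v s, 0 ≤ v → 0 ≤ s → 0 ≤ Cerr v s
  cerr_mono : ∀ v v' s s', 0 ≤ v → v ≤ v' → 0 ≤ s → s ≤ s' → Cerr v s ≤ Cerr v' s'
  guarantee : ∀ (i : ℕ) (G : Set Ω),
    MeasurableSet[past w η (epochStart Tmult i)] G →
    μ G ≠ 0 →
    (∀ ω ∈ G, Stabilizes sys (ctrl sys Est Tmult K0 w η i ω)) →
    (∀ a, MemLp (fun ω => initState sys Est Tmult K0 w η i ω a) 2 (cond μ G)) →
    ∀ ε δ : ℝ, 0 < ε → 0 < δ → δ < 1 →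
    (∀ ω ∈ G, ε < Creq ‖valueFn sys (ctrl sys Est Tmult K0 w η i ω)‖ ∧
      Cerr ‖valueFn sys (ctrl sys Est Tmult K0 w η i ω)‖
          ‖condSecondMoment μ G (initState sys Est Tmult K0 w η i)‖ / ε ^ 2
        * (1 / sigEta sys α i ^ (2 * α))
        * polylog c p [(epochLen Tmult i : ℝ), 1 / sigEta sys α i ^ α, 1 / δ, 1 / ε]
        ≤ (epochLen Tmult i : ℝ)) →
    μ.real (G ∩ {ω | ε < ‖ctrl sys Est Tmult K0 w η (i + 1) ω - Kstar‖}) ≤ δ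

end System

/-! ### The constants of the regret bound -/

section Constants

variable {n d : ℕ} (sys : System n d)

/-- `Γ_⋆ = 1 + max {‖A‖, ‖B‖, ‖V^{(0)}‖, ‖V_⋆‖, ‖K^{(0)}‖, ‖K_⋆‖, ‖S‖, ‖R‖}`. -/
noncomputable def Gam (K0 Kstar : Matrix (Fin d) (Fin n) ℝ) : ℝ :=
  1 + max ‖sys.A‖ (max ‖sys.B‖ (max ‖valueFn sys K0‖ (max ‖valueFn sys Kstar‖
    (max ‖K0‖ (max ‖Kstar‖ (max ‖sys.S‖ ‖sys.R‖))))))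

/-- `V_max = 4 Γ_⋆⁵ / λ_min(S)²`. -/
noncomputable def Vmax (K0 Kstar : Matrix (Fin d) (Fin n) ℝ) : ℝ :=
  4 * Gam sys K0 Kstar ^ 5 / lamMin sys.S ^ 2

/-- `Σ_max = 4 σw² n Γ_⋆⁴ / λ_min(S)²`. -/
noncomputable def SigMax (K0 Kstar : Matrix (Fin d) (Fin n) ℝ) : ℝ :=
  4 * sys.σw ^ 2 * n * Gam sys K0 Kstar ^ 4 / lamMin sys.S ^ 2

/-- `τ = √(‖V^{(0)}‖ / λ_min(S))`. -/
noncomputable def tau0 (K0 : Matrix (Fin d) (Fin n) ℝ) : ℝ :=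
  Real.sqrt (‖valueFn sys K0‖ / lamMin sys.S)

/-- `ρ̄ = (ρ + 1) / 2` with `ρ = √(1 - λ_min(S) / ‖V^{(0)}‖)`. -/
noncomputable def rhoBar (K0 : Matrix (Fin d) (Fin n) ℝ) : ℝ :=
  (Real.sqrt (1 - lamMin sys.S / ‖valueFn sys K0‖) + 1) / 2

end Constants

end AdaptiveLQR

/-! The excess cost of a stabilizing controller `K` is quadratic in `K - Kstar`, and the exploration
variance is scheduled so that the cost of inaccurate controllers and the cost of exploring grow at
the same rate.

Cost accounting. A static controller costs `σw² tr V(K)` per step (`avgCost_linear`). Comparing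
`Kstar` with the greedy controller of its own value function `V⋆` forces the Bellman equation
(`optimal_gain_eq`, `bellman`), so a step costs the drop of the form `V⋆` before process noise is
added, plus the form `M = R + Bᵀ V⋆ B` at `u - Kstar x = (K - Kstar) x + η`. The part of the latter
due to `K - Kstar` is again a drop, of the form `P = V(K) - V⋆` along the closed loop
(`quad_valueFn_sub`). Both drops telescope; only the changes of `P` between epochs leave bounded
jumps (`sum_P_le`). What remains (`cost_le`, `regret_le`) is linear or quadratic in fresh noise. The
quadratic terms have means governed by `σw² tr V⋆`, which cancels `J⋆`, by `tr P`, which is at most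
of order `d ε²`, and by `σ_η² tr M`, the price of exploration.

Stability. Controllers within the threshold `Near` contract in the norm of `V⋆` at the common rate
`ρ̄` (`contract_near`), and `K0` does so in the norm of `V0`. Since `V⋆ ≤ V0`, the potential `W`
never increases when the controller is replaced. Hence on the event `good i` that all earlier
estimates were accurate, second moments and value functions obey the bounds `SigMax` and `Vmax` that
enter the constants of the assumption. The assumption, applied with `G = good i`, then yields `good
(i + 1)` up to a small loss of probability (`one_sub_le_measure_good`). The accuracies are explicit
and small because `Tmult` is large (`accuracy_size`, `accuracy_small`).

Fluctuations. Exponential supermartingales control the linear and quadratic noise terms with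
predictable coefficients (`DrivenBy.linear_tail`, `DrivenBy.quad_tail`). Bounded noise and
contraction keep the state bounded, so the coefficients are bounded and all fluctuations are of
order `√T` up to a logarithm (`regret_le_of_typical`).

Summation. Up to logarithms and an additive constant, both `T_i ε_i²` and `T_i σ_{η,i}²` are
proportional to `2^i · 2^(-i/(1+α))`, a geometric growth dominated by the last epoch; this is the
power `α/(α+1)` of the time (`sum_trace_le`). -/

namespace AdaptiveLQR
open scoped Topology

/-! ### Quadratic forms and the operator norm -/

/-- The quadratic form `xᵀ M x`. -/
def quad {m : ℕ} (M : Matrix (Fin m) (Fin m) ℝ) (x : Fin m → ℝ) : ℝ := x ⬝ᵥ (M *ᵥ x)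

section Quad

variable {m l : ℕ}

lemma dot_self_nonneg (x : Fin m → ℝ) : 0 ≤ x ⬝ᵥ x :=
  Finset.sum_nonneg fun i _ => mul_self_nonneg (x i)

lemma norm_toLp_sq (x : Fin m → ℝ) : ‖(WithLp.toLp 2 x : EuclideanSpace ℝ (Fin m))‖ ^ 2 = x ⬝ᵥ x := by
  rw [EuclideanSpace.real_norm_sq_eq]
  simp [dotProduct, sq]

lemma norm_toLp_eq_sqrt (x : Fin m → ℝ) :
    ‖(WithLp.toLp 2 x : EuclideanSpace ℝ (Fin m))‖ = √(x ⬝ᵥ x) := by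
  rw [← norm_toLp_sq, Real.sqrt_sq (norm_nonneg _)]

lemma abs_dot_le (x y : Fin m → ℝ) : |x ⬝ᵥ y| ≤ √(x ⬝ᵥ x) * √(y ⬝ᵥ y) := by
  have := abs_real_inner_le_norm (WithLp.toLp 2 y : EuclideanSpace ℝ (Fin m)) (WithLp.toLp 2 x)
  rw [norm_toLp_eq_sqrt, norm_toLp_eq_sqrt, mul_comm] at this
  simpa [EuclideanSpace.inner_eq_star_dotProduct] using this

lemma norm_toLp_mulVec_le (M : Matrix (Fin m) (Fin l) ℝ) (x : Fin l → ℝ) :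
    √((M *ᵥ x) ⬝ᵥ (M *ᵥ x)) ≤ ‖M‖ * √(x ⬝ᵥ x) := by
  rw [← norm_toLp_eq_sqrt, ← norm_toLp_eq_sqrt]
  exact Matrix.l2_opNorm_mulVec M (WithLp.toLp 2 x)

lemma mulVec_dot_self_le (M : Matrix (Fin m) (Fin l) ℝ) (x : Fin l → ℝ) :
    (M *ᵥ x) ⬝ᵥ (M *ᵥ x) ≤ ‖M‖ ^ 2 * (x ⬝ᵥ x) := by
  have h := norm_toLp_mulVec_le M x
  have h2 := pow_le_pow_left₀ (Real.sqrt_nonneg _) h 2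
  rwa [mul_pow, Real.sq_sqrt (dot_self_nonneg _), Real.sq_sqrt (dot_self_nonneg _)] at h2

lemma abs_dot_mulVec_le (M : Matrix (Fin m) (Fin l) ℝ) (y : Fin m → ℝ) (x : Fin l → ℝ) :
    |y ⬝ᵥ (M *ᵥ x)| ≤ ‖M‖ * (√(y ⬝ᵥ y) * √(x ⬝ᵥ x)) := by
  refine (abs_dot_le _ _).trans ?_
  calc _ ≤ √(y ⬝ᵥ y) * (‖M‖ * √(x ⬝ᵥ x)) :=
        mul_le_mul_of_nonneg_left (norm_toLp_mulVec_le M x) (Real.sqrt_nonneg _)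
    _ = _ := by ring

lemma abs_quad_le (M : Matrix (Fin m) (Fin m) ℝ) (x : Fin m → ℝ) :
    |quad M x| ≤ ‖M‖ * (x ⬝ᵥ x) := by
  have := abs_dot_mulVec_le M x x
  rwa [Real.mul_self_sqrt (dot_self_nonneg _)] at this

lemma quad_le (M : Matrix (Fin m) (Fin m) ℝ) (x : Fin m → ℝ) :
    quad M x ≤ ‖M‖ * (x ⬝ᵥ x) := (le_abs_self _).trans (abs_quad_le M x)

lemma norm_le_of_sqrt_dot_le (M : Matrix (Fin m) (Fin l) ℝ) {c : ℝ} (hc : 0 ≤ c)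
    (h : ∀ x : Fin l → ℝ, √((M *ᵥ x) ⬝ᵥ (M *ᵥ x)) ≤ c * √(x ⬝ᵥ x)) : ‖M‖ ≤ c := by
  rw [Matrix.l2_opNorm_def]
  refine ContinuousLinearMap.opNorm_le_bound _ hc fun x => ?_
  have := h x.ofLp
  rw [← norm_toLp_eq_sqrt, ← norm_toLp_eq_sqrt] at this
  exact this

lemma norm_le_of_dot_le (M : Matrix (Fin m) (Fin l) ℝ) {c : ℝ} (hc : 0 ≤ c)
    (h : ∀ x : Fin l → ℝ, (M *ᵥ x) ⬝ᵥ (M *ᵥ x) ≤ c ^ 2 * (x ⬝ᵥ x)) : ‖M‖ ≤ c := by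
  refine norm_le_of_sqrt_dot_le M hc fun x => ?_
  rw [← Real.sqrt_sq hc, ← Real.sqrt_mul (sq_nonneg c)]
  exact Real.sqrt_le_sqrt (h x)

lemma norm_le_of_bilin_le (M : Matrix (Fin m) (Fin l) ℝ) {c : ℝ} (hc : 0 ≤ c)
    (h : ∀ y x, y ⬝ᵥ (M *ᵥ x) ≤ c * (√(y ⬝ᵥ y) * √(x ⬝ᵥ x))) : ‖M‖ ≤ c := by
  refine norm_le_of_sqrt_dot_le M hc fun x => ?_
  have h1 := h (M *ᵥ x) x
  set s := √((M *ᵥ x) ⬝ᵥ (M *ᵥ x)) with hs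
  have hss : (M *ᵥ x) ⬝ᵥ (M *ᵥ x) = s * s := (Real.mul_self_sqrt (dot_self_nonneg _)).symm
  rw [hss] at h1
  rcases (Real.sqrt_nonneg ((M *ᵥ x) ⬝ᵥ (M *ᵥ x))).eq_or_lt with h0 | h0
  · rw [hs, ← h0]; positivity
  · refine le_of_mul_le_mul_left ?_ h0
    calc s * s ≤ _ := h1
      _ = _ := by ring

lemma norm_transpose (M : Matrix (Fin m) (Fin l) ℝ) : ‖Mᵀ‖ = ‖M‖ := by
  have := Matrix.l2_opNorm_conjTranspose (𝕜 := ℝ) M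
  rwa [Matrix.conjTranspose_eq_transpose_of_trivial] at this

lemma quad_add_left (M N : Matrix (Fin m) (Fin m) ℝ) (x) :
    quad (M + N) x = quad M x + quad N x := by
  simp [quad, Matrix.add_mulVec]

lemma quad_sub_left (M N : Matrix (Fin m) (Fin m) ℝ) (x) :
    quad (M - N) x = quad M x - quad N x := by
  simp [quad, Matrix.sub_mulVec]

lemma quad_smul_left (c : ℝ) (M : Matrix (Fin m) (Fin m) ℝ) (x) :
    quad (c • M) x = c * quad M x := by
  simp [quad, Matrix.smul_mulVec]

@[simp] lemma quad_zero_left (x : Fin m → ℝ) : quad 0 x = 0 := by simp [quad]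

@[simp] lemma quad_zero_right (M : Matrix (Fin m) (Fin m) ℝ) : quad M 0 = 0 := by simp [quad]

@[simp] lemma quad_one (x : Fin m → ℝ) : quad 1 x = x ⬝ᵥ x := by simp [quad]

lemma dot_mulVec_comm (M : Matrix (Fin m) (Fin l) ℝ) (y : Fin m → ℝ) (x : Fin l → ℝ) :
    y ⬝ᵥ (M *ᵥ x) = (Mᵀ *ᵥ y) ⬝ᵥ x := by
  rw [Matrix.dotProduct_mulVec, Matrix.mulVec_transpose]

lemma quad_conj (M : Matrix (Fin m) (Fin m) ℝ) (L : Matrix (Fin m) (Fin l) ℝ) (x : Fin l → ℝ) :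
    quad (Lᵀ * M * L) x = quad M (L *ᵥ x) := by
  simp only [quad]
  rw [dot_mulVec_comm M, dot_mulVec_comm (Lᵀ * M * L)]
  rw [dot_mulVec_comm L]
  simp [Matrix.mulVec_mulVec, Matrix.transpose_mul, Matrix.mul_assoc]

lemma symm_dot {M : Matrix (Fin m) (Fin m) ℝ} (hM : Mᵀ = M) (x y : Fin m → ℝ) :
    x ⬝ᵥ (M *ᵥ y) = y ⬝ᵥ (M *ᵥ x) := by
  rw [dot_mulVec_comm, hM, dotProduct_comm]

lemma quad_add_right {M : Matrix (Fin m) (Fin m) ℝ} (hM : Mᵀ = M) (x y : Fin m → ℝ) :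
    quad M (x + y) = quad M x + 2 * (x ⬝ᵥ (M *ᵥ y)) + quad M y := by
  simp only [quad, Matrix.mulVec_add, add_dotProduct, dotProduct_add]
  rw [symm_dot hM y x]; ring

lemma quad_smul_right (M : Matrix (Fin m) (Fin m) ℝ) (c : ℝ) (x : Fin m → ℝ) :
    quad M (c • x) = c ^ 2 * quad M x := by
  simp only [quad, Matrix.mulVec_smul, smul_dotProduct, dotProduct_smul, smul_eq_mul]; ring

/-- The form is nonnegative at `x - y`, which bounds the cross term. -/
lemma quad_add_le {M : Matrix (Fin m) (Fin m) ℝ} (hM : Mᵀ = M) (h0 : ∀ x, 0 ≤ quad M x)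
    (x y : Fin m → ℝ) : quad M (x + y) ≤ 2 * quad M x + 2 * quad M y := by
  have h := h0 (x + (-1 : ℝ) • y)
  rw [quad_add_right hM, quad_smul_right, Matrix.mulVec_smul, dotProduct_smul, smul_eq_mul] at h
  rw [quad_add_right hM]
  linarith

/-- Cauchy–Schwarz for a positive semidefinite form. -/
lemma sq_dot_mulVec_le {M : Matrix (Fin m) (Fin m) ℝ} (hM : Mᵀ = M) (h0 : ∀ x, 0 ≤ quad M x)
    (x y : Fin m → ℝ) : (x ⬝ᵥ (M *ᵥ y)) ^ 2 ≤ quad M x * quad M y := by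
  have h : ∀ t : ℝ, 0 ≤ quad M y * (t * t) + 2 * (x ⬝ᵥ (M *ᵥ y)) * t + quad M x := fun t => by
    have := h0 (x + t • y)
    rw [quad_add_right hM, quad_smul_right, Matrix.mulVec_smul, dotProduct_smul, smul_eq_mul] at this
    linarith
  have := discrim_le_zero h
  rw [discrim] at this
  linarith

/-- `|M x|² ≤ b xᵀ M x` if `0 ≤ M ≤ b`. -/
lemma mulVec_dot_self_le_quad {M : Matrix (Fin m) (Fin m) ℝ} (hM : Mᵀ = M)
    (h0 : ∀ x, 0 ≤ quad M x) {b : ℝ} (hb : ∀ x, quad M x ≤ b * (x ⬝ᵥ x)) (x : Fin m → ℝ) :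
    (M *ᵥ x) ⬝ᵥ (M *ᵥ x) ≤ b * quad M x := by
  -- Cauchy–Schwarz for the form at the pair `M x`, `x` has `|M x|⁴` on the left and `b |M x|²`
  -- times the form at `x` on the right; one factor `|M x|²` is then cancelled.
  have h1 := sq_dot_mulVec_le hM h0 (M *ᵥ x) x
  have h2 := hb (M *ᵥ x)
  have h3 := h0 x
  set s := (M *ᵥ x) ⬝ᵥ (M *ᵥ x) with hs
  have hs0 : 0 ≤ s := dot_self_nonneg _
  rcases hs0.eq_or_lt with h | h
  · rw [← h]
    rcases (dot_self_nonneg x).eq_or_lt with hx | hx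
    · have hx0 : x = 0 := dotProduct_self_eq_zero.1 hx.symm
      simp [hx0]
    · exact mul_nonneg (nonneg_of_mul_nonneg_left (h3.trans (hb x)) hx) h3
  · have : s ^ 2 ≤ (b * s) * quad M x := h1.trans (mul_le_mul_of_nonneg_right h2 h3)
    nlinarith

/-- The triangle inequality for operators in the seminorm `√(quad V)`. It measures how much a
perturbation of the closed loop worsens its contraction rate. -/
lemma quad_add_mulVec_le {V : Matrix (Fin m) (Fin m) ℝ} (hV : Vᵀ = V) (h0 : ∀ x, 0 ≤ quad V x)
    {L Δ : Matrix (Fin m) (Fin m) ℝ} {r s : ℝ} (hr : 0 ≤ r) (hs : 0 ≤ s)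
    (hL : ∀ x, quad V (L *ᵥ x) ≤ r ^ 2 * quad V x) (hΔ : ∀ x, quad V (Δ *ᵥ x) ≤ s ^ 2 * quad V x)
    (x : Fin m → ℝ) : quad V ((L + Δ) *ᵥ x) ≤ (r + s) ^ 2 * quad V x := by
  rw [Matrix.add_mulVec, quad_add_right hV]
  have h1 := sq_dot_mulVec_le hV h0 (L *ᵥ x) (Δ *ᵥ x)
  have h2 : (L *ᵥ x) ⬝ᵥ (V *ᵥ (Δ *ᵥ x)) ≤ r * s * quad V x := by
    refine abs_le_of_sq_le_sq' ?_ (mul_nonneg (mul_nonneg hr hs) (h0 x)) |>.2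
    refine h1.trans ((mul_le_mul (hL x) (hΔ x) (h0 _)
      (mul_nonneg (sq_nonneg _) (h0 _))).trans (le_of_eq ?_))
    ring
  linarith [hL x, hΔ x]

lemma trace_eq_sum_quad (M : Matrix (Fin m) (Fin m) ℝ) :
    M.trace = ∑ i, quad M (Pi.single i 1) := by
  simp [Matrix.trace, quad]

lemma trace_nonneg_of_quad {M : Matrix (Fin m) (Fin m) ℝ} (h : ∀ x, 0 ≤ quad M x) : 0 ≤ M.trace := by
  rw [trace_eq_sum_quad]; exact Finset.sum_nonneg fun i _ => h _

lemma trace_le_of_quad_le {M : Matrix (Fin m) (Fin m) ℝ} {b : ℝ}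
    (h : ∀ x, quad M x ≤ b * (x ⬝ᵥ x)) : M.trace ≤ m * b := by
  rw [trace_eq_sum_quad]
  refine (Finset.sum_le_card_nsmul _ _ b fun i _ => ?_).trans (by simp)
  simpa using h (Pi.single i 1)

lemma trace_le_norm (M : Matrix (Fin m) (Fin m) ℝ) : M.trace ≤ m * ‖M‖ :=
  trace_le_of_quad_le (quad_le M)

/-- Cyclicity of the trace turns the `m × m` product into an `l × l` one. This is why the input
dimension `d`, not `n`, multiplies the leading regret term. -/
lemma trace_conj_le {M : Matrix (Fin l) (Fin l) ℝ} (X : Matrix (Fin l) (Fin m) ℝ) :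
    (Xᵀ * M * X).trace ≤ l * (‖M‖ * ‖X‖ ^ 2) := by
  rw [Matrix.mul_assoc, Matrix.trace_mul_comm, Matrix.mul_assoc]
  refine (trace_le_norm _).trans (mul_le_mul_of_nonneg_left ?_ (Nat.cast_nonneg _))
  calc _ ≤ ‖M‖ * (‖X‖ * ‖Xᵀ‖) := (Matrix.l2_opNorm_mul _ _).trans
        (mul_le_mul_of_nonneg_left (Matrix.l2_opNorm_mul _ _) (norm_nonneg _))
    _ = _ := by rw [norm_transpose]; ring

open scoped MatrixOrder in
lemma exists_transpose_mul_self {P : Matrix (Fin m) (Fin m) ℝ} (hP : P.PosSemidef) :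
    ∃ Y : Matrix (Fin m) (Fin m) ℝ, P = Yᵀ * Y := by
  obtain ⟨Y, hY⟩ := CStarAlgebra.nonneg_iff_eq_star_mul_self.mp hP.nonneg
  exact ⟨Y, by rwa [Matrix.star_eq_conjTranspose, Matrix.conjTranspose_eq_transpose_of_trivial] at hY⟩

lemma quad_transpose_mul_self (Y : Matrix (Fin m) (Fin m) ℝ) (x : Fin m → ℝ) :
    quad (Yᵀ * Y) x = ∑ i, (Y i ⬝ᵥ x) ^ 2 := by
  rw [quad, ← Matrix.mulVec_mulVec, dot_mulVec_comm, Matrix.transpose_transpose]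
  simp [dotProduct, Matrix.mulVec, sq]

lemma trace_transpose_mul_self (Y : Matrix (Fin m) (Fin m) ℝ) :
    (Yᵀ * Y).trace = ∑ i, Y i ⬝ᵥ Y i := by
  rw [Matrix.trace_mul_comm]
  simp [Matrix.trace, Matrix.mul_apply, dotProduct]

/-- A positive semidefinite form is a sum of squares of linear forms. -/
lemma exists_sum_sq {P : Matrix (Fin m) (Fin m) ℝ} (hP : P.PosSemidef) :
    ∃ y : Fin m → Fin m → ℝ, (∀ x, quad P x = ∑ i, (y i ⬝ᵥ x) ^ 2) ∧ P.trace = ∑ i, y i ⬝ᵥ y i := by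
  obtain ⟨Y, rfl⟩ := exists_transpose_mul_self hP
  exact ⟨fun i => Y i, quad_transpose_mul_self Y, trace_transpose_mul_self Y⟩

/-- `tr (Bᵀ P B) ≤ ‖B‖² tr P` for positive semidefinite `P`. -/
lemma trace_conj_le_trace {P : Matrix (Fin m) (Fin m) ℝ} (hP : P.PosSemidef)
    (B : Matrix (Fin m) (Fin l) ℝ) : (Bᵀ * P * B).trace ≤ ‖B‖ ^ 2 * P.trace := by
  obtain ⟨Y, rfl⟩ := exists_transpose_mul_self hP
  have h1 : (Bᵀ * (Yᵀ * Y) * B).trace = ∑ i, (Bᵀ *ᵥ Y i) ⬝ᵥ (Bᵀ *ᵥ Y i) := by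
    have : Bᵀ * (Yᵀ * Y) * B = (Bᵀ * Yᵀ) * (Y * B) := by simp [Matrix.mul_assoc]
    rw [this, Matrix.trace_mul_comm]
    simp only [Matrix.trace, Matrix.diag, Matrix.mul_apply, dotProduct, Matrix.mulVec,
      Matrix.transpose_apply]
    refine Finset.sum_congr rfl fun i _ => Finset.sum_congr rfl fun j _ => ?_
    congr 1; exact Finset.sum_congr rfl fun k _ => mul_comm _ _
  rw [h1, trace_transpose_mul_self, Finset.mul_sum, ← norm_transpose]
  exact Finset.sum_le_sum fun i _ => mulVec_dot_self_le _ _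

lemma posSemidef_of_quad {P : Matrix (Fin m) (Fin m) ℝ} (hP : Pᵀ = P) (h : ∀ x, 0 ≤ quad P x) :
    P.PosSemidef := by
  refine Matrix.PosSemidef.of_dotProduct_mulVec_nonneg ?_ ?_
  · rw [Matrix.IsHermitian, Matrix.conjTranspose_eq_transpose_of_trivial, hP]
  · intro x; simpa [quad] using h x

lemma transpose_eq_of_posDef {P : Matrix (Fin m) (Fin m) ℝ} (hP : P.PosDef) : Pᵀ = P := by
  have := hP.isHermitian
  rwa [Matrix.IsHermitian, Matrix.conjTranspose_eq_transpose_of_trivial] at this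

lemma quad_pos_of_posDef {P : Matrix (Fin m) (Fin m) ℝ} (hP : P.PosDef) {x : Fin m → ℝ}
    (hx : x ≠ 0) : 0 < quad P x := by
  simpa [quad] using hP.dotProduct_mulVec_pos hx

lemma quad_nonneg_of_posDef {P : Matrix (Fin m) (Fin m) ℝ} (hP : P.PosDef) (x : Fin m → ℝ) :
    0 ≤ quad P x := by
  simpa [quad] using hP.posSemidef.dotProduct_mulVec_nonneg x

/-! ### The smallest eigenvalue -/

/-- The spectrum must be nonempty, because `sInf ∅ = 0`. Being finite, it then contains its infimum.
-/
lemma lamMin_pos [NeZero m] {S : Matrix (Fin m) (Fin m) ℝ} (hS : S.PosDef) : 0 < lamMin S := by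
  rw [lamMin, hS.isHermitian.spectrum_real_eq_range_eigenvalues]
  have hne : (Set.range hS.isHermitian.eigenvalues).Nonempty := Set.range_nonempty _
  obtain ⟨i, hi⟩ := hne.csInf_mem (Set.finite_range _)
  rw [← hi]
  exact hS.eigenvalues_pos i

/-- By the spectral theorem `S - lamMin S • 1` is conjugate to a diagonal matrix with nonnegative
entries. -/
lemma lamMin_mul_le_quad {S : Matrix (Fin m) (Fin m) ℝ} (hS : S.PosDef) (x : Fin m → ℝ) :
    lamMin S * (x ⬝ᵥ x) ≤ quad S x := by
  have hH := hS.isHermitian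
  have hle : ∀ i, lamMin S ≤ hH.eigenvalues i := fun i => by
    rw [lamMin, hH.spectrum_real_eq_range_eigenvalues]
    exact csInf_le (Set.finite_range _).bddBelow ⟨i, rfl⟩
  have hpsd : (S - lamMin S • (1 : Matrix (Fin m) (Fin m) ℝ)).PosSemidef := by
    have hU := hH.spectral_theorem
    set U := hH.eigenvectorUnitary
    have h1 : S - lamMin S • (1 : Matrix (Fin m) (Fin m) ℝ) =
        Unitary.conjStarAlgAut ℝ _ U
          (Matrix.diagonal (fun i => hH.eigenvalues i - lamMin S)) := by
      have : (Matrix.diagonal (fun i => hH.eigenvalues i - lamMin S)) =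
          Matrix.diagonal (RCLike.ofReal ∘ hH.eigenvalues) -
            lamMin S • (1 : Matrix (Fin m) (Fin m) ℝ) := by
        ext i j; by_cases h : i = j <;> simp [h]
      rw [this, map_sub, map_smul, map_one, ← hU]
    rw [h1, Unitary.conjStarAlgAut_apply]
    have hd : (Matrix.diagonal (fun i => hH.eigenvalues i - lamMin S)).PosSemidef :=
      Matrix.posSemidef_diagonal_iff.2 fun i => sub_nonneg.2 (hle i)
    exact hd.mul_mul_conjTranspose_same _
  have := hpsd.dotProduct_mulVec_nonneg x
  have h2 : 0 ≤ quad (S - lamMin S • (1 : Matrix (Fin m) (Fin m) ℝ)) x := by simpa [quad] using this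
  rw [quad_sub_left, quad_smul_left, quad_one] at h2
  linarith

end Quad

end AdaptiveLQR

namespace AdaptiveLQR
open scoped Topology

/-! ### Stable matrices and Lyapunov equations -/

section Lyapunov

variable {m : ℕ}

lemma geom_sum_le_inv {x : ℝ} (h0 : 0 ≤ x) (h1 : x < 1) (N : ℕ) :
    ∑ k ∈ Finset.range N, x ^ k ≤ (1 - x)⁻¹ :=
  sum_le_hasSum _ (fun i _ => pow_nonneg h0 i) (hasSum_geometric_of_lt_one h0 h1)

lemma tendsto_matrix_iff {𝕜 : Type*} [RCLike 𝕜] {f : ℕ → Matrix (Fin m) (Fin m) 𝕜}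
    {M : Matrix (Fin m) (Fin m) 𝕜} :
    Tendsto f atTop (𝓝 M) ↔ ∀ i j, Tendsto (fun k => f k i j) atTop (𝓝 (M i j)) := by
  refine ⟨fun h i j => ((continuous_id.matrix_elem i j).tendsto M).comp h, fun h => ?_⟩
  exact tendsto_pi_nhds.2 fun i => tendsto_pi_nhds.2 fun j => h i j

lemma map_ofReal_pow (L : Matrix (Fin m) (Fin m) ℝ) (k : ℕ) :
    (L.map (fun x : ℝ => (x : ℂ))) ^ k = (L ^ k).map (fun x : ℝ => (x : ℂ)) :=
  (Matrix.map_pow L (Complex.ofRealHom : ℝ →+* ℂ) k).symm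

/-- Gelfand's formula: with `s` strictly between the spectral radius and one, the norms of the
powers are eventually at most `s ^ k`. -/
lemma tendsto_pow_of_isStable {L : Matrix (Fin m) (Fin m) ℝ} (hL : IsStable L) :
    Tendsto (fun k => L ^ k) atTop (𝓝 0) := by
  set a : Matrix (Fin m) (Fin m) ℂ := L.map (fun x : ℝ => (x : ℂ)) with ha
  have h1 := spectrum.pow_nnnorm_pow_one_div_tendsto_nhds_spectralRadius a
  obtain ⟨s, hs1, hs2⟩ := exists_between (show spectralRadius ℂ a < 1 from hL)
  lift s to NNReal using (hs2.trans ENNReal.one_lt_top).ne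
  have h2 : ∀ᶠ k : ℕ in atTop, ‖a ^ k‖ ≤ (s : ℝ) ^ k := by
    filter_upwards [h1.eventually_lt_const hs1, eventually_gt_atTop 0] with k hk hk0
    have h3 := ENNReal.rpow_lt_rpow hk (show (0 : ℝ) < k by exact_mod_cast hk0)
    rw [← ENNReal.rpow_mul, one_div, inv_mul_cancel₀ (by exact_mod_cast hk0.ne'),
      ENNReal.rpow_one, ENNReal.rpow_natCast] at h3
    have h4 : ‖a ^ k‖₊ ≤ s ^ k := by exact_mod_cast h3.le
    exact_mod_cast h4
  have h5 : Tendsto (fun k => a ^ k) atTop (𝓝 0) := by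
    refine squeeze_zero_norm' h2 (tendsto_pow_atTop_nhds_zero_of_lt_one s.2 ?_)
    exact_mod_cast hs2
  refine tendsto_matrix_iff.2 fun i j => ?_
  have h7 := (Complex.continuous_re.tendsto _).comp (tendsto_matrix_iff.1 h5 i j)
  simpa [ha, map_ofReal_pow, Function.comp_def] using h7

/-- The spectral radius is at most the `(k+1)`-st root of `‖a ^ (k+1)‖ ‖1‖`, for every `k`; a single
`k` with small enough power suffices. -/
lemma isStable_of_tendsto_pow {L : Matrix (Fin m) (Fin m) ℝ}
    (hL : Tendsto (fun k => L ^ k) atTop (𝓝 0)) : IsStable L := by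
  set a : Matrix (Fin m) (Fin m) ℂ := L.map (fun x : ℝ => (x : ℂ)) with ha
  have h1 : Tendsto (fun k => a ^ k) atTop (𝓝 0) := by
    refine tendsto_matrix_iff.2 fun i j => ?_
    have h7 := (Complex.continuous_ofReal.tendsto _).comp (tendsto_matrix_iff.1 hL i j)
    simpa [ha, map_ofReal_pow, Function.comp_def] using h7
  have h2 : Tendsto (fun k => ‖a ^ (k + 1)‖₊ * (‖(1 : Matrix (Fin m) (Fin m) ℂ)‖₊ + 1)) atTop (𝓝 0) := by
    have := ((h1.comp (tendsto_add_atTop_nat 1)).nnnorm).mul_const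
      (‖(1 : Matrix (Fin m) (Fin m) ℂ)‖₊ + 1)
    simpa using this
  obtain ⟨k, hk⟩ := (h2.eventually_lt_const zero_lt_one).exists
  refine (spectrum.spectralRadius_le_pow_nnnorm_pow_one_div ℂ a k).trans_lt ?_
  have hp : (0 : ℝ) < 1 / (k + 1) := by positivity
  rw [← ENNReal.mul_rpow_of_nonneg _ _ hp.le]
  refine ENNReal.rpow_lt_one ?_ hp
  refine lt_of_le_of_lt ?_ (show ((‖a ^ (k + 1)‖₊ * (‖(1 : Matrix (Fin m) (Fin m) ℂ)‖₊ + 1) : NNReal) : ℝ≥0∞) < 1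
    by exact_mod_cast hk)
  rw [← ENNReal.coe_mul]
  refine ENNReal.coe_le_coe.2 (mul_le_mul_right (le_add_of_nonneg_right zero_le_one) _)

lemma tendsto_conj_pow {L : Matrix (Fin m) (Fin m) ℝ} (hL : Tendsto (fun k => L ^ k) atTop (𝓝 0))
    (P : Matrix (Fin m) (Fin m) ℝ) : Tendsto (fun k => (L ^ k)ᵀ * P * L ^ k) atTop (𝓝 0) := by
  have h1 : Tendsto (fun k => (L ^ k)ᵀ) atTop (𝓝 0) := by
    have := ((continuous_id.matrix_transpose).tendsto (0 : Matrix (Fin m) (Fin m) ℝ)).comp hL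
    simpa [Function.comp_def] using this
  simpa using (h1.mul_const P).mul hL

lemma lyapunov_iterate {L P Q : Matrix (Fin m) (Fin m) ℝ} (h : P = Lᵀ * P * L + Q) (N : ℕ) :
    P = (L ^ N)ᵀ * P * L ^ N + ∑ k ∈ Finset.range N, (L ^ k)ᵀ * Q * L ^ k := by
  induction N with
  | zero => simp
  | succ N ih =>
    rw [Finset.sum_range_succ]
    have : (L ^ N)ᵀ * P * L ^ N = (L ^ (N + 1))ᵀ * P * L ^ (N + 1) + (L ^ N)ᵀ * Q * L ^ N := by
      conv_lhs => rw [h]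
      rw [pow_succ', Matrix.transpose_mul]
      simp only [Matrix.mul_add, Matrix.add_mul, Matrix.mul_assoc]
    rw [← add_assoc, add_right_comm, ← this]
    exact ih

lemma tendsto_lyapunov_sum {L P Q : Matrix (Fin m) (Fin m) ℝ} (h : P = Lᵀ * P * L + Q)
    (hL : Tendsto (fun k => L ^ k) atTop (𝓝 0)) :
    Tendsto (fun N => ∑ k ∈ Finset.range N, (L ^ k)ᵀ * Q * L ^ k) atTop (𝓝 P) := by
  have h1 : (fun N => ∑ k ∈ Finset.range N, (L ^ k)ᵀ * Q * L ^ k) =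
      fun N => P - (L ^ N)ᵀ * P * L ^ N := by
    funext N
    nth_rewrite 1 [lyapunov_iterate h N]
    abel
  rw [h1]
  simpa using (tendsto_conj_pow hL P).const_sub P

/-- The map `P ↦ P - Lᵀ P L` is linear on a finite-dimensional space, so injectivity is enough. A
solution of the homogeneous equation is the limit of its own source sums, which vanish. -/
lemma existsUnique_lyapunov {L : Matrix (Fin m) (Fin m) ℝ}
    (hL : Tendsto (fun k => L ^ k) atTop (𝓝 0)) (Q : Matrix (Fin m) (Fin m) ℝ) :
    ∃! P : Matrix (Fin m) (Fin m) ℝ, P = Lᵀ * P * L + Q := by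
  let f : Matrix (Fin m) (Fin m) ℝ →ₗ[ℝ] Matrix (Fin m) (Fin m) ℝ :=
    LinearMap.id - (LinearMap.mulLeft ℝ Lᵀ).comp (LinearMap.mulRight ℝ L)
  have hf : ∀ P, f P = P - Lᵀ * P * L := fun P => by simp [f, Matrix.mul_assoc]
  have hinj : Function.Injective f := by
    rw [← LinearMap.ker_eq_bot, LinearMap.ker_eq_bot']
    intro P hP
    rw [hf, sub_eq_zero] at hP
    have h0 : P = Lᵀ * P * L + 0 := by rwa [add_zero]
    have := tendsto_lyapunov_sum h0 hL
    simp only [mul_zero, zero_mul, Finset.sum_const_zero] at this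
    exact (tendsto_nhds_unique this tendsto_const_nhds)
  obtain ⟨P, hP⟩ := (LinearMap.injective_iff_surjective.1 hinj) Q
  refine ⟨P, ?_, fun P' hP' => hinj ?_⟩
  · rw [hf] at hP; rw [← hP]; simp
  · rw [hP, hf]; exact sub_eq_of_eq_add' hP'

lemma dlyap_eq {L : Matrix (Fin m) (Fin m) ℝ} (hL : IsStable L) (Q : Matrix (Fin m) (Fin m) ℝ) :
    dlyap L Q = Lᵀ * dlyap L Q * L + Q := by
  have h := existsUnique_lyapunov (tendsto_pow_of_isStable hL) Q
  rw [dlyap, dif_pos h]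
  exact h.choose_spec.1

lemma lyapunov_transpose {L P Q : Matrix (Fin m) (Fin m) ℝ} (h : P = Lᵀ * P * L + Q)
    (hL : IsStable L) (hQ : Qᵀ = Q) : Pᵀ = P := by
  refine (existsUnique_lyapunov (tendsto_pow_of_isStable hL) Q).unique ?_ h
  conv_lhs => rw [h]
  simp [hQ, Matrix.mul_assoc]

lemma tendsto_quad_pow {L : Matrix (Fin m) (Fin m) ℝ}
    (hL : Tendsto (fun k => L ^ k) atTop (𝓝 0)) (X : Matrix (Fin m) (Fin m) ℝ) (x : Fin m → ℝ) :
    Tendsto (fun k => quad X (L ^ k *ᵥ x)) atTop (𝓝 0) := by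
  have h1 := tendsto_conj_pow hL X
  have hc : Continuous fun M : Matrix (Fin m) (Fin m) ℝ => quad M x := by
    unfold quad; fun_prop
  have := (hc.tendsto 0).comp h1
  simpa only [Function.comp_def, quad_conj, quad_zero_left] using this

/-- Comparison principle for Lyapunov inequalities. -/
lemma quad_nonneg_of_lyapunov {L X : Matrix (Fin m) (Fin m) ℝ} (hL : IsStable L)
    (h : ∀ x, quad X (L *ᵥ x) ≤ quad X x) (x : Fin m → ℝ) : 0 ≤ quad X x := by
  -- The form does not increase along an orbit, and it tends to zero because the orbit does; hence
  -- it starts nonnegative.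
  have h1 : ∀ k, quad X (L ^ k *ᵥ x) ≤ quad X x := fun k => by
    induction k with
    | zero => simp
    | succ k ih =>
      rw [pow_succ', ← Matrix.mulVec_mulVec]
      exact (h _).trans ih
  exact le_of_tendsto' (tendsto_quad_pow (tendsto_pow_of_isStable hL) X x) h1

lemma norm_lyapunov_le {L P Q : Matrix (Fin m) (Fin m) ℝ} (h : P = Lᵀ * P * L + Q)
    (hL : IsStable L) {τ ρ : ℝ} (hρ0 : 0 ≤ ρ) (hρ1 : ρ < 1)
    (hτ : ∀ k : ℕ, ‖L ^ k‖ ≤ τ * ρ ^ k) : ‖P‖ ≤ ‖Q‖ * τ ^ 2 / (1 - ρ ^ 2) := by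
  have h1 := (tendsto_lyapunov_sum h (tendsto_pow_of_isStable hL)).norm
  refine le_of_tendsto' h1 fun N => ?_
  have hρ2 : ρ ^ 2 < 1 := by nlinarith
  have hτ0 : 0 ≤ τ := by simpa using (norm_nonneg _).trans (hτ 0)
  calc _ ≤ ∑ k ∈ Finset.range N, ‖Q‖ * τ ^ 2 * (ρ ^ 2) ^ k := by
        refine (norm_sum_le _ _).trans (Finset.sum_le_sum fun k _ => ?_)
        have h2 : ‖(L ^ k)ᵀ * Q * L ^ k‖ ≤ ‖L ^ k‖ * ‖Q‖ * ‖L ^ k‖ := by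
          refine (norm_mul_le _ _).trans (mul_le_mul_of_nonneg_right ?_ (norm_nonneg _))
          refine (norm_mul_le _ _).trans ?_
          rw [norm_transpose]
        refine h2.trans ?_
        calc ‖L ^ k‖ * ‖Q‖ * ‖L ^ k‖ = ‖Q‖ * ‖L ^ k‖ ^ 2 := by ring
          _ ≤ ‖Q‖ * (τ * ρ ^ k) ^ 2 := by gcongr; exact hτ k
          _ = _ := by ring
    _ = ‖Q‖ * τ ^ 2 * ∑ k ∈ Finset.range N, (ρ ^ 2) ^ k := by rw [Finset.mul_sum]
    _ ≤ ‖Q‖ * τ ^ 2 * (1 - ρ ^ 2)⁻¹ := by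
        gcongr
        exact (geom_sum_le_inv (sq_nonneg ρ) hρ2 _)
    _ = _ := by rw [div_eq_mul_inv]

/-- Each term of the Lyapunov series is `(D L^k)ᵀ M (D L^k)`, so `trace_conj_le` bounds its trace
with the factor `d`; the series is then geometric. -/
lemma trace_lyapunov_le {d : ℕ} {L P : Matrix (Fin m) (Fin m) ℝ} {M : Matrix (Fin d) (Fin d) ℝ}
    {D : Matrix (Fin d) (Fin m) ℝ} (h : P = Lᵀ * P * L + Dᵀ * M * D)
    (hL : IsStable L) {τ ρ : ℝ} (hρ0 : 0 ≤ ρ) (hρ1 : ρ < 1)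
    (hτ : ∀ k : ℕ, ‖L ^ k‖ ≤ τ * ρ ^ k) :
    P.trace ≤ d * (‖M‖ * ‖D‖ ^ 2) * τ ^ 2 / (1 - ρ ^ 2) := by
  have h1 := ((continuous_id.matrix_trace).tendsto P).comp
    (tendsto_lyapunov_sum h (tendsto_pow_of_isStable hL))
  refine le_of_tendsto' h1 fun N => ?_
  have hρ2 : ρ ^ 2 < 1 := by nlinarith
  have hτ0 : 0 ≤ τ := by simpa using (norm_nonneg _).trans (hτ 0)
  simp only [Function.comp_apply, id]
  rw [Matrix.trace_sum]
  calc _ ≤ ∑ k ∈ Finset.range N, d * (‖M‖ * ‖D‖ ^ 2) * τ ^ 2 * (ρ ^ 2) ^ k := by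
        refine Finset.sum_le_sum fun k _ => ?_
        have h2 : (L ^ k)ᵀ * (Dᵀ * M * D) * L ^ k = (D * L ^ k)ᵀ * M * (D * L ^ k) := by
          simp [Matrix.transpose_mul, Matrix.mul_assoc]
        rw [h2]
        refine (trace_conj_le _).trans ?_
        calc (d : ℝ) * (‖M‖ * ‖D * L ^ k‖ ^ 2) ≤ d * (‖M‖ * (‖D‖ * (τ * ρ ^ k)) ^ 2) := by
              gcongr
              refine (Matrix.l2_opNorm_mul _ _).trans ?_
              gcongr
              exact hτ k
          _ = _ := by ring
    _ = d * (‖M‖ * ‖D‖ ^ 2) * τ ^ 2 * ∑ k ∈ Finset.range N, (ρ ^ 2) ^ k := by rw [Finset.mul_sum]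
    _ ≤ d * (‖M‖ * ‖D‖ ^ 2) * τ ^ 2 * (1 - ρ ^ 2)⁻¹ := by
        gcongr
        exact (geom_sum_le_inv (sq_nonneg ρ) hρ2 _)
    _ = _ := by rw [div_eq_mul_inv]

/-- A contraction in the norm of `V`, with `lam ≤ V ≤ v`, has geometrically decaying powers. -/
lemma norm_pow_le_of_contraction {L V : Matrix (Fin m) (Fin m) ℝ} {lam v r : ℝ} (hlam : 0 < lam)
    (hv : 0 ≤ v) (hr : 0 ≤ r) (hlow : ∀ x, lam * (x ⬝ᵥ x) ≤ quad V x)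
    (hup : ∀ x, quad V x ≤ v * (x ⬝ᵥ x)) (hL : ∀ x, quad V (L *ᵥ x) ≤ r ^ 2 * quad V x) (k : ℕ) :
    ‖L ^ k‖ ≤ √(v / lam) * r ^ k := by
  have h1 : ∀ x, quad V (L ^ k *ᵥ x) ≤ (r ^ k) ^ 2 * quad V x := fun x => by
    induction k with
    | zero => simp
    | succ k ih =>
      rw [pow_succ', ← Matrix.mulVec_mulVec]
      refine (hL _).trans ((mul_le_mul_of_nonneg_left ih (sq_nonneg r)).trans (le_of_eq (by ring)))
  refine norm_le_of_dot_le _ (by positivity) fun x => ?_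
  rw [mul_pow, Real.sq_sqrt (by positivity)]
  have h2 := (hlow (L ^ k *ᵥ x)).trans (h1 x)
  have h3 : (r ^ k) ^ 2 * quad V x ≤ (r ^ k) ^ 2 * (v * (x ⬝ᵥ x)) :=
    mul_le_mul_of_nonneg_left (hup x) (sq_nonneg _)
  have h4 := h2.trans h3
  rw [div_mul_eq_mul_div, div_mul_eq_mul_div, le_div_iff₀ hlam]
  linarith

lemma isStable_of_norm_pow_le {L : Matrix (Fin m) (Fin m) ℝ} {τ ρ : ℝ} (hρ0 : 0 ≤ ρ) (hρ1 : ρ < 1)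
    (hτ : ∀ k : ℕ, ‖L ^ k‖ ≤ τ * ρ ^ k) : IsStable L := by
  refine isStable_of_tendsto_pow (squeeze_zero_norm hτ ?_)
  simpa using (tendsto_pow_atTop_nhds_zero_of_lt_one hρ0 hρ1).const_mul τ

end Lyapunov

end AdaptiveLQR

namespace AdaptiveLQR
open scoped Topology

/-! ### Gaussian integrals -/

section Gaussian

variable {m l : ℕ}

instance isProbabilityMeasure_isoGaussian (m : ℕ) (σ : ℝ) : IsProbabilityMeasure (isoGaussian m σ) := by
  unfold isoGaussian; infer_instance

/-- The characteristic functions agree: under the product measure that of a linear form factors over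
the coordinates. -/
lemma map_dot_isoGaussian (σ : ℝ) (a : Fin m → ℝ) :
    (isoGaussian m σ).map (fun z => a ⬝ᵥ z) = gaussianReal 0 (σ ^ 2 * (a ⬝ᵥ a)).toNNReal := by
  have hm : Measurable fun z : Fin m → ℝ => a ⬝ᵥ z := by
    unfold dotProduct; fun_prop
  have : IsProbabilityMeasure ((isoGaussian m σ).map (fun z => a ⬝ᵥ z)) :=
    Measure.isProbabilityMeasure_map hm.aemeasurable
  refine Measure.ext_of_charFun ?_
  funext t
  rw [charFun_gaussianReal, charFun_apply_real, integral_map hm.aemeasurable (by fun_prop)]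
  have h1 : ∀ z : Fin m → ℝ, Complex.exp (t * ((a ⬝ᵥ z : ℝ) : ℂ) * Complex.I) =
      ∏ i, Complex.exp (((t * a i : ℝ) : ℂ) * (z i : ℂ) * Complex.I) := fun z => by
    rw [← Complex.exp_sum]
    congr 1
    simp only [dotProduct, Complex.ofReal_sum, Finset.mul_sum, Finset.sum_mul]
    refine Finset.sum_congr rfl fun i _ => ?_
    push_cast; ring
  simp_rw [h1, isoGaussian]
  rw [integral_fintype_prod_eq_prod (fun i (x : ℝ) => Complex.exp (((t * a i : ℝ) : ℂ) * (x : ℂ) * Complex.I))]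
  simp_rw [← charFun_apply_real, charFun_gaussianReal]
  rw [← Complex.exp_sum]
  congr 1
  have hs : 0 ≤ σ ^ 2 * (a ⬝ᵥ a) := mul_nonneg (sq_nonneg _) (dot_self_nonneg _)
  simp only [Complex.ofReal_zero, mul_zero, zero_mul, zero_sub, Real.coe_toNNReal _ hs,
    Real.coe_toNNReal _ (sq_nonneg σ)]
  simp only [dotProduct]
  push_cast
  rw [Finset.sum_neg_distrib, Finset.mul_sum, Finset.sum_mul, Finset.sum_div]
  congr 1
  refine Finset.sum_congr rfl fun i _ => ?_
  ring

lemma measurable_dot (a : Fin m → ℝ) : Measurable fun z : Fin m → ℝ => a ⬝ᵥ z := by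
  unfold dotProduct; fun_prop

lemma lintegral_exp_dot_isoGaussian (σ : ℝ) (a : Fin m → ℝ) :
    ∫⁻ z, ENNReal.ofReal (Real.exp (a ⬝ᵥ z)) ∂(isoGaussian m σ) =
      ENNReal.ofReal (Real.exp (σ ^ 2 * (a ⬝ᵥ a) / 2)) := by
  have h1 := lintegral_map (μ := isoGaussian m σ) (f := fun x : ℝ => ENNReal.ofReal (Real.exp x))
    (by fun_prop) (measurable_dot a)
  rw [← h1, map_dot_isoGaussian]
  have h2 := integrable_exp_mul_gaussianReal (μ := 0) (v := (σ ^ 2 * (a ⬝ᵥ a)).toNNReal) 1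
  simp only [one_mul] at h2
  rw [← ofReal_integral_eq_lintegral_ofReal h2 (ae_of_all _ fun x => (Real.exp_pos x).le)]
  have h3 := congrFun (mgf_fun_id_gaussianReal (μ := 0) (v := (σ ^ 2 * (a ⬝ᵥ a)).toNNReal)) 1
  simp only [mgf, one_mul] at h3
  rw [h3, Real.coe_toNNReal _ (mul_nonneg (sq_nonneg _) (dot_self_nonneg _))]
  simp

/-- The left side is the exponential moment of a squared Gaussian. The right side separates its mean
`u` from a second-order remainder. After squaring, the Taylor bound `1 + y + y²/2 ≤ exp y` is
enough. -/
lemma sqrt_inv_le_exp {u : ℝ} (h0 : 0 ≤ u) (h1 : u ≤ 1 / 4) :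
    √(1 / (1 - 2 * u)) ≤ Real.exp (u + 2 * u ^ 2) := by
  rw [Real.sqrt_le_left (Real.exp_pos _).le, ← Real.exp_nat_mul, div_le_iff₀ (by linarith)]
  have h2 := Real.quadratic_le_exp_of_nonneg (x := ((2 : ℕ) : ℝ) * (u + 2 * u ^ 2)) (by positivity)
  refine le_trans ?_ (mul_le_mul_of_nonneg_right h2 (by linarith))
  push_cast
  have h3 : u ^ 3 ≤ u ^ 2 * (1 / 4) := by nlinarith [sq_nonneg u]
  have h4 : u ^ 4 ≤ u ^ 2 * (1 / 16) := by nlinarith [sq_nonneg u, mul_nonneg h0 (sq_nonneg u)]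
  have h5 : u ^ 5 ≤ u ^ 2 * (1 / 64) := by
    nlinarith [mul_nonneg (sq_nonneg u) (sq_nonneg u), mul_nonneg h0 (sq_nonneg u)]
  nlinarith [sq_nonneg u]

lemma lintegral_exp_sq_gaussianReal {s : ℝ} {v : NNReal} (hs : 0 ≤ s) (hv : s * v ≤ 1 / 4) :
    ∫⁻ x, ENNReal.ofReal (Real.exp (s * x ^ 2)) ∂(gaussianReal 0 v) ≤
      ENNReal.ofReal (Real.exp (s * v + 2 * (s * v) ^ 2)) := by
  rcases eq_or_ne v 0 with rfl | hv0
  · simp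
  have hvpos : (0 : ℝ) < v := by positivity
  -- The weight `exp (s x²)` lowers the precision of the Gaussian density; `s v ≤ 1/4` keeps it
  -- positive.
  have hb : 0 < 1 / (2 * v) - s := by
    rw [sub_pos, lt_div_iff₀ (by positivity)]; linarith
  rw [gaussianReal_of_var_ne_zero _ hv0, lintegral_withDensity_eq_lintegral_mul _
    (measurable_gaussianPDF _ _) (by fun_prop)]
  have h1 : ∀ x : ℝ, (gaussianPDF 0 v * fun x => ENNReal.ofReal (Real.exp (s * x ^ 2))) x =
      ENNReal.ofReal ((√(2 * Real.pi * v))⁻¹ * Real.exp (-(1 / (2 * v) - s) * x ^ 2)) := fun x => by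
    rw [Pi.mul_apply, gaussianPDF, ← ENNReal.ofReal_mul (gaussianPDFReal_nonneg _ _ _),
      gaussianPDFReal, mul_assoc, ← Real.exp_add]
    congr 3
    field_simp
    ring
  simp_rw [h1]
  rw [← ofReal_integral_eq_lintegral_ofReal ((integrable_exp_neg_mul_sq hb).const_mul _)
    (ae_of_all _ fun x => by positivity), integral_const_mul, integral_gaussian]
  refine ENNReal.ofReal_le_ofReal (le_trans (le_of_eq ?_)
    (sqrt_inv_le_exp (mul_nonneg hs hvpos.le) hv))
  rw [← Real.sqrt_inv, ← Real.sqrt_mul (by positivity)]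
  congr 1
  have : 1 - 2 * (s * v) ≠ 0 := by linarith
  have h4 : 1 / (2 * (v : ℝ)) - s = (1 - 2 * (s * v)) / (2 * v) := by field_simp
  rw [h4]
  field_simp

lemma measurable_quad (P : Matrix (Fin m) (Fin m) ℝ) : Measurable (quad P) := by
  unfold quad; unfold dotProduct Matrix.mulVec dotProduct; fun_prop

/-- Exponential moments of a Gaussian quadratic form. -/
lemma lintegral_exp_quad_isoGaussian {P : Matrix (Fin m) (Fin m) ℝ} (hP : P.PosSemidef)
    {σ θ : ℝ} (hθ : 0 ≤ θ) (hu : θ * (σ ^ 2 * P.trace) ≤ 1 / 4) :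
    ∫⁻ z, ENNReal.ofReal (Real.exp (θ * quad P z)) ∂(isoGaussian m σ) ≤
      ENNReal.ofReal (Real.exp (θ * (σ ^ 2 * P.trace) + 2 * (θ * (σ ^ 2 * P.trace)) ^ 2)) := by
  obtain ⟨Y, hq, htr⟩ := exists_sum_sq hP
  rw [htr] at hu ⊢
  set T := ∑ i, Y i ⬝ᵥ Y i with hT
  set u := θ * (σ ^ 2 * T) with hu'
  have hT0 : 0 ≤ T := Finset.sum_nonneg fun i _ => dot_self_nonneg _
  have hu0 : 0 ≤ u := mul_nonneg hθ (mul_nonneg (sq_nonneg _) hT0)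
  rcases hT0.eq_or_lt with hT1 | hT1
  · have hY : ∀ i, Y i = 0 := fun i => dotProduct_self_eq_zero.1
      ((Finset.sum_eq_zero_iff_of_nonneg fun i _ => dot_self_nonneg (Y i)).1 (hT ▸ hT1.symm) i
        (Finset.mem_univ _))
    have : ∀ z : Fin m → ℝ, quad P z = 0 := fun z => by
      rw [hq]; simp [hY]
    simp only [this, mul_zero, Real.exp_zero, ENNReal.ofReal_one, lintegral_one, measure_univ]
    rw [← ENNReal.ofReal_one]
    exact ENNReal.ofReal_le_ofReal (Real.one_le_exp (by positivity))
  -- Jensen's inequality with weights `|Y i|² / T`. It replaces independence of the linear forms: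
  -- each summand involves one Gaussian variable, and after rescaling every exponent has mean at
  -- most the same `u`.
  have hpt : ∀ z, Real.exp (θ * quad P z) ≤
      ∑ i, (Y i ⬝ᵥ Y i / T) * Real.exp (θ * T / (Y i ⬝ᵥ Y i) * (Y i ⬝ᵥ z) ^ 2) := fun z => by
    have h1 := convexOn_exp.map_sum_le (t := Finset.univ) (w := fun i => Y i ⬝ᵥ Y i / T)
      (p := fun i => θ * T / (Y i ⬝ᵥ Y i) * (Y i ⬝ᵥ z) ^ 2)
      (fun i _ => div_nonneg (dot_self_nonneg _) hT0)
      (by rw [← Finset.sum_div]; exact div_self hT1.ne') (fun i _ => Set.mem_univ _)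
    simp only [smul_eq_mul] at h1
    refine le_trans (le_of_eq ?_) h1
    congr 1
    rw [hq, Finset.mul_sum]
    refine Finset.sum_congr rfl fun i _ => ?_
    -- A zero row is harmless: division by zero gives zero, as does its square.
    by_cases hi : Y i ⬝ᵥ Y i = 0
    · rw [dotProduct_self_eq_zero.1 hi]; simp
    · field_simp
  have hone : ∀ i, ∫⁻ z, ENNReal.ofReal
      (Real.exp (θ * T / (Y i ⬝ᵥ Y i) * (Y i ⬝ᵥ z) ^ 2)) ∂(isoGaussian m σ) ≤
      ENNReal.ofReal (Real.exp (u + 2 * u ^ 2)) := fun i => by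
    have h1 := lintegral_map (μ := isoGaussian m σ)
      (f := fun x : ℝ => ENNReal.ofReal (Real.exp (θ * T / (Y i ⬝ᵥ Y i) * x ^ 2)))
      (by fun_prop) (measurable_dot (Y i))
    rw [← h1, map_dot_isoGaussian]
    have h2 : θ * T / (Y i ⬝ᵥ Y i) * ((σ ^ 2 * (Y i ⬝ᵥ Y i)).toNNReal : ℝ) ≤ u := by
      rw [Real.coe_toNNReal _ (mul_nonneg (sq_nonneg _) (dot_self_nonneg _))]
      by_cases hi : Y i ⬝ᵥ Y i = 0
      · rw [hi]; simpa using hu0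
      · exact le_of_eq (by rw [hu']; field_simp)
    have h3 : 0 ≤ θ * T / (Y i ⬝ᵥ Y i) := div_nonneg (mul_nonneg hθ hT0) (dot_self_nonneg _)
    refine (lintegral_exp_sq_gaussianReal h3 (h2.trans hu)).trans ?_
    refine ENNReal.ofReal_le_ofReal (Real.exp_le_exp.2 ?_)
    gcongr
  calc _ ≤ ∫⁻ z, ∑ i, ENNReal.ofReal (Y i ⬝ᵥ Y i / T) *
        ENNReal.ofReal (Real.exp (θ * T / (Y i ⬝ᵥ Y i) * (Y i ⬝ᵥ z) ^ 2)) ∂(isoGaussian m σ) := by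
        refine lintegral_mono fun z => (ENNReal.ofReal_le_ofReal (hpt z)).trans (le_of_eq ?_)
        rw [ENNReal.ofReal_sum_of_nonneg fun i _ => mul_nonneg (div_nonneg (dot_self_nonneg _) hT0)
          (Real.exp_pos _).le]
        exact Finset.sum_congr rfl fun i _ =>
          ENNReal.ofReal_mul (div_nonneg (dot_self_nonneg _) hT0)
    _ = ∑ i, ENNReal.ofReal (Y i ⬝ᵥ Y i / T) * ∫⁻ z,
        ENNReal.ofReal (Real.exp (θ * T / (Y i ⬝ᵥ Y i) * (Y i ⬝ᵥ z) ^ 2)) ∂(isoGaussian m σ) := by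
        have hmeas : ∀ i, Measurable fun z : Fin m → ℝ =>
            ENNReal.ofReal (Real.exp (θ * T / (Y i ⬝ᵥ Y i) * (Y i ⬝ᵥ z) ^ 2)) := fun i => by
          have := measurable_dot (Y i); fun_prop
        rw [lintegral_finsetSum _ fun i _ => (hmeas i).const_mul _]
        exact Finset.sum_congr rfl fun i _ => lintegral_const_mul _ (hmeas i)
    _ ≤ ∑ i, ENNReal.ofReal (Y i ⬝ᵥ Y i / T) * ENNReal.ofReal (Real.exp (u + 2 * u ^ 2)) :=
        Finset.sum_le_sum fun i _ => mul_le_mul_right (hone i) _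
    _ = _ := by
        rw [← Finset.sum_mul, ← ENNReal.ofReal_sum_of_nonneg
          fun i _ => div_nonneg (dot_self_nonneg _) hT0, ← Finset.sum_div, div_self hT1.ne',
          ENNReal.ofReal_one, one_mul]

lemma integrable_dot_isoGaussian (σ : ℝ) (a : Fin m → ℝ) :
    Integrable (fun z => a ⬝ᵥ z) (isoGaussian m σ) := by
  have h : Integrable (id : ℝ → ℝ) ((isoGaussian m σ).map (fun z => a ⬝ᵥ z)) := by
    rw [map_dot_isoGaussian]
    exact memLp_one_iff_integrable.1 (memLp_id_gaussianReal' 1 (by simp))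
  exact h.comp_measurable (measurable_dot a)

lemma integral_dot_isoGaussian (σ : ℝ) (a : Fin m → ℝ) :
    ∫ z, a ⬝ᵥ z ∂(isoGaussian m σ) = 0 := by
  have h := integral_map (μ := isoGaussian m σ) (f := (fun x : ℝ => x))
    (measurable_dot a).aemeasurable (by fun_prop)
  rw [← h, map_dot_isoGaussian, integral_id_gaussianReal]

lemma integrable_sq_dot_isoGaussian (σ : ℝ) (a : Fin m → ℝ) :
    Integrable (fun z => (a ⬝ᵥ z) ^ 2) (isoGaussian m σ) := by
  have h : Integrable (fun x : ℝ => x ^ 2) ((isoGaussian m σ).map (fun z => a ⬝ᵥ z)) := by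
    rw [map_dot_isoGaussian]
    exact (memLp_id_gaussianReal' 2 (by simp)).integrable_sq
  exact h.comp_measurable (measurable_dot a)

lemma integral_sq_dot_isoGaussian (σ : ℝ) (a : Fin m → ℝ) :
    ∫ z, (a ⬝ᵥ z) ^ 2 ∂(isoGaussian m σ) = σ ^ 2 * (a ⬝ᵥ a) := by
  have h := integral_map (μ := isoGaussian m σ) (f := (fun x : ℝ => x ^ 2))
    (measurable_dot a).aemeasurable (by fun_prop)
  rw [← h, map_dot_isoGaussian]
  have hv := variance_fun_id_gaussianReal (μ := 0) (v := (σ ^ 2 * (a ⬝ᵥ a)).toNNReal)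
  rw [variance_of_integral_eq_zero (by fun_prop) (by simp)] at hv
  rw [hv, Real.coe_toNNReal _ (mul_nonneg (sq_nonneg _) (dot_self_nonneg _))]

lemma integrable_quad_isoGaussian {P : Matrix (Fin m) (Fin m) ℝ} (hP : P.PosSemidef) (σ : ℝ) :
    Integrable (quad P) (isoGaussian m σ) := by
  obtain ⟨Y, hq, -⟩ := exists_sum_sq hP
  rw [funext hq]
  exact integrable_finsetSum _ fun i _ => integrable_sq_dot_isoGaussian σ (Y i)

lemma integral_quad_isoGaussian {P : Matrix (Fin m) (Fin m) ℝ} (hP : P.PosSemidef) (σ : ℝ) :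
    ∫ z, quad P z ∂(isoGaussian m σ) = σ ^ 2 * P.trace := by
  obtain ⟨Y, hq, htr⟩ := exists_sum_sq hP
  simp_rw [hq, htr]
  rw [integral_finsetSum _ fun i _ => integrable_sq_dot_isoGaussian σ (Y i), Finset.mul_sum]
  exact Finset.sum_congr rfl fun i _ => integral_sq_dot_isoGaussian σ (Y i)

lemma posSemidef_conj {N : Matrix (Fin m) (Fin m) ℝ} (hN : N.PosSemidef)
    (C : Matrix (Fin m) (Fin l) ℝ) : (Cᵀ * N * C).PosSemidef := by
  simpa using hN.conjTranspose_mul_mul_same C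

lemma transpose_eq_of_posSemidef {P : Matrix (Fin m) (Fin m) ℝ} (hP : P.PosSemidef) : Pᵀ = P := by
  have := hP.isHermitian
  rwa [Matrix.IsHermitian, Matrix.conjTranspose_eq_transpose_of_trivial] at this

lemma quad_nonneg_of_posSemidef {P : Matrix (Fin m) (Fin m) ℝ} (hP : P.PosSemidef)
    (x : Fin m → ℝ) : 0 ≤ quad P x := by
  simpa [quad] using hP.dotProduct_mulVec_nonneg x

lemma lintegral_quad_add_isoGaussian {N : Matrix (Fin m) (Fin m) ℝ} (hN : N.PosSemidef)
    (C : Matrix (Fin m) (Fin l) ℝ) (a : Fin m → ℝ) (σ : ℝ) :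
    ∫⁻ z, ENNReal.ofReal (quad N (a + C *ᵥ z)) ∂(isoGaussian l σ) =
      ENNReal.ofReal (quad N a + σ ^ 2 * (Cᵀ * N * C).trace) := by
  have h1 : ∀ z, quad N (a + C *ᵥ z) = quad N a + 2 * ((Cᵀ *ᵥ (N *ᵥ a)) ⬝ᵥ z) +
      quad (Cᵀ * N * C) z := fun z => by
    rw [quad_add_right (transpose_eq_of_posSemidef hN), quad_conj,
      symm_dot (transpose_eq_of_posSemidef hN), dotProduct_comm (C *ᵥ z), dot_mulVec_comm]
  have hi1 : Integrable (fun z => quad N a + 2 * ((Cᵀ *ᵥ (N *ᵥ a)) ⬝ᵥ z)) (isoGaussian l σ) :=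
    (integrable_const _).add ((integrable_dot_isoGaussian σ _).const_mul 2)
  have hi2 := integrable_quad_isoGaussian (posSemidef_conj hN C) σ
  have hi : Integrable (fun z => quad N (a + C *ᵥ z)) (isoGaussian l σ) := by
    simp_rw [h1]; exact hi1.add hi2
  rw [← ofReal_integral_eq_lintegral_ofReal hi (ae_of_all _ fun z => quad_nonneg_of_posSemidef hN _)]
  simp_rw [h1]
  rw [integral_add hi1 hi2, integral_add (integrable_const _)
    ((integrable_dot_isoGaussian σ _).const_mul 2), integral_const_mul, integral_dot_isoGaussian,
    integral_quad_isoGaussian (posSemidef_conj hN C)]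
  simp

end Gaussian

end AdaptiveLQR

namespace AdaptiveLQR
open scoped Topology

/-! ### Value functions of stabilizing controllers -/

section Value

variable {n d : ℕ} {sys : System n d} {K : Matrix (Fin d) (Fin n) ℝ}

lemma valueFn_eq (hK : Stabilizes sys K) :
    valueFn sys K = (closedLoop sys K)ᵀ * valueFn sys K * closedLoop sys K +
      (sys.S + Kᵀ * sys.R * K) := dlyap_eq hK _

lemma quad_stage (x : Fin n → ℝ) :
    quad (sys.S + Kᵀ * sys.R * K) x = quad sys.S x + quad sys.R (K *ᵥ x) := by
  rw [quad_add_left, quad_conj]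

lemma closedLoop_mulVec (x : Fin n → ℝ) :
    closedLoop sys K *ᵥ x = sys.A *ᵥ x + sys.B *ᵥ (K *ᵥ x) := by
  rw [closedLoop, Matrix.add_mulVec, Matrix.mulVec_mulVec]

lemma quad_valueFn (hK : Stabilizes sys K) (x : Fin n → ℝ) :
    quad (valueFn sys K) x = quad (valueFn sys K) (closedLoop sys K *ᵥ x) +
      (quad sys.S x + quad sys.R (K *ᵥ x)) := by
  conv_lhs => rw [valueFn_eq hK]
  rw [quad_add_left, quad_conj, quad_stage]

lemma le_of_quad_le [NeZero n] {V : Matrix (Fin n) (Fin n) ℝ} {lam v : ℝ}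
    (h : ∀ x, lam * (x ⬝ᵥ x) ≤ quad V x)
    (hv : ∀ x, quad V x ≤ v * (x ⬝ᵥ x)) : lam ≤ v := by
  have := (h (Pi.single 0 1)).trans (hv (Pi.single 0 1))
  simpa using this

variable (hS : sys.S.PosDef) (hR : sys.R.PosDef)
include hS hR

lemma valueFn_transpose (hK : Stabilizes sys K) : (valueFn sys K)ᵀ = valueFn sys K := by
  refine lyapunov_transpose (valueFn_eq hK) hK ?_
  simp [transpose_eq_of_posDef hS, transpose_eq_of_posDef hR, Matrix.mul_assoc]

lemma lamMin_le_quad_stage (x : Fin n → ℝ) :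
    lamMin sys.S * (x ⬝ᵥ x) ≤ quad sys.S x + quad sys.R (K *ᵥ x) :=
  (lamMin_mul_le_quad hS x).trans (le_add_of_nonneg_right (quad_nonneg_of_posDef hR _))

lemma valueFn_nonneg (hK : Stabilizes sys K) (x : Fin n → ℝ) : 0 ≤ quad (valueFn sys K) x := by
  refine quad_nonneg_of_lyapunov hK (fun x => ?_) x
  rw [quad_valueFn hK x]
  exact le_add_of_nonneg_right
    (add_nonneg (quad_nonneg_of_posDef hS _) (quad_nonneg_of_posDef hR _))

lemma valueFn_posSemidef (hK : Stabilizes sys K) : (valueFn sys K).PosSemidef :=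
  posSemidef_of_quad (valueFn_transpose hS hR hK) (valueFn_nonneg hS hR hK)

lemma lamMin_le_quad_valueFn (hK : Stabilizes sys K) (x : Fin n → ℝ) :
    lamMin sys.S * (x ⬝ᵥ x) ≤ quad (valueFn sys K) x := by
  rw [quad_valueFn hK x]
  exact (lamMin_le_quad_stage hS hR x).trans (le_add_of_nonneg_left (valueFn_nonneg hS hR hK _))

/-- One closed-loop step lowers the form by the stage cost, which is at least `lamMin S · |x|²`,
hence at least the fraction `lamMin S / v` of the form. The bound `v` is left free so that `V⋆` can
later be used with `v = ‖V0‖`, giving both controllers one rate. -/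
lemma valueFn_contract [NeZero n] (hK : Stabilizes sys K) {v : ℝ}
    (hv : ∀ x, quad (valueFn sys K) x ≤ v * (x ⬝ᵥ x)) (x : Fin n → ℝ) :
    quad (valueFn sys K) (closedLoop sys K *ᵥ x) ≤
      (√(1 - lamMin sys.S / v)) ^ 2 * quad (valueFn sys K) x := by
  have hl := lamMin_pos hS
  have hle : lamMin sys.S ≤ v :=
    le_of_quad_le (lamMin_le_quad_valueFn hS hR hK) hv
  have hv0 : 0 < v := hl.trans_le hle
  rw [Real.sq_sqrt (sub_nonneg.2 ((div_le_one hv0).2 hle))]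
  have h1 := quad_valueFn hK x
  have h2 := lamMin_le_quad_stage (K := K) hS hR x
  have h3 : lamMin sys.S / v * quad (valueFn sys K) x ≤ lamMin sys.S * (x ⬝ᵥ x) := by
    calc _ ≤ lamMin sys.S / v * (v * (x ⬝ᵥ x)) :=
          mul_le_mul_of_nonneg_left (hv x) (div_nonneg hl.le hv0.le)
      _ = _ := by field_simp
  linarith

end Value

/-! ### Independence of the past -/

section Hist

variable {Ω β γ : Type*} [MeasurableSpace β] [MeasurableSpace γ]

/-- The σ-algebra generated by `ζ s`, `s < t`. -/
abbrev hist (ζ : ℕ → Ω → β) (t : ℕ) : MeasurableSpace Ω :=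
  ⨆ s : Fin t, MeasurableSpace.comap (ζ s) inferInstance

lemma hist_le [m0 : MeasurableSpace Ω] {ζ : ℕ → Ω → β} (hζ : ∀ t, Measurable (ζ t)) (t : ℕ) : hist ζ t ≤ m0 :=
  iSup_le fun s => (hζ s).comap_le

lemma hist_mono (ζ : ℕ → Ω → β) {s t : ℕ} (h : s ≤ t) : hist ζ s ≤ hist ζ t :=
  iSup_le fun r => le_iSup (fun s : Fin t => MeasurableSpace.comap (ζ s) inferInstance)
    ⟨r, r.2.trans_le h⟩

lemma measurable_hist (ζ : ℕ → Ω → β) {s t : ℕ} (h : s < t) : Measurable[hist ζ t] (ζ s) := by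
  refine Measurable.mono (comap_measurable (ζ s)) ?_ le_rfl
  exact le_iSup (fun s : Fin t => MeasurableSpace.comap (ζ s) inferInstance) ⟨s, h⟩

lemma indep_hist [MeasurableSpace Ω] {μ : Measure Ω} {ζ : ℕ → Ω → β} (hζ : ∀ t, Measurable (ζ t))
    (h : iIndepFun ζ μ) (t : ℕ) :
    Indep (hist ζ t) (MeasurableSpace.comap (ζ t) inferInstance) μ := by
  have h1 := indep_iSup_of_disjoint (fun i => (hζ i).comap_le) h
    (S := Set.Iio t) (T := {t}) (by simp)
  refine indep_of_indep_of_le_left (indep_of_indep_of_le_right h1 ?_) ?_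
  · exact le_iSup₂_of_le t rfl le_rfl
  · exact iSup_le fun s => le_iSup₂_of_le (s : ℕ) s.2 le_rfl

/-- Conditioning on `F` without conditional expectations: the joint law of `X` and `ν` is a product,
so Tonelli integrates out `ν` with `X` frozen. -/
lemma lintegral_indep {F : MeasurableSpace Ω} [m0 : MeasurableSpace Ω] {μ : Measure Ω}
    [IsFiniteMeasure μ] (hF : F ≤ m0)
    {ν : Ω → β} (hν : Measurable ν) (hind : Indep F (MeasurableSpace.comap ν inferInstance) μ)
    {X : Ω → γ} (hX : Measurable[F] X) {f : γ → β → ℝ≥0∞} (hf : Measurable (Function.uncurry f)) :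
    ∫⁻ ω, f (X ω) (ν ω) ∂μ = ∫⁻ ω, ∫⁻ z, f (X ω) z ∂(μ.map ν) ∂μ := by
  have hX0 : Measurable X := hX.mono hF le_rfl
  have hi : IndepFun X ν μ := indep_of_indep_of_le_left hind hX.comap_le
  have h1 := (indepFun_iff_map_prod_eq_prod_map_map hX0.aemeasurable hν.aemeasurable).1 hi
  have h2 := lintegral_map (μ := μ) (f := Function.uncurry f) hf (hX0.prodMk hν)
  rw [h1, lintegral_prod _ hf.aemeasurable] at h2
  simp only [Function.uncurry] at h2
  rw [← h2, lintegral_map _ hX0]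
  exact hf.lintegral_prod_right'

end Hist

/-! ### The average cost of a stabilizing controller -/

section AvgCost

variable {n d : ℕ} {sys : System n d} {K : Matrix (Fin d) (Fin n) ℝ}

lemma measurable_mulVec {m l : ℕ} (M : Matrix (Fin m) (Fin l) ℝ) :
    Measurable fun x : Fin l → ℝ => M *ᵥ x := by
  unfold Matrix.mulVec dotProduct; fun_prop

lemma linear_state_succ (w : ℕ → Fin n → ℝ) (t : ℕ) :
    policyHist sys (linearPolicy K) w (t + 1) (Fin.last (t + 1)) =
      closedLoop sys K *ᵥ policyHist sys (linearPolicy K) w t (Fin.last t) + w t := by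
  rw [policyHist, Fin.snoc_last, step, closedLoop_mulVec]
  rfl

lemma linear_state_zero (w : ℕ → Fin n → ℝ) :
    policyHist sys (linearPolicy K) w 0 (Fin.last 0) = 0 := rfl

lemma policyCost_linear (w : ℕ → Fin n → ℝ) (t : ℕ) :
    policyCost sys (linearPolicy K) w t =
      quad (sys.S + Kᵀ * sys.R * K) (policyHist sys (linearPolicy K) w t (Fin.last t)) := by
  rw [quad_stage]; rfl

lemma measurable_linear_state (t : ℕ) :
    Measurable[hist (fun (s : ℕ) (w : ℕ → Fin n → ℝ) => w s) t]
      fun w => policyHist sys (linearPolicy K) w t (Fin.last t) := by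
  induction t with
  | zero => simp only [linear_state_zero]; exact measurable_const
  | succ t ih =>
    simp only [linear_state_succ]
    refine Measurable.add ?_ (measurable_hist _ (Nat.lt_succ_self t))
    exact (measurable_mulVec _).comp (ih.mono (hist_mono _ (Nat.le_succ t)) le_rfl)

lemma iIndepFun_eval_infinitePi {β : Type*} [MeasurableSpace β] (P : ℕ → Measure β)
    [∀ i, IsProbabilityMeasure (P i)] :
    iIndepFun (fun (t : ℕ) (w : ℕ → β) => w t) (Measure.infinitePi P) := by
  rw [iIndepFun_iff_map_fun_eq_infinitePi_map (by fun_prop)]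
  have h1 : ∀ i, (Measure.infinitePi P).map (fun w => w i) = P i := fun i =>
    Measure.infinitePi_map_eval P i
  simp_rw [h1]
  exact Measure.map_id

variable (hS : sys.S.PosDef) (hR : sys.R.PosDef)
include hS hR

/-- Energy balance for the potential `E V(x_t)`: each step it loses the expected cost and gains `σw²
tr V` from the noise. It stays bounded by contraction, so the average cost converges to the average
gain. -/
lemma avgCost_linear [NeZero n] (hK : Stabilizes sys K) :
    avgCost sys (linearPolicy K) = ENNReal.ofReal (sys.σw ^ 2 * (valueFn sys K).trace) := by
  set V := valueFn sys K with hV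
  set Q := sys.S + Kᵀ * sys.R * K with hQ
  set μ : Measure (ℕ → Fin n → ℝ) := Measure.infinitePi fun _ : ℕ => isoGaussian n sys.σw with hμ
  set κ := sys.σw ^ 2 * V.trace with hκ
  have hVpsd : V.PosSemidef := valueFn_posSemidef hS hR hK
  have hV0 := valueFn_nonneg hS hR hK
  have hκ0 : 0 ≤ κ := mul_nonneg (sq_nonneg _) (trace_nonneg_of_quad hV0)
  let x : ℕ → (ℕ → Fin n → ℝ) → Fin n → ℝ :=
    fun t w => policyHist sys (linearPolicy K) w t (Fin.last t)
  have hζ : ∀ t, Measurable fun w : ℕ → Fin n → ℝ => w t := fun t => measurable_pi_apply t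
  have hxm : ∀ t, Measurable (x t) := fun t =>
    (measurable_linear_state t).mono (hist_le hζ t) le_rfl
  have hlaw : ∀ t, μ.map (fun w => w t) = isoGaussian n sys.σw := fun t =>
    Measure.infinitePi_map_eval _ t
  set s : ℕ → ℝ≥0∞ := fun t => ∫⁻ w, ENNReal.ofReal (quad V (x t w)) ∂μ with hs
  set c : ℕ → ℝ≥0∞ := fun t => ∫⁻ w, ENNReal.ofReal (policyCost sys (linearPolicy K) w t) ∂μ with hc
  set s' : ℕ → ℝ≥0∞ := fun t => ∫⁻ w, ENNReal.ofReal (quad V (closedLoop sys K *ᵥ x t w)) ∂μ with hs'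
  have hstep : ∀ t, s (t + 1) = s' t + ENNReal.ofReal κ := fun t => by
    have h1 : ∀ w, ENNReal.ofReal (quad V (x (t + 1) w)) =
        ENNReal.ofReal (quad V (closedLoop sys K *ᵥ x t w + w t)) := fun w => by
      simp only [x, linear_state_succ]
    have h2 : Measurable (Function.uncurry fun (a z : Fin n → ℝ) =>
        ENNReal.ofReal (quad V (closedLoop sys K *ᵥ a + z))) := by
      refine ENNReal.measurable_ofReal.comp ((measurable_quad V).comp ?_)
      exact ((measurable_mulVec _).comp measurable_fst).add measurable_snd
    simp only [hs, h1]
    rw [lintegral_indep (hist_le hζ t) (hζ t) (indep_hist hζ (iIndepFun_eval_infinitePi _) t)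
      (measurable_linear_state t) (f := fun a z =>
        ENNReal.ofReal (quad V (closedLoop sys K *ᵥ a + z))) h2, hlaw t]
    have h3 : ∀ a : Fin n → ℝ, ∫⁻ z, ENNReal.ofReal (quad V (a + z)) ∂(isoGaussian n sys.σw) =
        ENNReal.ofReal (quad V a) + ENNReal.ofReal κ := fun a => by
      have := lintegral_quad_add_isoGaussian hVpsd (1 : Matrix (Fin n) (Fin n) ℝ) a sys.σw
      simp only [Matrix.one_mulVec, Matrix.transpose_one, Matrix.one_mul, Matrix.mul_one] at this
      rw [this, ENNReal.ofReal_add (hV0 a) hκ0]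
    simp only [h3]
    rw [lintegral_add_right _ measurable_const, lintegral_const, measure_univ, mul_one]
  have hdec : ∀ t, s t = s' t + c t := fun t => by
    have h1 : ∀ w, ENNReal.ofReal (quad V (x t w)) =
        ENNReal.ofReal (quad V (closedLoop sys K *ᵥ x t w)) +
          ENNReal.ofReal (policyCost sys (linearPolicy K) w t) := fun w => by
      rw [policyCost_linear, quad_stage, ← ENNReal.ofReal_add (hV0 _)
        (add_nonneg (quad_nonneg_of_posDef hS _) (quad_nonneg_of_posDef hR _)), hV, quad_valueFn hK]
    simp only [hs, h1]
    rw [lintegral_add_left]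
    exact ENNReal.measurable_ofReal.comp
      ((measurable_quad V).comp ((measurable_mulVec _).comp (hxm t)))
  have hs0 : s 0 = 0 := by
    have : ∀ w, x 0 w = 0 := fun _ => rfl
    simp [hs, this]
  have hc0 : c 0 = 0 := by
    have := hdec 0
    rw [hs0] at this
    exact (add_eq_zero.1 this.symm).2
  -- the potential stays bounded
  have hl := lamMin_pos hS
  have hvle : ∀ y, quad V y ≤ ‖V‖ * (y ⬝ᵥ y) := quad_le V
  have hlv : lamMin sys.S ≤ ‖V‖ :=
    le_of_quad_le (lamMin_le_quad_valueFn hS hR hK) hvle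
  have hv0 : 0 < ‖V‖ := hl.trans_le hlv
  -- The fixed point of `b ↦ r b + κ`, the recursion that dominates the expected potential.
  set b := κ * ‖V‖ / lamMin sys.S with hb
  have hb0 : 0 ≤ b := by positivity
  set r := 1 - lamMin sys.S / ‖V‖ with hr
  have hr0 : 0 ≤ r := sub_nonneg.2 ((div_le_one hv0).2 hlv)
  have hbr : r * b + κ = b := by rw [hr, hb]; field_simp; ring
  have hsb : ∀ t, s t ≤ ENNReal.ofReal b := fun t => by
    induction t with
    | zero => rw [hs0]; exact zero_le
    | succ t ih =>
      have h1 : s' t ≤ ENNReal.ofReal r * s t := by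
        rw [hs', hs, ← lintegral_const_mul]
        · refine lintegral_mono fun w => ?_
          rw [← ENNReal.ofReal_mul hr0]
          refine ENNReal.ofReal_le_ofReal ?_
          have := valueFn_contract hS hR hK hvle (x t w)
          rwa [Real.sq_sqrt hr0] at this
        · exact ENNReal.measurable_ofReal.comp ((measurable_quad V).comp (hxm t))
      rw [hstep, ← hbr, ENNReal.ofReal_add (mul_nonneg hr0 hb0) hκ0, ENNReal.ofReal_mul hr0]
      gcongr
      exact h1.trans (mul_le_mul_right ih _)
  have hsum : ∀ N : ℕ, ∑ t ∈ Finset.range N, c t + s N = N * ENNReal.ofReal κ := fun N => by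
    induction N with
    | zero => simp [hs0]
    | succ N ih =>
      rw [Finset.sum_range_succ, hstep, add_assoc, ← add_assoc (c N), add_comm (c N), ← hdec,
        ← add_assoc, ih]
      push_cast; ring
  have hsfin : ∀ t, s t ≠ ∞ := fun t => ((hsb t).trans_lt ENNReal.ofReal_lt_top).ne
  -- The average counts times `1, …, T` while the balance starts at `0`; they agree because the cost
  -- at `x_0 = 0` vanishes.
  have hT : ∀ T : ℕ, ∑ t ∈ Finset.Icc 1 T, c t = ENNReal.ofReal ((T + 1) * κ - (s (T + 1)).toReal) := by
    intro T
    have h1 : ∑ t ∈ Finset.range (T + 1), c t = ∑ t ∈ Finset.Icc 1 T, c t := by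
      rw [Finset.range_eq_Ico, Finset.sum_eq_sum_Ico_succ_bot (Nat.succ_pos T), hc0, zero_add]
      rfl
    rw [← h1]
    have h2 := hsum (T + 1)
    have h3 : ((T + 1 : ℕ) : ℝ≥0∞) * ENNReal.ofReal κ = ENNReal.ofReal ((T + 1) * κ) := by
      rw [ENNReal.ofReal_mul (show (0 : ℝ) ≤ (T : ℝ) + 1 by positivity), ← Nat.cast_succ,
        ENNReal.ofReal_natCast]
    rw [h3] at h2
    rw [ENNReal.ofReal_sub _ ENNReal.toReal_nonneg, ENNReal.ofReal_toReal (hsfin _), ← h2]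
    exact (ENNReal.add_sub_cancel_right (hsfin _)).symm
  have hlim : Tendsto (fun T : ℕ => ((T + 1 : ℝ) * κ - (s (T + 1)).toReal) / T) atTop (𝓝 κ) := by
    have h1 : Tendsto (fun T : ℕ => κ + (κ - (s (T + 1)).toReal) / (T : ℝ)) atTop (𝓝 (κ + 0)) := by
      refine tendsto_const_nhds.add ?_
      refine squeeze_zero_norm (a := fun T : ℕ => (κ + b) / (T : ℝ)) (fun T => ?_)
        (tendsto_const_div_atTop_nhds_zero_nat _)
      rw [norm_div, Real.norm_natCast]
      gcongr
      refine (norm_sub_le _ _).trans ?_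
      rw [Real.norm_of_nonneg hκ0, Real.norm_of_nonneg ENNReal.toReal_nonneg]
      gcongr
      exact ENNReal.toReal_le_of_le_ofReal hb0 (hsb _)
    rw [add_zero] at h1
    refine h1.congr' ?_
    filter_upwards [eventually_gt_atTop 0] with T hT0
    have : (T : ℝ) ≠ 0 := by exact_mod_cast hT0.ne'
    field_simp
    ring
  have hmain : Tendsto (fun T : ℕ => (∑ t ∈ Finset.Icc 1 T, c t) / (T : ℝ≥0∞)) atTop
      (𝓝 (ENNReal.ofReal κ)) := by
    refine (ENNReal.tendsto_ofReal hlim).congr' ?_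
    filter_upwards [eventually_gt_atTop 0] with T hT0
    rw [hT, ENNReal.ofReal_div_of_pos (by exact_mod_cast hT0), ENNReal.ofReal_natCast]
  exact hmain.limsup_eq

end AvgCost

end AdaptiveLQR

namespace AdaptiveLQR
open scoped Topology

/-! ### The Bellman equation of an optimal controller -/

section Bellman

lemma eq_of_quad_eq {m : ℕ} {M N : Matrix (Fin m) (Fin m) ℝ} (hM : Mᵀ = M) (hN : Nᵀ = N)
    (h : ∀ x, quad M x = quad N x) : M = N := by
  ext i j
  have h1 := h (Pi.single i 1 + Pi.single j 1)
  rw [quad_add_right hM, quad_add_right hN, h, h] at h1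
  simpa using h1

variable {n d : ℕ} {sys : System n d}

/-- The weight `R + Bᵀ V B` of input deviations. -/
def inputWeight (sys : System n d) (V : Matrix (Fin n) (Fin n) ℝ) : Matrix (Fin d) (Fin d) ℝ :=
  sys.R + sys.Bᵀ * V * sys.B

lemma quad_inputWeight (V : Matrix (Fin n) (Fin n) ℝ) (u : Fin d → ℝ) :
    quad (inputWeight sys V) u = quad sys.R u + quad V (sys.B *ᵥ u) := by
  rw [inputWeight, quad_add_left, quad_conj]

lemma inputWeight_posDef (hR : sys.R.PosDef) {V : Matrix (Fin n) (Fin n) ℝ} (hV : V.PosSemidef) :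
    (inputWeight sys V).PosDef := hR.add_posSemidef (posSemidef_conj hV _)

/-- In `u` the left side is a quadratic polynomial with leading form `inputWeight sys V`; the
equation for `K'` says that `K' x` is its critical point. `V` is not yet assumed to be a value
function. -/
lemma complete_square (hR : sys.R.PosDef) {V : Matrix (Fin n) (Fin n) ℝ} (hV : V.PosSemidef)
    {K' : Matrix (Fin d) (Fin n) ℝ} (hK' : inputWeight sys V * K' = -(sys.Bᵀ * V * sys.A))
    (x : Fin n → ℝ) (u : Fin d → ℝ) :
    quad sys.S x + quad sys.R u + quad V (sys.A *ᵥ x + sys.B *ᵥ u) =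
      quad (inputWeight sys V) (u - K' *ᵥ x) +
        (quad sys.S x + quad V (sys.A *ᵥ x) - quad (inputWeight sys V) (K' *ᵥ x)) := by
  have hVt := transpose_eq_of_posSemidef hV
  have hM := transpose_eq_of_posDef (inputWeight_posDef (sys := sys) hR hV)
  have h1 : u - K' *ᵥ x = u + (-1 : ℝ) • (K' *ᵥ x) := by simp [sub_eq_add_neg]
  have h2 : u ⬝ᵥ (inputWeight sys V *ᵥ (K' *ᵥ x)) =
      -((sys.A *ᵥ x) ⬝ᵥ (V *ᵥ (sys.B *ᵥ u))) := by
    rw [Matrix.mulVec_mulVec, hK', Matrix.neg_mulVec, dotProduct_neg, symm_dot hVt,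
      ← Matrix.mulVec_mulVec, ← Matrix.mulVec_mulVec, dot_mulVec_comm, Matrix.transpose_transpose]
  rw [h1, quad_add_right hM, quad_add_right hVt, Matrix.mulVec_smul, dotProduct_smul, h2,
    quad_smul_right, quad_inputWeight, smul_eq_mul]
  ring

/-- A strict Lyapunov function: the decrease `lamMin S · |x|²` is a fixed fraction of the form, so
powers of the closed loop decay geometrically. -/
lemma stabilizes_of_lyapunov [NeZero n] (hS : sys.S.PosDef) {V : Matrix (Fin n) (Fin n) ℝ} {K : Matrix (Fin d) (Fin n) ℝ}
    (hV : ∀ x, lamMin sys.S * (x ⬝ᵥ x) ≤ quad V x)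
    (h : ∀ x, quad V (closedLoop sys K *ᵥ x) ≤ quad V x - lamMin sys.S * (x ⬝ᵥ x)) :
    Stabilizes sys K := by
  have hl := lamMin_pos hS
  have hlv : lamMin sys.S ≤ ‖V‖ := le_of_quad_le hV (quad_le V)
  have hv0 : 0 < ‖V‖ := hl.trans_le hlv
  have hr0 : 0 ≤ 1 - lamMin sys.S / ‖V‖ := sub_nonneg.2 ((div_le_one hv0).2 hlv)
  refine isStable_of_norm_pow_le (Real.sqrt_nonneg _) ?_
    (norm_pow_le_of_contraction hl hv0.le (Real.sqrt_nonneg (1 - lamMin sys.S / ‖V‖)) hV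
      (quad_le V) fun x => ?_)
  · rw [Real.sqrt_lt' one_pos]
    have : 0 < lamMin sys.S / ‖V‖ := div_pos hl hv0
    linarith
  · rw [Real.sq_sqrt hr0]
    have h3 : lamMin sys.S / ‖V‖ * quad V x ≤ lamMin sys.S * (x ⬝ᵥ x) := by
      calc _ ≤ lamMin sys.S / ‖V‖ * (‖V‖ * (x ⬝ᵥ x)) :=
            mul_le_mul_of_nonneg_left (quad_le V x) (div_nonneg hl.le hv0.le)
        _ = _ := by field_simp
    linarith [h x]

variable [NeZero n] (hS : sys.S.PosDef) (hR : sys.R.PosDef)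
include hS hR

/-- Policy improvement. Let `K'` be greedy for the value function `V` of `Kstar`. Then `K'` is
stabilizing and its value function satisfies `V' ≤ V`. Optimality of `Kstar`, needed only against
the static policy `K'`, gives `tr V ≤ tr V'`, which leaves no room for `Kstar ≠ K'`. -/
lemma optimal_gain_eq (hσ : 0 < sys.σw) {Kstar : Matrix (Fin d) (Fin n) ℝ}
    (hopt : IsOptimalController sys Kstar) :
    inputWeight sys (valueFn sys Kstar) * Kstar = -(sys.Bᵀ * valueFn sys Kstar * sys.A) := by
  obtain ⟨hst, hopt⟩ := hopt
  set V := valueFn sys Kstar with hVdef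
  have hV := valueFn_posSemidef hS hR hst
  have hMpd := inputWeight_posDef (sys := sys) hR hV
  set M := inputWeight sys V with hM
  obtain ⟨K', hK'⟩ : ∃ K' : Matrix (Fin d) (Fin n) ℝ, M * K' = -(sys.Bᵀ * V * sys.A) := by
    refine ⟨M⁻¹ * (-(sys.Bᵀ * V * sys.A)), ?_⟩
    rw [← Matrix.mul_assoc, Matrix.mul_nonsing_inv _ ((Matrix.isUnit_iff_isUnit_det _).1 hMpd.isUnit),
      Matrix.one_mul]
  have hsq := complete_square hR hV hK'
  have hstep : ∀ x, quad V (closedLoop sys K' *ᵥ x) =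
      quad V x - quad M ((Kstar - K') *ᵥ x) - (quad sys.S x + quad sys.R (K' *ᵥ x)) := fun x => by
    have h1 := hsq x (Kstar *ᵥ x)
    have h2 := hsq x (K' *ᵥ x)
    rw [← closedLoop_mulVec] at h1 h2
    rw [sub_self, quad_zero_right] at h2
    have h3 := quad_valueFn hst x
    rw [Matrix.sub_mulVec]
    linarith
  have hst' : Stabilizes sys K' := by
    refine stabilizes_of_lyapunov hS (lamMin_le_quad_valueFn hS hR hst) fun x => ?_
    rw [hstep]
    have h1 := lamMin_le_quad_stage (K := K') hS hR x
    have h2 := quad_nonneg_of_posDef hMpd ((Kstar - K') *ᵥ x)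
    linarith
  set V' := valueFn sys K' with hV'
  have hdec : ∀ x, quad (V - V') x = quad (V - V') (closedLoop sys K' *ᵥ x) +
      quad M ((Kstar - K') *ᵥ x) := fun x => by
    rw [quad_sub_left, quad_sub_left, hstep, hV', quad_valueFn hst' x]
    ring
  have hnn : ∀ x, 0 ≤ quad (V - V') x := quad_nonneg_of_lyapunov hst' fun x => by
    rw [hdec x]; exact le_add_of_nonneg_right (quad_nonneg_of_posDef hMpd _)
  have htr : V.trace ≤ V'.trace := by
    have h1 : avgCost sys (linearPolicy Kstar) ≤ avgCost sys (linearPolicy K') := by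
      rw [hopt]; exact iInf_le _ _
    rw [avgCost_linear hS hR hst, avgCost_linear hS hR hst', ENNReal.ofReal_le_ofReal_iff] at h1
    · exact le_of_mul_le_mul_left h1 (by positivity)
    · exact mul_nonneg (sq_nonneg _) (trace_nonneg_of_quad (valueFn_nonneg hS hR hst'))
  -- The diagonal entries of `V - V'` are nonnegative with nonpositive sum.
  have hz : ∀ i, quad (V - V') (Pi.single i 1) = 0 := by
    have h1 : (V - V').trace ≤ 0 := by rw [Matrix.trace_sub]; linarith
    rw [trace_eq_sum_quad] at h1
    have h2 := (Finset.sum_eq_zero_iff_of_nonneg fun i _ => hnn (Pi.single i 1)).1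
      (le_antisymm h1 (Finset.sum_nonneg fun i _ => hnn _))
    exact fun i => h2 i (Finset.mem_univ _)
  -- At a basis vector the identity `hdec` writes zero as a sum of two nonnegative terms, one of
  -- them the positive definite form `M` at a column of `Kstar - K'`.
  have hD : Kstar - K' = 0 := by
    ext a i
    have h1 := hdec (Pi.single i 1)
    rw [hz] at h1
    have h2 := hnn (closedLoop sys K' *ᵥ Pi.single i 1)
    have h3 := quad_nonneg_of_posDef hMpd ((Kstar - K') *ᵥ Pi.single i 1)
    have h4 : (Kstar - K') *ᵥ Pi.single i 1 = 0 := by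
      by_contra hne
      have := quad_pos_of_posDef hMpd hne
      linarith
    have h5 := congrFun h4 a
    simpa using h5
  rw [sub_eq_zero.1 hD, hK']

/-- Bellman equation for the optimal controller. -/
lemma bellman (hσ : 0 < sys.σw) {Kstar : Matrix (Fin d) (Fin n) ℝ}
    (hopt : IsOptimalController sys Kstar) (x : Fin n → ℝ) (u : Fin d → ℝ) :
    quad sys.S x + quad sys.R u + quad (valueFn sys Kstar) (sys.A *ᵥ x + sys.B *ᵥ u) =
      quad (valueFn sys Kstar) x +
        quad (inputWeight sys (valueFn sys Kstar)) (u - Kstar *ᵥ x) := by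
  have hV := valueFn_posSemidef hS hR hopt.1
  have hg := optimal_gain_eq hS hR hσ hopt
  have h1 := complete_square hR hV hg x u
  have h2 := complete_square hR hV hg x (Kstar *ᵥ x)
  rw [sub_self, quad_zero_right, ← closedLoop_mulVec] at h2
  have h3 := quad_valueFn hopt.1 x
  linarith

/-- The Bellman equation at `u = K x`, subtracted from the Lyapunov equation of `K`. The excess
value solves a Lyapunov equation whose source is quadratic in `K - Kstar`, which is the origin of
the second-order dependence of the regret on the accuracy. -/
lemma quad_valueFn_sub (hσ : 0 < sys.σw) {Kstar K : Matrix (Fin d) (Fin n) ℝ}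
    (hopt : IsOptimalController sys Kstar) (hK : Stabilizes sys K) (x : Fin n → ℝ) :
    quad (valueFn sys K - valueFn sys Kstar) x =
      quad (valueFn sys K - valueFn sys Kstar) (closedLoop sys K *ᵥ x) +
        quad (inputWeight sys (valueFn sys Kstar)) ((K - Kstar) *ᵥ x) := by
  have h1 := bellman hS hR hσ hopt x (K *ᵥ x)
  rw [← closedLoop_mulVec, ← Matrix.sub_mulVec] at h1
  have h2 := quad_valueFn hK x
  rw [quad_sub_left, quad_sub_left]
  linarith

lemma valueFn_sub_eq (hσ : 0 < sys.σw) {Kstar K : Matrix (Fin d) (Fin n) ℝ}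
    (hopt : IsOptimalController sys Kstar) (hK : Stabilizes sys K) :
    valueFn sys K - valueFn sys Kstar =
      (closedLoop sys K)ᵀ * (valueFn sys K - valueFn sys Kstar) * closedLoop sys K +
        (K - Kstar)ᵀ * inputWeight sys (valueFn sys Kstar) * (K - Kstar) := by
  have hV := valueFn_transpose hS hR hK
  have hVs := valueFn_transpose hS hR hopt.1
  have hM := transpose_eq_of_posDef (inputWeight_posDef (sys := sys) hR
    (valueFn_posSemidef hS hR hopt.1))
  refine eq_of_quad_eq (by simp [hV, hVs]) (by simp [hV, hVs, hM, Matrix.mul_assoc]) fun x => ?_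
  rw [quad_add_left, quad_conj, quad_conj]
  exact quad_valueFn_sub hS hR hσ hopt hK x

lemma quad_valueFn_sub_nonneg (hσ : 0 < sys.σw) {Kstar K : Matrix (Fin d) (Fin n) ℝ}
    (hopt : IsOptimalController sys Kstar) (hK : Stabilizes sys K) (x : Fin n → ℝ) :
    0 ≤ quad (valueFn sys K - valueFn sys Kstar) x := by
  refine quad_nonneg_of_lyapunov hK (fun x => ?_) x
  rw [quad_valueFn_sub hS hR hσ hopt hK x]
  exact le_add_of_nonneg_right (quad_nonneg_of_posDef
    (inputWeight_posDef hR (valueFn_posSemidef hS hR hopt.1)) _)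

lemma Jstar_eq {Kstar : Matrix (Fin d) (Fin n) ℝ} (hopt : IsOptimalController sys Kstar) :
    Jstar sys = sys.σw ^ 2 * (valueFn sys Kstar).trace := by
  rw [Jstar, ← hopt.2, avgCost_linear hS hR hopt.1, ENNReal.toReal_ofReal]
  exact mul_nonneg (sq_nonneg _) (trace_nonneg_of_quad (valueFn_nonneg hS hR hopt.1))

end Bellman

end AdaptiveLQR

namespace AdaptiveLQR
open scoped Topology

/-! ### Concentration for sums driven by Gaussian noise -/

section Concentration

variable {Ω : Type*} {m : ℕ}

lemma measurable_of_entries {l : ℕ} {_ : MeasurableSpace Ω} {X : Ω → Fin m → Fin l → ℝ}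
    (h : ∀ i j, Measurable fun ω => X ω i j) : Measurable X :=
  measurable_pi_iff.2 fun i => measurable_pi_iff.2 fun j => h i j

/-- `ν t ∼ N(0, σ_t² I)` is independent of `F t` and decided at time `t + 1`. -/
structure DrivenBy (F : ℕ → MeasurableSpace Ω) [m0 : MeasurableSpace Ω] (μ : Measure Ω)
    (ν : ℕ → Ω → Fin m → ℝ) (σ : ℕ → ℝ) : Prop where
  le : ∀ t, F t ≤ m0
  mono : ∀ t, F t ≤ F (t + 1)
  measurable_next : ∀ t, Measurable[F (t + 1)] (ν t)
  indep : ∀ t, Indep (F t) (MeasurableSpace.comap (ν t) inferInstance) μ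
  law : ∀ t, μ.map (ν t) = isoGaussian m (σ t)

variable {F : ℕ → MeasurableSpace Ω} [m0 : MeasurableSpace Ω] {μ : Measure Ω}
  {ν : ℕ → Ω → Fin m → ℝ} {σ : ℕ → ℝ}

lemma DrivenBy.measurable (h : DrivenBy F μ ν σ) (t : ℕ) : Measurable (ν t) :=
  (h.measurable_next t).mono (h.le _) le_rfl

variable [IsProbabilityMeasure μ]

lemma DrivenBy.lintegral (h : DrivenBy F μ ν σ) (t : ℕ) {γ : Type*} [MeasurableSpace γ]
    {X : Ω → γ} (hX : Measurable[F t] X) {f : γ → (Fin m → ℝ) → ℝ≥0∞}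
    (hf : Measurable (Function.uncurry f)) :
    ∫⁻ ω, f (X ω) (ν t ω) ∂μ = ∫⁻ ω, ∫⁻ z, f (X ω) z ∂(isoGaussian m (σ t)) ∂μ := by
  rw [lintegral_indep (h.le t) (h.measurable t) (h.indep t) hX hf, h.law t]

/-- Exponential supermartingale bound. -/
lemma DrivenBy.lintegral_exp_sum_le_one (h : DrivenBy F μ ν σ) {γ : Type*} [MeasurableSpace γ]
    {X : ℕ → Ω → γ} (hX : ∀ t, Measurable[F t] (X t)) {g : ℕ → γ → (Fin m → ℝ) → ℝ}
    (hg : ∀ t, Measurable (Function.uncurry (g t)))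
    (hle : ∀ t ω, ∫⁻ z, ENNReal.ofReal (Real.exp (g t (X t ω) z)) ∂(isoGaussian m (σ t)) ≤ 1)
    (N : ℕ) :
    Measurable[F N] (fun ω => ∑ t ∈ Finset.range N, g t (X t ω) (ν t ω)) ∧
    ∫⁻ ω, ENNReal.ofReal (Real.exp (∑ t ∈ Finset.range N, g t (X t ω) (ν t ω))) ∂μ ≤ 1 := by
  induction N with
  | zero => simp
  | succ N ih =>
    obtain ⟨hm, hi⟩ := ih
    constructor
    · simp only [Finset.sum_range_succ]
      refine Measurable.add (hm.mono (h.mono N) le_rfl) ?_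
      exact (hg N).comp (((hX N).mono (h.mono N) le_rfl).prodMk (h.measurable_next N))
    -- The partial sum and `X N` are both known before `ν N` is drawn. Integrating out `ν N` with
    -- this pair frozen leaves a factor at most one.
    · have hpair : Measurable[F N] fun ω =>
          (∑ t ∈ Finset.range N, g t (X t ω) (ν t ω), X N ω) := hm.prodMk (hX N)
      have hf : Measurable (Function.uncurry fun (p : ℝ × γ) (z : Fin m → ℝ) =>
          ENNReal.ofReal (Real.exp p.1) * ENNReal.ofReal (Real.exp (g N p.2 z))) := by
        have h2 : Measurable fun q : (ℝ × γ) × (Fin m → ℝ) => g N q.1.2 q.2 :=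
          (hg N).comp ((measurable_snd.comp measurable_fst).prodMk measurable_snd)
        have h3 : Measurable fun q : (ℝ × γ) × (Fin m → ℝ) => q.1.1 :=
          measurable_fst.comp measurable_fst
        exact (h3.exp.ennreal_ofReal).mul h2.exp.ennreal_ofReal
      have h1 := h.lintegral N hpair hf
      simp only [Finset.sum_range_succ, Real.exp_add]
      simp_rw [ENNReal.ofReal_mul (Real.exp_pos _).le]
      rw [h1]
      refine le_trans (lintegral_mono fun ω => ?_) hi
      have hgm : Measurable fun z => ENNReal.ofReal (Real.exp (g N (X N ω) z)) :=
        (((hg N).comp measurable_prodMk_left).exp).ennreal_ofReal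
      rw [lintegral_const_mul _ hgm]
      exact (mul_le_mul_right (hle N ω) _).trans (by simp)

/-- Markov's inequality for the exponential, at level `1 / δ`. -/
lemma DrivenBy.measure_sum_ge_le (h : DrivenBy F μ ν σ) {γ : Type*} [MeasurableSpace γ]
    {X : ℕ → Ω → γ} (hX : ∀ t, Measurable[F t] (X t)) {g : ℕ → γ → (Fin m → ℝ) → ℝ}
    (hg : ∀ t, Measurable (Function.uncurry (g t)))
    (hle : ∀ t ω, ∫⁻ z, ENNReal.ofReal (Real.exp (g t (X t ω) z)) ∂(isoGaussian m (σ t)) ≤ 1)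
    (N : ℕ) {δ : ℝ} (hδ : 0 < δ) :
    μ {ω | Real.log (1 / δ) ≤ ∑ t ∈ Finset.range N, g t (X t ω) (ν t ω)} ≤ ENNReal.ofReal δ := by
  obtain ⟨hm, hi⟩ := h.lintegral_exp_sum_le_one hX hg hle N
  have hm' := (hm.mono (h.le N) le_rfl).exp.ennreal_ofReal
  have h1 := mul_meas_ge_le_lintegral (μ := μ) hm' (ENNReal.ofReal (1 / δ))
  have h2 : {ω | Real.log (1 / δ) ≤ ∑ t ∈ Finset.range N, g t (X t ω) (ν t ω)} ⊆
      {ω | ENNReal.ofReal (1 / δ) ≤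
        ENNReal.ofReal (Real.exp (∑ t ∈ Finset.range N, g t (X t ω) (ν t ω)))} := fun ω hω => by
    refine ENNReal.ofReal_le_ofReal ?_
    rw [← Real.log_le_iff_le_exp (by positivity)]
    exact hω
  have h3 := (mul_le_mul_right (measure_mono (μ := μ) h2) (ENNReal.ofReal (1 / δ))).trans (h1.trans hi)
  calc _ = ENNReal.ofReal δ * (ENNReal.ofReal (1 / δ) *
        μ {ω | Real.log (1 / δ) ≤ ∑ t ∈ Finset.range N, g t (X t ω) (ν t ω)}) := by
        rw [← mul_assoc, ← ENNReal.ofReal_mul hδ.le, mul_one_div_cancel hδ.ne', ENNReal.ofReal_one,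
          one_mul]
    _ ≤ ENNReal.ofReal δ * 1 := mul_le_mul_right h3 _
    _ = _ := mul_one _

lemma exp_sub_lintegral_le_one {f : (Fin m → ℝ) → ℝ} {b s : ℝ}
    (hb : ∫⁻ z, ENNReal.ofReal (Real.exp (f z)) ∂(isoGaussian m s) ≤ ENNReal.ofReal (Real.exp b))
    {b' : ℝ} (hb' : b ≤ b') :
    ∫⁻ z, ENNReal.ofReal (Real.exp (f z - b')) ∂(isoGaussian m s) ≤ 1 := by
  have h1 : ∀ z, ENNReal.ofReal (Real.exp (f z - b')) =
      ENNReal.ofReal (Real.exp (-b')) * ENNReal.ofReal (Real.exp (f z)) := fun z => by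
    rw [← ENNReal.ofReal_mul (Real.exp_pos _).le, ← Real.exp_add]; congr 2; ring
  simp_rw [h1]
  rw [lintegral_const_mul' _ _ ENNReal.ofReal_ne_top]
  refine (mul_le_mul_right hb _).trans ?_
  rw [← ENNReal.ofReal_mul (Real.exp_pos _).le, ← Real.exp_add, ← ENNReal.ofReal_one]
  exact ENNReal.ofReal_le_ofReal (Real.exp_le_one_iff.2 (by linarith))

/-- Concentration of a martingale `∑ a_t ⬝ ν_t` with predictable coefficients. -/
lemma DrivenBy.linear_tail (h : DrivenBy F μ ν σ) {s : ℝ} (hs : ∀ t, σ t ^ 2 ≤ s ^ 2)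
    {a : ℕ → Ω → Fin m → ℝ} (ha : ∀ t, Measurable[F t] (a t)) {θ δ : ℝ} (hθ : 0 < θ) (hδ : 0 < δ)
    (N : ℕ) :
    μ {ω | θ * s ^ 2 / 2 * ∑ t ∈ Finset.range N, a t ω ⬝ᵥ a t ω + Real.log (1 / δ) / θ <
      ∑ t ∈ Finset.range N, a t ω ⬝ᵥ ν t ω} ≤ ENNReal.ofReal δ := by
  -- The subtracted term is the log-moment of a Gaussian linear form at the largest allowed variance
  -- `s²`, so each increment has exponential moment at most one.
  let g : ℕ → (Fin m → ℝ) → (Fin m → ℝ) → ℝ :=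
    fun _ a z => (θ • a) ⬝ᵥ z - θ ^ 2 * s ^ 2 / 2 * (a ⬝ᵥ a)
  have hg : ∀ t, Measurable (Function.uncurry (g t)) := fun t => by
    simp only [g, Function.uncurry_def]
    unfold dotProduct
    fun_prop
  have hle : ∀ t ω, ∫⁻ z, ENNReal.ofReal (Real.exp (g t (a t ω) z)) ∂(isoGaussian m (σ t)) ≤ 1 := by
    intro t ω
    refine exp_sub_lintegral_le_one (lintegral_exp_dot_isoGaussian _ _).le ?_
    rw [smul_dotProduct, dotProduct_smul, smul_eq_mul, smul_eq_mul]
    have := mul_le_mul_of_nonneg_right (hs t)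
      (mul_nonneg (sq_nonneg θ) (dot_self_nonneg (a t ω)))
    nlinarith
  refine (measure_mono fun ω hω => ?_).trans (h.measure_sum_ge_le ha hg hle N hδ)
  simp only [Set.mem_ofPred_eq, g, smul_dotProduct, smul_eq_mul, Finset.sum_sub_distrib,
    ← Finset.mul_sum] at hω ⊢
  have h1 := mul_lt_mul_of_pos_left hω hθ
  rw [mul_add, mul_div_cancel₀ _ hθ.ne'] at h1
  linarith

/-- Concentration of `∑ ν_tᵀ N_t ν_t` with predictable positive semidefinite `N_t`. -/
lemma DrivenBy.quad_tail (h : DrivenBy F μ ν σ) {s : ℝ} (hs : ∀ t, σ t ^ 2 ≤ s ^ 2)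
    {P : ℕ → Ω → Matrix (Fin m) (Fin m) ℝ} (hP : ∀ t i j, Measurable[F t] fun ω => P t ω i j)
    (hpsd : ∀ t ω, (P t ω).PosSemidef) {b : ℝ} (hb : ∀ t ω, (P t ω).trace ≤ b)
    {θ δ : ℝ} (hθ : 0 < θ) (hθb : θ * (s ^ 2 * b) ≤ 1 / 4) (hδ : 0 < δ) (N : ℕ) :
    μ {ω | ∑ t ∈ Finset.range N, σ t ^ 2 * (P t ω).trace + 2 * N * θ * (s ^ 2 * b) ^ 2 +
        Real.log (1 / δ) / θ < ∑ t ∈ Finset.range N, quad (P t ω) (ν t ω)} ≤ ENNReal.ofReal δ := by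
  let X : ℕ → Ω → Fin m → Fin m → ℝ := fun t ω i j => P t ω i j
  have hX : ∀ t, Measurable[F t] (X t) := fun t =>
    measurable_of_entries (hP t)
  -- The compensator keeps the exact mean `σ_t² tr P_t`, which must later cancel `J⋆`; only the
  -- second-order part uses the uniform trace bound `b`.
  let g : ℕ → (Fin m → Fin m → ℝ) → (Fin m → ℝ) → ℝ := fun t y z =>
    θ * quad (Matrix.of y) z -
      (θ * (σ t ^ 2 * (Matrix.of y).trace) + 2 * (θ * (s ^ 2 * b)) ^ 2)
  have hg : ∀ t, Measurable (Function.uncurry (g t)) := fun t => by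
    simp only [g, Function.uncurry_def, quad, Matrix.trace, Matrix.mulVec, dotProduct, Matrix.diag,
      Matrix.of_apply]
    fun_prop
  have hle : ∀ t ω, ∫⁻ z, ENNReal.ofReal (Real.exp (g t (X t ω) z)) ∂(isoGaussian m (σ t)) ≤ 1 := by
    intro t ω
    have hXP : Matrix.of (X t ω) = P t ω := rfl
    simp only [g, hXP]
    have ht0 : 0 ≤ (P t ω).trace := trace_nonneg_of_quad (quad_nonneg_of_posSemidef (hpsd t ω))
    have h1 : θ * (σ t ^ 2 * (P t ω).trace) ≤ θ * (s ^ 2 * b) :=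
      mul_le_mul_of_nonneg_left (mul_le_mul (hs t) (hb t ω) ht0 (sq_nonneg s)) hθ.le
    refine exp_sub_lintegral_le_one
      (lintegral_exp_quad_isoGaussian (hpsd t ω) hθ.le (h1.trans hθb)) ?_
    have h2 : 0 ≤ θ * (σ t ^ 2 * (P t ω).trace) := by positivity
    gcongr
  refine (measure_mono fun ω hω => ?_).trans (h.measure_sum_ge_le hX hg hle N hδ)
  have hXP : ∀ t, Matrix.of (X t ω) = P t ω := fun _ => rfl
  simp only [Set.mem_ofPred_eq, g, hXP, Finset.sum_sub_distrib, Finset.sum_add_distrib,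
    ← Finset.mul_sum, Finset.sum_const, Finset.card_range, nsmul_eq_mul] at hω ⊢
  have h1 := mul_lt_mul_of_pos_left hω hθ
  rw [mul_add, mul_div_cancel₀ _ hθ.ne'] at h1
  nlinarith

end Concentration

end AdaptiveLQR

namespace AdaptiveLQR
open scoped Topology

/-! ### Epochs -/

section Epochs

variable {Tmult : ℕ}

@[simp] lemma epochStart_zero : epochStart Tmult 0 = 0 := by simp [epochStart]

lemma epochStart_succ (i : ℕ) :
    epochStart Tmult (i + 1) = epochStart Tmult i + epochLen Tmult i := by
  have : 1 ≤ 2 ^ i := Nat.one_le_two_pow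
  rw [epochStart, epochStart, epochLen, ← Nat.mul_add]
  congr 1
  rw [pow_succ]; omega

lemma epochStart_mono {i j : ℕ} (h : i ≤ j) : epochStart Tmult i ≤ epochStart Tmult j :=
  Nat.mul_le_mul_left _ (Nat.sub_le_sub_right (Nat.pow_le_pow_right two_pos h) 1)

lemma epochOf_eq_iff (hT : 0 < Tmult) {t i : ℕ} :
    epochOf Tmult t = i ↔ epochStart Tmult i ≤ t ∧ t < epochStart Tmult (i + 1) := by
  have h1 : 1 ≤ 2 ^ i := Nat.one_le_two_pow
  rw [epochOf, Nat.log_eq_iff (Or.inr ⟨one_lt_two, Nat.succ_ne_zero _⟩), epochStart, epochStart]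
  have h2 : 2 ^ i ≤ t / Tmult + 1 ↔ Tmult * (2 ^ i - 1) ≤ t := by
    rw [← Nat.sub_le_iff_le_add, Nat.le_div_iff_mul_le hT, mul_comm]
  have h3 : t / Tmult + 1 < 2 ^ (i + 1) ↔ t < Tmult * (2 ^ (i + 1) - 1) := by
    rw [← Nat.lt_sub_iff_add_lt, Nat.div_lt_iff_lt_mul hT, mul_comm]
  rw [h2, h3]

lemma epochStart_epochOf_le (hT : 0 < Tmult) (t : ℕ) : epochStart Tmult (epochOf Tmult t) ≤ t :=
  ((epochOf_eq_iff hT).1 rfl).1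

lemma lt_epochStart_epochOf (hT : 0 < Tmult) (t : ℕ) :
    t < epochStart Tmult (epochOf Tmult t + 1) :=
  ((epochOf_eq_iff hT).1 rfl).2

lemma epochOf_mono {s t : ℕ} (h : s ≤ t) : epochOf Tmult s ≤ epochOf Tmult t :=
  Nat.log_mono_right (Nat.add_le_add_right (Nat.div_le_div_right h) 1)

lemma epochLen_pos (hT : 0 < Tmult) (i : ℕ) : 0 < epochLen Tmult i :=
  Nat.mul_pos hT (by positivity)

lemma epochOf_epochStart (hT : 0 < Tmult) (i : ℕ) : epochOf Tmult (epochStart Tmult i) = i := by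
  rw [epochOf_eq_iff hT, epochStart_succ]
  exact ⟨le_rfl, Nat.lt_add_of_pos_right (epochLen_pos hT i)⟩

lemma epochOf_zero : epochOf Tmult 0 = 0 := by simp [epochOf]

lemma epochOf_succ (hT : 0 < Tmult) (t : ℕ) :
    epochOf Tmult (t + 1) = epochOf Tmult t ∨
      (epochOf Tmult (t + 1) = epochOf Tmult t + 1 ∧
        t + 1 = epochStart Tmult (epochOf Tmult t + 1)) := by
  rcases (Nat.succ_le_of_lt (lt_epochStart_epochOf hT t)).lt_or_eq with h | h
  · left
    exact (epochOf_eq_iff hT).2 ⟨(epochStart_epochOf_le hT t).trans (Nat.le_succ t), h⟩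
  · right
    refine ⟨?_, h⟩
    have := epochOf_epochStart hT (epochOf Tmult t + 1)
    rwa [← h] at this

/-- Sum over time steps of a function of the epoch. -/
lemma sum_epochOf_eq (hT : 0 < Tmult) (f : ℕ → ℝ) (N : ℕ) :
    ∑ t ∈ Finset.range (epochStart Tmult N), f (epochOf Tmult t) =
      ∑ i ∈ Finset.range N, epochLen Tmult i * f i := by
  induction N with
  | zero => simp
  | succ N ih =>
    rw [Finset.sum_range_succ, ← ih, epochStart_succ, Finset.sum_range_add]
    congr 1
    rw [← nsmul_eq_mul]
    nth_rewrite 2 [← Finset.card_range (epochLen Tmult N)]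
    rw [← Finset.sum_const]
    refine Finset.sum_congr rfl fun k hk => ?_
    congr 1
    rw [epochOf_eq_iff hT, epochStart_succ]
    exact ⟨Nat.le_add_right _ _, Nat.add_lt_add_left (Finset.mem_range.1 hk) _⟩

lemma sum_epochOf_le (hT : 0 < Tmult) {f : ℕ → ℝ} (hf : ∀ i, 0 ≤ f i) (T : ℕ) :
    ∑ t ∈ Finset.range (T + 1), f (epochOf Tmult t) ≤
      ∑ i ∈ Finset.range (epochOf Tmult T + 1), epochLen Tmult i * f i := by
  rw [← sum_epochOf_eq hT]
  exact Finset.sum_le_sum_of_subset_of_nonneg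
    (Finset.range_subset_range.2 (lt_epochStart_epochOf hT T)) fun i _ _ => hf _

end Epochs

/-! ### The dynamics of the algorithm -/

section Dynamics

variable {n d : ℕ} {sys : System n d} {Est : Estimator n d} {Tmult : ℕ}
  {K0 : Matrix (Fin d) (Fin n) ℝ}

lemma stateAt_zero (w : ℕ → Fin n → ℝ) (η : ℕ → Fin d → ℝ) :
    stateAt sys Est Tmult K0 w η 0 = 0 := by
  simp [stateAt, epochOf_zero, epoch, rollout]

lemma stateAt_epochStart (hT : 0 < Tmult) (w : ℕ → Fin n → ℝ) (η : ℕ → Fin d → ℝ) (i : ℕ) :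
    stateAt sys Est Tmult K0 w η (epochStart Tmult i) = (epoch sys Est Tmult K0 w η i).2 := by
  simp [stateAt, epochOf_epochStart hT, rollout]

/-- Inside an epoch this is the recursion of `rollout`. At the last step of an epoch the next state
is described as the start of the next epoch, which `epoch` sets to the end of the same rollout. -/
lemma stateAt_succ (hT : 0 < Tmult) (w : ℕ → Fin n → ℝ) (η : ℕ → Fin d → ℝ) (t : ℕ) :
    stateAt sys Est Tmult K0 w η (t + 1) =
      step sys (stateAt sys Est Tmult K0 w η t) (inputAt sys Est Tmult K0 w η t) (w t) := by
  obtain ⟨i, k, rfl, hi⟩ : ∃ i k, t = epochStart Tmult i + k ∧ epochOf Tmult t = i := by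
    obtain ⟨k, hk⟩ := Nat.exists_eq_add_of_le (epochStart_epochOf_le hT t)
    exact ⟨_, k, hk, rfl⟩
  set s := epochStart Tmult i with hs
  have h1 : stateAt sys Est Tmult K0 w η (s + k) =
      rollout sys (epoch sys Est Tmult K0 w η i).1 (epoch sys Est Tmult K0 w η i).2
        (fun k => w (s + k)) (fun k => η (s + k)) k := by
    simp only [stateAt, hi, ← hs, Nat.add_sub_cancel_left]
  have h2 : step sys (stateAt sys Est Tmult K0 w η (s + k))
      (inputAt sys Est Tmult K0 w η (s + k)) (w (s + k)) =
      rollout sys (epoch sys Est Tmult K0 w η i).1 (epoch sys Est Tmult K0 w η i).2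
        (fun k => w (s + k)) (fun k => η (s + k)) (k + 1) := by
    rw [rollout, inputAt, hi, h1]
  rw [h2]
  rcases epochOf_succ hT (s + k) with h | ⟨h, h'⟩
  · simp only [stateAt, h, hi, ← hs]
    rw [add_assoc, Nat.add_sub_cancel_left]
  · rw [hi] at h h'
    rw [h', stateAt_epochStart hT, epoch]
    have : epochLen Tmult i = k + 1 := by
      rw [epochStart_succ] at h'; omega
    rw [← this]

lemma step_eq_closedLoop (K : Matrix (Fin d) (Fin n) ℝ) (x w : Fin n → ℝ) (u : Fin d → ℝ) :
    step sys x (K *ᵥ x + u) w = closedLoop sys K *ᵥ x + sys.B *ᵥ u + w := by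
  rw [step, closedLoop_mulVec, Matrix.mulVec_add, ← add_assoc]

end Dynamics

/-! ### Measurability -/

section Measurability

variable {Ω : Type*} {n d m l : ℕ} {sys : System n d}

lemma measurable_mulVec_rand {_ : MeasurableSpace Ω} {M : Ω → Matrix (Fin m) (Fin l) ℝ}
    (hM : ∀ i j, Measurable fun ω => M ω i j) {x : Ω → Fin l → ℝ} (hx : Measurable x) :
    Measurable fun ω => M ω *ᵥ x ω := by
  refine measurable_pi_iff.2 fun i => ?_
  simp only [Matrix.mulVec, dotProduct]
  exact Finset.measurable_sum _ fun j _ => (hM i j).mul ((measurable_pi_apply j).comp hx)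

lemma measurable_mul_rand {k : ℕ} {_ : MeasurableSpace Ω} {M : Ω → Matrix (Fin m) (Fin l) ℝ}
    {N : Ω → Matrix (Fin l) (Fin k) ℝ} (hM : ∀ i j, Measurable fun ω => M ω i j)
    (hN : ∀ i j, Measurable fun ω => N ω i j) (i j) : Measurable fun ω => (M ω * N ω) i j := by
  simp only [Matrix.mul_apply]
  exact Finset.measurable_sum _ fun r _ => (hM i r).mul (hN r j)

lemma measurable_pow_rand {_ : MeasurableSpace Ω} {M : Ω → Matrix (Fin m) (Fin m) ℝ}
    (hM : ∀ i j, Measurable fun ω => M ω i j) (k : ℕ) :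
    ∀ i j, Measurable fun ω => (M ω ^ k) i j := by
  induction k with
  | zero => simp
  | succ k ih => simp only [pow_succ]; exact measurable_mul_rand ih hM

lemma measurable_rollout {_ : MeasurableSpace Ω} {K : Ω → Matrix (Fin d) (Fin n) ℝ}
    (hK : ∀ i j, Measurable fun ω => K ω i j) {x0 : Ω → Fin n → ℝ} (hx0 : Measurable x0)
    {w : Ω → ℕ → Fin n → ℝ} {η : Ω → ℕ → Fin d → ℝ} (k : ℕ)
    (hw : ∀ j < k, Measurable fun ω => w ω j) (hη : ∀ j < k, Measurable fun ω => η ω j) :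
    Measurable fun ω => rollout sys (K ω) (x0 ω) (w ω) (η ω) k := by
  induction k with
  | zero => exact hx0
  | succ k ih =>
    have ih' := ih (fun j hj => hw j (hj.trans (Nat.lt_succ_self k)))
      (fun j hj => hη j (hj.trans (Nat.lt_succ_self k)))
    simp only [rollout, step]
    refine (((measurable_mulVec _).comp ih').add ((measurable_mulVec _).comp ?_)).add
      (hw k (Nat.lt_succ_self k))
    exact (measurable_mulVec_rand hK ih').add (hη k (Nat.lt_succ_self k))

variable {Est : Estimator n d} {Tmult : ℕ} {K0 : Matrix (Fin d) (Fin n) ℝ}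

lemma measurable_noise_past {w : ℕ → Ω → Fin n → ℝ} {η : ℕ → Ω → Fin d → ℝ} {s t : ℕ} (h : s < t) :
    Measurable[past w η t] (w s) ∧ Measurable[past w η t] (η s) :=
  ⟨measurable_fst.comp (measurable_hist (fun t ω => (w t ω, η t ω)) h),
    measurable_snd.comp (measurable_hist (fun t ω => (w t ω, η t ω)) h)⟩

lemma past_mono (w : ℕ → Ω → Fin n → ℝ) (η : ℕ → Ω → Fin d → ℝ) {s t : ℕ} (h : s ≤ t) :
    past w η s ≤ past w η t := hist_mono (fun t ω => (w t ω, η t ω)) h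

/-- Induction over epochs: the data set of an epoch uses only noise up to its end. This makes `good
i` an event to which the assumption on the estimator may be applied. -/
lemma measurable_epoch (hEst : Est.IsMeasurable) (w : ℕ → Ω → Fin n → ℝ) (η : ℕ → Ω → Fin d → ℝ)
    (i : ℕ) :
    (∀ a b, Measurable[past w η (epochStart Tmult i)]
      fun ω => ctrl sys Est Tmult K0 w η i ω a b) ∧
    Measurable[past w η (epochStart Tmult i)] (initState sys Est Tmult K0 w η i) := by
  induction i with
  | zero =>
    exact ⟨fun a b => @measurable_const _ _ _ (_) (K0 a b), @measurable_const _ _ _ (_) 0⟩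
  | succ i ih =>
    have hle : past w η (epochStart Tmult i) ≤ past w η (epochStart Tmult (i + 1)) :=
      past_mono w η (epochStart_mono (Nat.le_succ i))
    have hK : ∀ a b, Measurable[past w η (epochStart Tmult (i + 1))]
        fun ω => ctrl sys Est Tmult K0 w η i ω a b := fun a b => (ih.1 a b).mono hle le_rfl
    have hx : Measurable[past w η (epochStart Tmult (i + 1))]
        (initState sys Est Tmult K0 w η i) := ih.2.mono hle le_rfl
    have hroll : ∀ k ≤ epochLen Tmult i, Measurable[past w η (epochStart Tmult (i + 1))]
        fun ω => rollout sys (ctrl sys Est Tmult K0 w η i ω) (initState sys Est Tmult K0 w η i ω)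
          (fun t => w (epochStart Tmult i + t) ω) (fun t => η (epochStart Tmult i + t) ω) k := by
      intro k hk
      have hlt : ∀ j < k, epochStart Tmult i + j < epochStart Tmult (i + 1) := fun j hj => by
        rw [epochStart_succ]; omega
      exact measurable_rollout hK hx k (fun j hj => (measurable_noise_past (hlt j hj)).1)
        (fun j hj => (measurable_noise_past (hlt j hj)).2)
    constructor
    · intro a b
      refine (hEst (epochLen Tmult i) a b).comp (Measurable.prodMk (measurable_of_entries hK) ?_)
      refine (@measurable_pi_iff _ _ _ (_) _ _).2 fun t => ?_
      have hr := hroll t t.2.le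
      have hlt : epochStart Tmult i + t < epochStart Tmult (i + 1) := by
        rw [epochStart_succ]; exact Nat.add_lt_add_left t.2 _
      have hu := (measurable_mulVec_rand hK hr).add (measurable_noise_past (w := w) (η := η) hlt).2
      exact Measurable.prodMk hr (Measurable.prodMk hu (hroll (t + 1) t.2))
    · exact hroll _ le_rfl

lemma measurable_ctrl_past (hT : 0 < Tmult) (hEst : Est.IsMeasurable) (w : ℕ → Ω → Fin n → ℝ)
    (η : ℕ → Ω → Fin d → ℝ) {i t : ℕ} (h : i ≤ epochOf Tmult t) (a b) : Measurable[past w η t]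
      fun ω => ctrl sys Est Tmult K0 w η i ω a b :=
  ((measurable_epoch hEst w η i).1 a b).mono
    (past_mono w η ((epochStart_mono h).trans (epochStart_epochOf_le hT t))) le_rfl

lemma measurable_stateAt (hT : 0 < Tmult) (hEst : Est.IsMeasurable) (w : ℕ → Ω → Fin n → ℝ)
    (η : ℕ → Ω → Fin d → ℝ) (t : ℕ) : Measurable[past w η t]
      fun ω => stateAt sys Est Tmult K0 (fun s => w s ω) (fun s => η s ω) t := by
  induction t with
  | zero => simp only [stateAt_zero]; exact measurable_const
  | succ t ih =>
    simp only [stateAt_succ hT, inputAt, step_eq_closedLoop]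
    have hle := past_mono w η (Nat.le_succ t)
    have ih' := ih.mono hle le_rfl
    have hn := measurable_noise_past (w := w) (η := η) (Nat.lt_succ_self t)
    refine Measurable.add (Measurable.add ?_ ((measurable_mulVec _).comp hn.2)) hn.1
    simp only [closedLoop_mulVec]
    refine ((measurable_mulVec _).comp ih').add ((measurable_mulVec _).comp ?_)
    exact measurable_mulVec_rand (fun a b =>
      (measurable_ctrl_past hT hEst w η le_rfl a b).mono hle le_rfl) ih'

end Measurability

/-! ### The noise of the algorithm -/

section Noise

variable {Ω : Type*} {n d : ℕ} {sys : System n d}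

/-- Used with `m1` generated by `w t`, `m2` by `η t`, and `m3` the past. Intersections of events of
`m3` and `m2` form a π-system, on which both independence hypotheses multiply out. -/
lemma indep_sup_of_indep {m1 m2 m3 : MeasurableSpace Ω} [m0 : MeasurableSpace Ω] {μ : Measure Ω}
    [IsProbabilityMeasure μ] (h1 : m1 ≤ m0) (h2 : m2 ≤ m0) (h3 : m3 ≤ m0)
    (h12 : Indep m1 m2 μ) (h : Indep m3 (m1 ⊔ m2) μ) : Indep (m3 ⊔ m2) m1 μ := by
  have hgen : m3 ⊔ m2 = MeasurableSpace.generateFrom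
      {s | ∃ a b, MeasurableSet[m3] a ∧ MeasurableSet[m2] b ∧ s = a ∩ b} := by
    refine le_antisymm (sup_le ?_ ?_) (MeasurableSpace.generateFrom_le ?_)
    · intro s hs
      exact MeasurableSpace.measurableSet_generateFrom
        ⟨s, Set.univ, hs, MeasurableSet.univ, (Set.inter_univ s).symm⟩
    · intro s hs
      exact MeasurableSpace.measurableSet_generateFrom
        ⟨Set.univ, s, MeasurableSet.univ, hs, (Set.univ_inter s).symm⟩
    · rintro s ⟨a, b, ha, hb, rfl⟩
      exact @MeasurableSet.inter _ (m3 ⊔ m2) _ _ ((le_sup_left : m3 ≤ m3 ⊔ m2) _ ha)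
        ((le_sup_right : m2 ≤ m3 ⊔ m2) _ hb)
  refine IndepSets.indep (sup_le h3 h2) h1 ?_ (@MeasurableSpace.isPiSystem_measurableSet _ m1) hgen
    (@MeasurableSpace.generateFrom_measurableSet _ m1).symm ?_
  · rintro s ⟨a, b, ha, hb, rfl⟩ t ⟨a', b', ha', hb', rfl⟩ -
    exact ⟨a ∩ a', b ∩ b', @MeasurableSet.inter _ m3 _ _ ha ha',
      @MeasurableSet.inter _ m2 _ _ hb hb', Set.inter_inter_inter_comm _ _ _ _⟩
  · rw [IndepSets_iff]
    rintro s t ⟨a, b, ha, hb, rfl⟩ ht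
    rw [Indep_iff] at h12 h
    have e1 : μ (a ∩ b ∩ t) = μ a * μ (t ∩ b) := by
      rw [Set.inter_assoc, Set.inter_comm b t]
      exact h a (t ∩ b) ha (@MeasurableSet.inter _ (m1 ⊔ m2) _ _
        ((le_sup_left : m1 ≤ m1 ⊔ m2) _ ht) ((le_sup_right : m2 ≤ m1 ⊔ m2) _ hb))
    have e2 : μ (a ∩ b) = μ a * μ b := h a b ha ((le_sup_right : m2 ≤ m1 ⊔ m2) _ hb)
    rw [e1, e2, h12 t b ht hb]
    ring

variable {Tmult : ℕ} {α : ℝ} {w : ℕ → Ω → Fin n → ℝ} {η : ℕ → Ω → Fin d → ℝ}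

lemma comap_pair_eq (t : ℕ) :
    MeasurableSpace.comap (fun ω => (w t ω, η t ω)) inferInstance =
      MeasurableSpace.comap (w t) inferInstance ⊔ MeasurableSpace.comap (η t) inferInstance :=
  MeasurableSpace.comap_prodMk _ _

variable [m0 : MeasurableSpace Ω] {μ : Measure Ω}

lemma IsNoise.measurable_pair (h : IsNoise sys μ Tmult α w η) (t : ℕ) :
    Measurable fun ω => (w t ω, η t ω) := (h.measurable_w t).prodMk (h.measurable_η t)

lemma IsNoise.past_le (h : IsNoise sys μ Tmult α w η) (t : ℕ) : past w η t ≤ m0 :=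
  hist_le h.measurable_pair t

lemma IsNoise.indep_past (h : IsNoise sys μ Tmult α w η) (t : ℕ) :
    Indep (past w η t) (MeasurableSpace.comap (fun ω => (w t ω, η t ω)) inferInstance) μ :=
  indep_hist h.measurable_pair h.indep_time t

lemma IsNoise.drivenBy_η (h : IsNoise sys μ Tmult α w η) :
    DrivenBy (past w η) μ η (fun t => sigEta sys α (epochOf Tmult t)) where
  le := h.past_le
  mono t := past_mono w η (Nat.le_succ t)
  measurable_next t := (measurable_noise_past (Nat.lt_succ_self t)).2
  indep t := indep_of_indep_of_le_right (h.indep_past t) (by rw [comap_pair_eq]; exact le_sup_right)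
  law := h.law_η

/-- What is known before `w t` is drawn: the past, and `η t`. -/
abbrev pastInput (w : ℕ → Ω → Fin n → ℝ) (η : ℕ → Ω → Fin d → ℝ) (t : ℕ) : MeasurableSpace Ω :=
  past w η t ⊔ MeasurableSpace.comap (η t) inferInstance

-- The filtration is enlarged by `η t` because the coefficient of `w t` in the regret contains `B
-- η_t`.
variable [IsProbabilityMeasure μ] in
lemma IsNoise.drivenBy_w (h : IsNoise sys μ Tmult α w η) :
    DrivenBy (pastInput w η) μ w (fun _ => sys.σw) where
  le t := sup_le (h.past_le t) (h.measurable_η t).comap_le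
  mono t := le_sup_of_le_left (sup_le (past_mono w η (Nat.le_succ t))
    (measurable_noise_past (Nat.lt_succ_self t)).2.comap_le)
  measurable_next t := (measurable_noise_past (Nat.lt_succ_self t)).1.mono le_sup_left le_rfl
  indep t := indep_sup_of_indep (h.measurable_w t).comap_le (h.measurable_η t).comap_le
    (h.past_le t) (h.indep_pair t) (by rw [← comap_pair_eq]; exact h.indep_past t)
  law := h.law_w

end Noise

end AdaptiveLQR

namespace AdaptiveLQR
open scoped Topology

/-! ### Controllers close to the optimal one -/

section Near

variable {n d : ℕ}

/-- The standing assumptions on the system, the initial and the optimal controller. -/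
structure Problem (sys : System n d) (K0 Kstar : Matrix (Fin d) (Fin n) ℝ) : Prop where
  posS : sys.S.PosDef
  posR : sys.R.PosDef
  sig_pos : 0 < sys.σw
  stab0 : Stabilizes sys K0
  opt : IsOptimalController sys Kstar

variable {sys : System n d} {K0 Kstar : Matrix (Fin d) (Fin n) ℝ}

/-- A controller so close to `Kstar` that it contracts in the norm of the optimal value function. -/
def Near (sys : System n d) (K0 Kstar K : Matrix (Fin d) (Fin n) ℝ) : Prop :=
  ‖K - Kstar‖ ^ 2 ≤ lamMin sys.S ^ 3 / (16 * Gam sys K0 Kstar ^ 6)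

lemma norms_le_Gam :
    ‖sys.A‖ ≤ Gam sys K0 Kstar - 1 ∧ ‖sys.B‖ ≤ Gam sys K0 Kstar - 1 ∧
    ‖valueFn sys K0‖ ≤ Gam sys K0 Kstar - 1 ∧ ‖valueFn sys Kstar‖ ≤ Gam sys K0 Kstar - 1 ∧
    ‖K0‖ ≤ Gam sys K0 Kstar - 1 ∧ ‖Kstar‖ ≤ Gam sys K0 Kstar - 1 ∧
    ‖sys.S‖ ≤ Gam sys K0 Kstar - 1 ∧ ‖sys.R‖ ≤ Gam sys K0 Kstar - 1 := by
  simp [Gam]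

/-- The contraction rate `√(1 - λ_min(S) / ‖V₀‖)`. -/
noncomputable def rho0 (sys : System n d) (K0 : Matrix (Fin d) (Fin n) ℝ) : ℝ :=
  √(1 - lamMin sys.S / ‖valueFn sys K0‖)

lemma rhoBar_eq : rhoBar sys K0 = (rho0 sys K0 + 1) / 2 := rfl

namespace Problem

variable [NeZero n] (h : Problem sys K0 Kstar)
include h

lemma lam_pos : 0 < lamMin sys.S := lamMin_pos h.posS

lemma lam_le : lamMin sys.S ≤ ‖valueFn sys K0‖ :=
  le_of_quad_le (lamMin_le_quad_valueFn h.posS h.posR h.stab0) (quad_le _)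

lemma v0_pos : 0 < ‖valueFn sys K0‖ := h.lam_pos.trans_le h.lam_le

omit [NeZero n] in
lemma v0_le : ‖valueFn sys K0‖ ≤ Gam sys K0 Kstar - 1 := norms_le_Gam.2.2.1

lemma lam_lt_Gam : lamMin sys.S < Gam sys K0 Kstar := by
  linarith [h.lam_le, h.v0_le]

lemma one_lt_Gam : 1 < Gam sys K0 Kstar := by linarith [h.v0_pos, h.v0_le]

lemma Gam_pos : 0 < Gam sys K0 Kstar := zero_lt_one.trans h.one_lt_Gam

lemma lam_div_le_one : lamMin sys.S / ‖valueFn sys K0‖ ≤ 1 := (div_le_one h.v0_pos).2 h.lam_le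

lemma rho0_nonneg : 0 ≤ rho0 sys K0 := Real.sqrt_nonneg _

lemma rho0_sq : rho0 sys K0 ^ 2 = 1 - lamMin sys.S / ‖valueFn sys K0‖ :=
  Real.sq_sqrt (sub_nonneg.2 h.lam_div_le_one)

lemma rho0_lt_one : rho0 sys K0 < 1 := by
  have h1 : 0 < lamMin sys.S / ‖valueFn sys K0‖ := div_pos h.lam_pos h.v0_pos
  nlinarith [h.rho0_sq, h.rho0_nonneg]

lemma rhoBar_pos : 0 < rhoBar sys K0 := by rw [rhoBar_eq]; linarith [h.rho0_nonneg]

lemma rhoBar_lt_one : rhoBar sys K0 < 1 := by rw [rhoBar_eq]; linarith [h.rho0_lt_one]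

lemma rho0_le_rhoBar : rho0 sys K0 ≤ rhoBar sys K0 := by rw [rhoBar_eq]; linarith [h.rho0_lt_one]

/-- Since `1 - ρ² = λ / ‖V0‖` and `1 + ρ ≤ 2`, the gap `1 - ρ` is at least half of `λ / ‖V0‖`. -/
lemma gap_rho0 : lamMin sys.S / (4 * ‖valueFn sys K0‖) ≤ (1 - rho0 sys K0) / 2 := by
  have h1 : lamMin sys.S / (4 * ‖valueFn sys K0‖) = (lamMin sys.S / ‖valueFn sys K0‖) / 4 := by
    rw [mul_comm, div_div]
  rw [h1]
  nlinarith [h.rho0_sq, h.rho0_nonneg, h.rho0_lt_one]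

lemma gap_rhoBar : lamMin sys.S / (2 * ‖valueFn sys K0‖) ≤ 1 - rhoBar sys K0 ^ 2 := by
  have h1 : lamMin sys.S / (2 * ‖valueFn sys K0‖) = (lamMin sys.S / ‖valueFn sys K0‖) / 2 := by
    rw [mul_comm, div_div]
  rw [h1, rhoBar_eq]
  nlinarith [h.rho0_sq, h.rho0_nonneg, h.rho0_lt_one]

lemma one_sub_rhoBar_sq_pos : 0 < 1 - rhoBar sys K0 ^ 2 :=
  (div_pos h.lam_pos (by linarith [h.v0_pos])).trans_le h.gap_rhoBar

lemma one_le_tau0 : 1 ≤ tau0 sys K0 := by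
  rw [tau0, Real.one_le_sqrt, one_le_div h.lam_pos]; exact h.lam_le

lemma tau0_sq : tau0 sys K0 ^ 2 = ‖valueFn sys K0‖ / lamMin sys.S :=
  Real.sq_sqrt (div_nonneg h.v0_pos.le h.lam_pos.le)

/-- `τ² / (1 - ρ̄²) ≤ 2 Γ² / λ²`. -/
lemma tau0_sq_div_le {c : ℝ} (hc : 0 ≤ c) :
    c * tau0 sys K0 ^ 2 / (1 - rhoBar sys K0 ^ 2) ≤
      c * (2 * (Gam sys K0 Kstar - 1) ^ 2 / lamMin sys.S ^ 2) := by
  have hl := h.lam_pos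
  have hv := h.v0_pos
  rw [mul_div_assoc]
  refine mul_le_mul_of_nonneg_left ?_ hc
  rw [h.tau0_sq]
  calc _ ≤ ‖valueFn sys K0‖ / lamMin sys.S / (lamMin sys.S / (2 * ‖valueFn sys K0‖)) := by
        exact div_le_div_of_nonneg_left (by positivity) (by positivity) h.gap_rhoBar
    _ = 2 * ‖valueFn sys K0‖ ^ 2 / lamMin sys.S ^ 2 := by field_simp
    _ ≤ _ := by
        have := h.v0_le
        gcongr

/-- Optimality in the order of forms, not only on average. It bounds `V⋆` by `‖V0‖` and allows the
potential to be switched from `V0` to `V⋆` after the initial epoch. -/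
lemma quad_valueFn_star_le (x : Fin n → ℝ) :
    quad (valueFn sys Kstar) x ≤ quad (valueFn sys K0) x := by
  have := quad_valueFn_sub_nonneg h.posS h.posR h.sig_pos h.opt h.stab0 x
  rw [quad_sub_left] at this
  linarith

lemma quad_star_le (x : Fin n → ℝ) :
    quad (valueFn sys Kstar) x ≤ ‖valueFn sys K0‖ * (x ⬝ᵥ x) :=
  (h.quad_valueFn_star_le x).trans (quad_le _ _)

lemma contract_zero (x : Fin n → ℝ) :
    quad (valueFn sys K0) (closedLoop sys K0 *ᵥ x) ≤
      rhoBar sys K0 ^ 2 * quad (valueFn sys K0) x := by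
  refine (valueFn_contract h.posS h.posR h.stab0 (quad_le _) x).trans ?_
  exact mul_le_mul_of_nonneg_right (pow_le_pow_left₀ h.rho0_nonneg h.rho0_le_rhoBar 2)
    (valueFn_nonneg h.posS h.posR h.stab0 x)

/-- `Kstar` contracts at rate `ρ`, and the threshold in `Near` makes the perturbation `B (K -
Kstar)` at most `(1 - ρ) / 2` in the norm of `V⋆`. The rates add up to `ρ̄ = (1 + ρ) / 2`. -/
lemma contract_near {K : Matrix (Fin d) (Fin n) ℝ} (hK : Near sys K0 Kstar K) (x : Fin n → ℝ) :
    quad (valueFn sys Kstar) (closedLoop sys K *ᵥ x) ≤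
      rhoBar sys K0 ^ 2 * quad (valueFn sys Kstar) x := by
  have hl := h.lam_pos
  have hv := h.v0_pos
  have hG := h.Gam_pos
  have hdec : closedLoop sys K = closedLoop sys Kstar + sys.B * (K - Kstar) := by
    rw [closedLoop, closedLoop, Matrix.mul_sub]; abel
  have hΔ : ∀ x, quad (valueFn sys Kstar) ((sys.B * (K - Kstar)) *ᵥ x) ≤
      ((1 - rho0 sys K0) / 2) ^ 2 * quad (valueFn sys Kstar) x := fun x => by
    have h1 := h.quad_star_le ((sys.B * (K - Kstar)) *ᵥ x)
    have h2 : ((sys.B * (K - Kstar)) *ᵥ x) ⬝ᵥ ((sys.B * (K - Kstar)) *ᵥ x) ≤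
        (‖sys.B‖ * ‖K - Kstar‖) ^ 2 * (x ⬝ᵥ x) :=
      (mulVec_dot_self_le _ _).trans (mul_le_mul_of_nonneg_right
        (pow_le_pow_left₀ (norm_nonneg _) (Matrix.l2_opNorm_mul _ _) 2) (dot_self_nonneg _))
    have h3 := lamMin_le_quad_valueFn h.posS h.posR h.opt.1 x
    -- The extra factor `lamMin S` converts `|x|²` back into the form `V⋆`; clearing denominators
    -- leaves `16 Γ⁵ ‖K - Kstar‖² ≤ λ³`, which the threshold with `Γ⁶` more than covers.
    have h4 : ‖valueFn sys K0‖ * (‖sys.B‖ * ‖K - Kstar‖) ^ 2 ≤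
        (lamMin sys.S / (4 * ‖valueFn sys K0‖)) ^ 2 * lamMin sys.S := by
      have hb : ‖sys.B‖ ≤ Gam sys K0 Kstar := by
        linarith [(norms_le_Gam (sys := sys) (K0 := K0) (Kstar := Kstar)).2.1]
      have hv' : ‖valueFn sys K0‖ ≤ Gam sys K0 Kstar := by linarith [h.v0_le]
      rw [div_pow, div_mul_eq_mul_div, le_div_iff₀ (by positivity)]
      have hK' := hK
      rw [Near, le_div_iff₀ (by positivity)] at hK'
      calc ‖valueFn sys K0‖ * (‖sys.B‖ * ‖K - Kstar‖) ^ 2 * (4 * ‖valueFn sys K0‖) ^ 2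
          = ‖K - Kstar‖ ^ 2 * (16 * (‖valueFn sys K0‖ ^ 3 * ‖sys.B‖ ^ 2)) := by ring
        _ ≤ ‖K - Kstar‖ ^ 2 * (16 * (Gam sys K0 Kstar ^ 3 * Gam sys K0 Kstar ^ 2)) := by gcongr
        _ ≤ ‖K - Kstar‖ ^ 2 * (16 * Gam sys K0 Kstar ^ 6) := by
            rw [← pow_add]
            gcongr
            · exact h.one_lt_Gam.le
            · norm_num
        _ ≤ _ := by nlinarith
    calc _ ≤ ‖valueFn sys K0‖ * ((‖sys.B‖ * ‖K - Kstar‖) ^ 2 * (x ⬝ᵥ x)) :=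
          h1.trans (mul_le_mul_of_nonneg_left h2 hv.le)
      _ ≤ (lamMin sys.S / (4 * ‖valueFn sys K0‖)) ^ 2 * lamMin sys.S * (x ⬝ᵥ x) := by
          rw [← mul_assoc]; exact mul_le_mul_of_nonneg_right h4 (dot_self_nonneg _)
      _ ≤ (lamMin sys.S / (4 * ‖valueFn sys K0‖)) ^ 2 * quad (valueFn sys Kstar) x := by
          rw [mul_assoc]; exact mul_le_mul_of_nonneg_left h3 (sq_nonneg _)
      _ ≤ _ := by
          refine mul_le_mul_of_nonneg_right (pow_le_pow_left₀ (by positivity) h.gap_rho0 2)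
            (valueFn_nonneg h.posS h.posR h.opt.1 x)
  have hmain := quad_add_mulVec_le (valueFn_transpose h.posS h.posR h.opt.1)
    (valueFn_nonneg h.posS h.posR h.opt.1) h.rho0_nonneg (s := (1 - rho0 sys K0) / 2)
    (by linarith [h.rho0_lt_one])
    (fun x => valueFn_contract h.posS h.posR h.opt.1 h.quad_star_le x) hΔ x
  rw [hdec, rhoBar_eq]
  refine hmain.trans (le_of_eq ?_)
  congr 2; ring

lemma norm_pow_zero (k : ℕ) : ‖closedLoop sys K0 ^ k‖ ≤ tau0 sys K0 * rhoBar sys K0 ^ k :=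
  norm_pow_le_of_contraction h.lam_pos h.v0_pos.le h.rhoBar_pos.le
    (lamMin_le_quad_valueFn h.posS h.posR h.stab0) (quad_le _) h.contract_zero k

lemma norm_pow_near {K : Matrix (Fin d) (Fin n) ℝ} (hK : Near sys K0 Kstar K) (k : ℕ) :
    ‖closedLoop sys K ^ k‖ ≤ tau0 sys K0 * rhoBar sys K0 ^ k :=
  norm_pow_le_of_contraction h.lam_pos h.v0_pos.le h.rhoBar_pos.le
    (lamMin_le_quad_valueFn h.posS h.posR h.opt.1) h.quad_star_le (h.contract_near hK) k

lemma tauRhoStable_zero : TauRhoStable (tau0 sys K0) (rhoBar sys K0) (closedLoop sys K0) :=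
  ⟨h.one_le_tau0, h.rhoBar_pos, h.rhoBar_lt_one, h.norm_pow_zero⟩

lemma tauRhoStable_near {K : Matrix (Fin d) (Fin n) ℝ} (hK : Near sys K0 Kstar K) :
    TauRhoStable (tau0 sys K0) (rhoBar sys K0) (closedLoop sys K) :=
  ⟨h.one_le_tau0, h.rhoBar_pos, h.rhoBar_lt_one, h.norm_pow_near hK⟩

lemma stabilizes_near {K : Matrix (Fin d) (Fin n) ℝ} (hK : Near sys K0 Kstar K) :
    Stabilizes sys K :=
  isStable_of_norm_pow_le h.rhoBar_pos.le h.rhoBar_lt_one (h.norm_pow_near hK)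

lemma near_le_one {K : Matrix (Fin d) (Fin n) ℝ} (hK : Near sys K0 Kstar K) :
    ‖K - Kstar‖ ≤ 1 := by
  have h1 : ‖K - Kstar‖ ^ 2 ≤ 1 := by
    refine hK.trans ?_
    have hG := h.Gam_pos
    rw [div_le_one (by positivity)]
    calc lamMin sys.S ^ 3 ≤ Gam sys K0 Kstar ^ 3 := by
          have := h.lam_lt_Gam; have := h.lam_pos; gcongr
      _ ≤ Gam sys K0 Kstar ^ 6 := pow_le_pow_right₀ h.one_lt_Gam.le (by norm_num)
      _ ≤ _ := by nlinarith [pow_pos hG 6]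
  nlinarith [norm_nonneg (K - Kstar)]

lemma norm_valueFn_zero_le : ‖valueFn sys K0‖ ≤ Vmax sys K0 Kstar := by
  have hl := h.lam_pos
  have hG := h.one_lt_Gam
  rw [Vmax, le_div_iff₀ (by positivity)]
  have h1 := h.v0_le
  have h2 : lamMin sys.S ^ 2 ≤ Gam sys K0 Kstar ^ 2 := by
    have := h.lam_lt_Gam; gcongr
  calc _ ≤ Gam sys K0 Kstar * Gam sys K0 Kstar ^ 2 :=
        mul_le_mul (by linarith) h2 (by positivity) (by linarith)
    _ = Gam sys K0 Kstar ^ 3 := by ring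
    _ ≤ Gam sys K0 Kstar ^ 5 := pow_le_pow_right₀ hG.le (by norm_num)
    _ ≤ _ := by nlinarith [pow_pos h.Gam_pos 5]

/-- The stage cost matrix has norm at most `2 Γ³` and the Lyapunov series multiplies by at most `2
Γ² / λ²`; their product is `Vmax`. -/
lemma norm_valueFn_near_le {K : Matrix (Fin d) (Fin n) ℝ} (hK : Near sys K0 Kstar K) :
    ‖valueFn sys K‖ ≤ Vmax sys K0 Kstar := by
  have hl := h.lam_pos
  have hG := h.one_lt_Gam
  obtain ⟨-, -, -, -, -, h6, h7, h8⟩ := norms_le_Gam (sys := sys) (K0 := K0) (Kstar := Kstar)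
  have hKn : ‖K‖ ≤ Gam sys K0 Kstar := by
    calc ‖K‖ = ‖(K - Kstar) + Kstar‖ := by rw [sub_add_cancel]
      _ ≤ 1 + (Gam sys K0 Kstar - 1) := (norm_add_le _ _).trans (add_le_add (h.near_le_one hK) h6)
      _ = _ := by ring
  have hQ : ‖sys.S + Kᵀ * sys.R * K‖ ≤ (Gam sys K0 Kstar - 1) * (1 + Gam sys K0 Kstar ^ 2) := by
    have h9 : ‖Kᵀ * sys.R * K‖ ≤ ‖K‖ * ‖sys.R‖ * ‖K‖ := by
      refine (Matrix.l2_opNorm_mul _ _).trans (mul_le_mul_of_nonneg_right ?_ (norm_nonneg _))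
      refine (Matrix.l2_opNorm_mul _ _).trans ?_
      rw [norm_transpose]
    calc _ ≤ ‖sys.S‖ + ‖K‖ * ‖sys.R‖ * ‖K‖ := (norm_add_le _ _).trans (by gcongr)
      _ ≤ (Gam sys K0 Kstar - 1) +
          Gam sys K0 Kstar * (Gam sys K0 Kstar - 1) * Gam sys K0 Kstar := by gcongr
      _ = _ := by ring
  refine (norm_lyapunov_le (valueFn_eq (h.stabilizes_near hK)) (h.stabilizes_near hK)
    h.rhoBar_pos.le h.rhoBar_lt_one (h.norm_pow_near hK)).trans ?_
  refine (h.tau0_sq_div_le (norm_nonneg _)).trans ?_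
  rw [Vmax, ← mul_div_assoc]
  refine div_le_div_of_nonneg_right ?_ (by positivity)
  have hg0 : 0 ≤ Gam sys K0 Kstar - 1 := by linarith
  calc _ ≤ (Gam sys K0 Kstar * (2 * Gam sys K0 Kstar ^ 2)) * (2 * Gam sys K0 Kstar ^ 2) := by
        refine mul_le_mul (hQ.trans (mul_le_mul (by linarith) ?_ (by positivity) (by linarith)))
          (by gcongr; linarith) (by positivity) (by positivity)
        nlinarith
    _ = _ := by ring

lemma norm_inputWeight_le : ‖inputWeight sys (valueFn sys Kstar)‖ ≤ Gam sys K0 Kstar ^ 3 := by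
  obtain ⟨-, h2, -, h4, -, -, -, h8⟩ := norms_le_Gam (sys := sys) (K0 := K0) (Kstar := Kstar)
  have hG := h.one_lt_Gam
  have hg0 : 0 ≤ Gam sys K0 Kstar - 1 := by linarith
  have h9 : ‖sys.Bᵀ * valueFn sys Kstar * sys.B‖ ≤ ‖sys.B‖ * ‖valueFn sys Kstar‖ * ‖sys.B‖ := by
    refine (Matrix.l2_opNorm_mul _ _).trans (mul_le_mul_of_nonneg_right ?_ (norm_nonneg _))
    refine (Matrix.l2_opNorm_mul _ _).trans ?_
    rw [norm_transpose]
  calc _ ≤ ‖sys.R‖ + ‖sys.B‖ * ‖valueFn sys Kstar‖ * ‖sys.B‖ :=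
        (norm_add_le _ _).trans (by gcongr)
    _ ≤ (Gam sys K0 Kstar - 1) +
        (Gam sys K0 Kstar - 1) * (Gam sys K0 Kstar - 1) * (Gam sys K0 Kstar - 1) := by gcongr
    _ ≤ _ := by nlinarith [mul_nonneg hg0 hg0, mul_nonneg (mul_nonneg hg0 hg0) hg0]

lemma norm_valueFn_sub_near_le {K : Matrix (Fin d) (Fin n) ℝ} (hK : Near sys K0 Kstar K) :
    ‖valueFn sys K - valueFn sys Kstar‖ ≤
      2 * (Gam sys K0 Kstar ^ 5 / lamMin sys.S ^ 2) * ‖K - Kstar‖ ^ 2 := by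
  have hst := h.stabilizes_near hK
  have hl := h.lam_pos
  have hG := h.one_lt_Gam
  refine (norm_lyapunov_le (valueFn_sub_eq h.posS h.posR h.sig_pos h.opt hst) hst
    h.rhoBar_pos.le h.rhoBar_lt_one (h.norm_pow_near hK)).trans ?_
  refine (h.tau0_sq_div_le (norm_nonneg _)).trans ?_
  have h9 : ‖(K - Kstar)ᵀ * inputWeight sys (valueFn sys Kstar) * (K - Kstar)‖ ≤
      ‖K - Kstar‖ * Gam sys K0 Kstar ^ 3 * ‖K - Kstar‖ := by
    refine (Matrix.l2_opNorm_mul _ _).trans (mul_le_mul_of_nonneg_right ?_ (norm_nonneg _))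
    refine (Matrix.l2_opNorm_mul _ _).trans ?_
    rw [norm_transpose]
    exact mul_le_mul_of_nonneg_left h.norm_inputWeight_le (norm_nonneg _)
  calc _ ≤ (‖K - Kstar‖ * Gam sys K0 Kstar ^ 3 * ‖K - Kstar‖) *
        (2 * Gam sys K0 Kstar ^ 2 / lamMin sys.S ^ 2) := by
        have hg0 : 0 ≤ Gam sys K0 Kstar - 1 := by linarith
        gcongr
        linarith
    _ = _ := by ring

/-- The source of the Lyapunov equation passes through the `d`-dimensional input space, so the trace
costs a factor `d` rather than `n`. -/
lemma trace_valueFn_sub_near_le {K : Matrix (Fin d) (Fin n) ℝ} (hK : Near sys K0 Kstar K) :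
    (valueFn sys K - valueFn sys Kstar).trace ≤
      2 * d * (Gam sys K0 Kstar ^ 5 / lamMin sys.S ^ 2) * ‖K - Kstar‖ ^ 2 := by
  have hst := h.stabilizes_near hK
  have hl := h.lam_pos
  have hG := h.one_lt_Gam
  refine (trace_lyapunov_le (valueFn_sub_eq h.posS h.posR h.sig_pos h.opt hst) hst
    h.rhoBar_pos.le h.rhoBar_lt_one (h.norm_pow_near hK)).trans ?_
  refine (h.tau0_sq_div_le (by positivity)).trans ?_
  calc _ ≤ (d * (Gam sys K0 Kstar ^ 3 * ‖K - Kstar‖ ^ 2)) *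
        (2 * Gam sys K0 Kstar ^ 2 / lamMin sys.S ^ 2) := by
        have hg0 : 0 ≤ Gam sys K0 Kstar - 1 := by linarith
        have := h.norm_inputWeight_le
        gcongr
        linarith
    _ = _ := by ring

/-- Nearness makes the norm of the excess at most `lamMin S`, a lower bound for `V⋆`. Thus the
potential `W` also controls the excess value. -/
lemma quad_valueFn_sub_near_le {K : Matrix (Fin d) (Fin n) ℝ} (hK : Near sys K0 Kstar K)
    (x : Fin n → ℝ) :
    quad (valueFn sys K - valueFn sys Kstar) x ≤ quad (valueFn sys Kstar) x := by
  refine le_trans ?_ (lamMin_le_quad_valueFn h.posS h.posR h.opt.1 x)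
  refine (quad_le _ _).trans (mul_le_mul_of_nonneg_right ?_ (dot_self_nonneg _))
  refine (h.norm_valueFn_sub_near_le hK).trans ?_
  have hl := h.lam_pos
  have hG := h.one_lt_Gam
  have hG0 := h.Gam_pos
  calc _ ≤ 2 * (Gam sys K0 Kstar ^ 5 / lamMin sys.S ^ 2) *
        (lamMin sys.S ^ 3 / (16 * Gam sys K0 Kstar ^ 6)) := by
        have : ‖K - Kstar‖ ^ 2 ≤ lamMin sys.S ^ 3 / (16 * Gam sys K0 Kstar ^ 6) := hK
        gcongr
    _ = lamMin sys.S * (1 / (8 * Gam sys K0 Kstar)) := by field_simp; norm_num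
    _ ≤ lamMin sys.S * 1 := by
        gcongr
        rw [div_le_one (by positivity)]; linarith
    _ = _ := mul_one _

end Problem

end Near

end AdaptiveLQR

namespace AdaptiveLQR
open scoped Topology

/-! ### Runs of the algorithm -/

/-- A run of the algorithm, with an accuracy `eps i` that is aimed at in epoch `i`. -/
structure Run (n d : ℕ) (Ω : Type*) where
  sys : System n d
  Est : Estimator n d
  Tmult : ℕ
  K0 : Matrix (Fin d) (Fin n) ℝ
  Kstar : Matrix (Fin d) (Fin n) ℝ
  α : ℝ
  w : ℕ → Ω → Fin n → ℝ
  η : ℕ → Ω → Fin d → ℝ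
  eps : ℕ → ℝ

namespace Run

variable {n d : ℕ} {Ω : Type*} (r : Run n d Ω)

/-- The random state. -/
def X (t : ℕ) (ω : Ω) : Fin n → ℝ :=
  stateAt r.sys r.Est r.Tmult r.K0 (fun s => r.w s ω) (fun s => r.η s ω) t

/-- The random controller of an epoch. -/
def gain (i : ℕ) (ω : Ω) : Matrix (Fin d) (Fin n) ℝ := ctrl r.sys r.Est r.Tmult r.K0 r.w r.η i ω

/-- The epoch of a time step. -/
def ep (t : ℕ) : ℕ := epochOf r.Tmult t

/-- The random closed-loop matrix at a time step. -/
def L (t : ℕ) (ω : Ω) : Matrix (Fin n) (Fin n) ℝ := closedLoop r.sys (r.gain (r.ep t) ω)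

/-- The event that all controllers up to `i` are as accurate as intended. -/
def good (i : ℕ) : Set Ω := {ω | ∀ j < i, ‖r.gain (j + 1) ω - r.Kstar‖ ≤ r.eps j}

/-- The initial value function. -/
noncomputable abbrev V0 : Matrix (Fin n) (Fin n) ℝ := valueFn r.sys r.K0

/-- The optimal value function. -/
noncomputable abbrev Vs : Matrix (Fin n) (Fin n) ℝ := valueFn r.sys r.Kstar

/-- The weight in whose norm the controller of epoch `i` contracts. -/
noncomputable def W (i : ℕ) : Matrix (Fin n) (Fin n) ℝ := if i = 0 then r.V0 else r.Vs

/-- `Γ_⋆`. -/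
noncomputable abbrev Γ : ℝ := Gam r.sys r.K0 r.Kstar

/-- `λ_min(S)`. -/
noncomputable abbrev lam : ℝ := lamMin r.sys.S

/-- `ρ̄`. -/
noncomputable abbrev rho : ℝ := rhoBar r.sys r.K0

/-- The standing assumptions on a run. -/
structure Valid [MeasurableSpace Ω] (μ : Measure Ω) : Prop where
  prob : Problem r.sys r.K0 r.Kstar
  est : r.Est.IsMeasurable
  Tmult_pos : 0 < r.Tmult
  alpha : 0 < 1 + r.α
  noise : IsNoise r.sys μ r.Tmult r.α r.w r.η
  eps_pos : ∀ i, 0 < r.eps i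
  eps_sq_le : ∀ i, r.eps i ^ 2 ≤ r.lam ^ 3 / (16 * r.Γ ^ 6)

lemma good_zero : r.good 0 = Set.univ := by simp [good]

lemma good_succ (i : ℕ) :
    r.good (i + 1) = r.good i \ {ω | r.eps i < ‖r.gain (i + 1) ω - r.Kstar‖} := by
  ext ω
  constructor
  · intro h
    exact ⟨fun j hj => h j (hj.trans (Nat.lt_succ_self i)), not_lt.2 (h i (Nat.lt_succ_self i))⟩
  · rintro ⟨h1, h2⟩ j hj
    rcases (Nat.lt_succ_iff.1 hj).lt_or_eq with h | rfl
    · exact h1 j h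
    · exact not_lt.1 h2

lemma good_anti {i j : ℕ} (h : i ≤ j) : r.good j ⊆ r.good i := fun _ hω k hk => hω k (hk.trans_le h)

lemma ep_mono {s t : ℕ} (h : s ≤ t) : r.ep s ≤ r.ep t := epochOf_mono h

lemma ep_zero : r.ep 0 = 0 := epochOf_zero

lemma X_zero (ω : Ω) : r.X 0 ω = 0 := stateAt_zero _ _

lemma gain_zero (ω : Ω) : r.gain 0 ω = r.K0 := rfl

lemma sigEta_sq (i : ℕ) :
    sigEta r.sys r.α i ^ 2 = r.sys.σw ^ 2 * (1 / 2 ^ i : ℝ) ^ (1 / (1 + r.α)) :=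
  Real.sq_sqrt (by positivity)

namespace Valid

variable {r} [m0 : MeasurableSpace Ω] {μ : Measure Ω} (h : r.Valid μ)
include h

lemma X_succ (t : ℕ) (ω : Ω) :
    r.X (t + 1) ω = r.L t ω *ᵥ r.X t ω + r.sys.B *ᵥ r.η t ω + r.w t ω := by
  rw [X, stateAt_succ h.Tmult_pos, inputAt, step_eq_closedLoop]; rfl

lemma X_epochStart (i : ℕ) (ω : Ω) : r.X (epochStart r.Tmult i) ω =
    initState r.sys r.Est r.Tmult r.K0 r.w r.η i ω := stateAt_epochStart h.Tmult_pos _ _ _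

lemma measurable_X (t : ℕ) : Measurable[past r.w r.η t] (r.X t) :=
  measurable_stateAt h.Tmult_pos h.est r.w r.η t

lemma measurable_gain_start (i : ℕ) (a b) :
    Measurable[past r.w r.η (epochStart r.Tmult i)] fun ω => r.gain i ω a b :=
  (measurable_epoch h.est r.w r.η i).1 a b

lemma measurable_gain (t : ℕ) (a b) : Measurable[past r.w r.η t] fun ω => r.gain (r.ep t) ω a b :=
  measurable_ctrl_past h.Tmult_pos h.est r.w r.η le_rfl a b

lemma measurable_L (t : ℕ) (a b) : Measurable[past r.w r.η t] fun ω => r.L t ω a b := by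
  simp only [L, closedLoop, Matrix.add_apply]
  exact (measurable_mul_rand (M := fun _ => r.sys.B) (fun i j => measurable_const)
    (h.measurable_gain t) a b).const_add _

lemma measurableSet_good (i : ℕ) : MeasurableSet[past r.w r.η (epochStart r.Tmult i)] (r.good i) := by
  have h1 : r.good i = ⋂ j ∈ Set.Iio i, {ω | ‖r.gain (j + 1) ω - r.Kstar‖ ≤ r.eps j} := by
    ext ω; simp [good]
  rw [h1]
  refine MeasurableSet.biInter (Set.to_countable _) fun j hj => ?_
  have h2 : Continuous fun M : Fin d → Fin n → ℝ => ‖(Matrix.of M - r.Kstar)‖ := by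
    refine continuous_norm.comp (Continuous.sub ?_ continuous_const)
    exact continuous_id
  refine measurableSet_Iic.preimage (h2.measurable.comp (f := fun ω => (r.gain (j + 1) ω : Fin d → Fin n → ℝ)) ?_)
  refine measurable_of_entries fun a b => ?_
  exact (h.measurable_gain_start (j + 1) a b).mono
    (past_mono r.w r.η (epochStart_mono (Nat.succ_le_of_lt hj))) le_rfl

lemma measurableSet_good_ep (t : ℕ) : MeasurableSet[past r.w r.η t] (r.good (r.ep t)) :=
  past_mono r.w r.η (epochStart_epochOf_le h.Tmult_pos t) _ (h.measurableSet_good _)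

lemma near {i : ℕ} {ω : Ω} (hω : ω ∈ r.good (i + 1)) : Near r.sys r.K0 r.Kstar (r.gain (i + 1) ω) :=
  (pow_le_pow_left₀ (norm_nonneg _) (hω i (Nat.lt_succ_self i)) 2).trans (h.eps_sq_le i)

variable [NeZero n]

lemma stabilizes {i : ℕ} {ω : Ω} (hω : ω ∈ r.good i) : Stabilizes r.sys (r.gain i ω) := by
  cases i with
  | zero => exact h.prob.stab0
  | succ i => exact h.prob.stabilizes_near (h.near hω)

lemma norm_valueFn_le {i : ℕ} {ω : Ω} (hω : ω ∈ r.good i) :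
    ‖valueFn r.sys (r.gain i ω)‖ ≤ Vmax r.sys r.K0 r.Kstar := by
  cases i with
  | zero => exact h.prob.norm_valueFn_zero_le
  | succ i => exact h.prob.norm_valueFn_near_le (h.near hω)

lemma tauRhoStable {i : ℕ} {ω : Ω} (hω : ω ∈ r.good i) :
    TauRhoStable (tau0 r.sys r.K0) r.rho (closedLoop r.sys (r.gain i ω)) := by
  cases i with
  | zero => exact h.prob.tauRhoStable_zero
  | succ i => exact h.prob.tauRhoStable_near (h.near hω)

omit [NeZero n] in
lemma W_posSemidef (i : ℕ) : (r.W i).PosSemidef := by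
  unfold W; split_ifs
  · exact valueFn_posSemidef h.prob.posS h.prob.posR h.prob.stab0
  · exact valueFn_posSemidef h.prob.posS h.prob.posR h.prob.opt.1

omit [NeZero n] in
lemma Vs_posSemidef : (r.Vs).PosSemidef :=
  valueFn_posSemidef h.prob.posS h.prob.posR h.prob.opt.1

omit [NeZero n] in
lemma quad_W_nonneg (i : ℕ) (x : Fin n → ℝ) : 0 ≤ quad (r.W i) x :=
  quad_nonneg_of_posSemidef (h.W_posSemidef i) x

omit [NeZero n] in
lemma lam_le_quad_W (i : ℕ) (x : Fin n → ℝ) : r.lam * (x ⬝ᵥ x) ≤ quad (r.W i) x := by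
  unfold W; split_ifs
  · exact lamMin_le_quad_valueFn h.prob.posS h.prob.posR h.prob.stab0 x
  · exact lamMin_le_quad_valueFn h.prob.posS h.prob.posR h.prob.opt.1 x

lemma quad_W_le (i : ℕ) (x : Fin n → ℝ) : quad (r.W i) x ≤ ‖r.V0‖ * (x ⬝ᵥ x) := by
  unfold W; split_ifs
  · exact quad_le _ _
  · exact h.prob.quad_star_le x

/-- The weight changes only once, from `V0` to the smaller `V⋆`; so no factor accumulates over the
epochs. -/
lemma quad_W_anti {i j : ℕ} (hij : i ≤ j) (x : Fin n → ℝ) : quad (r.W j) x ≤ quad (r.W i) x := by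
  unfold W; split_ifs with h1 h2 h2
  · rfl
  · omega
  · exact h.prob.quad_valueFn_star_le x
  · rfl

lemma contract {i : ℕ} {ω : Ω} (hω : ω ∈ r.good i) (x : Fin n → ℝ) :
    quad (r.W i) (closedLoop r.sys (r.gain i ω) *ᵥ x) ≤ r.rho ^ 2 * quad (r.W i) x := by
  cases i with
  | zero => exact h.prob.contract_zero x
  | succ i => exact h.prob.contract_near (h.near hω) x

lemma trace_W_le (i : ℕ) : (r.W i).trace ≤ n * (r.Γ - 1) := by
  refine trace_le_of_quad_le fun x => (h.quad_W_le i x).trans ?_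
  exact mul_le_mul_of_nonneg_right h.prob.v0_le (dot_self_nonneg x)

omit [NeZero n] in
lemma sigEta_sq_le (i : ℕ) : sigEta r.sys r.α i ^ 2 ≤ r.sys.σw ^ 2 := by
  rw [r.sigEta_sq]
  refine mul_le_of_le_one_right (sq_nonneg _) (Real.rpow_le_one (by positivity) ?_ ?_)
  · rw [div_le_one (by positivity)]; exact one_le_pow₀ (by norm_num)
  · have := h.alpha; positivity

end Valid
end Run

/-! ### Second moments of the states -/

section SecondMoment

variable {Ω : Type*} {n m : ℕ} {F : ℕ → MeasurableSpace Ω} [m0 : MeasurableSpace Ω] {μ : Measure Ω}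
  {ν : ℕ → Ω → Fin m → ℝ} {σ : ℕ → ℝ} [IsProbabilityMeasure μ]

/-- The event is decided before the noise, so its indicator can be frozen together with `a`. Centred
noise contributes no cross term, only a trace. -/
lemma DrivenBy.lintegral_quad_add_le (h : DrivenBy F μ ν σ) (t : ℕ) {G : Set Ω}
    (hG : MeasurableSet[F t] G) {a : Ω → Fin n → ℝ} (ha : Measurable[F t] a)
    {N : Matrix (Fin n) (Fin n) ℝ} (hN : N.PosSemidef) (C : Matrix (Fin n) (Fin m) ℝ) {b : ℝ}
    (hb : σ t ^ 2 * (Cᵀ * N * C).trace ≤ b) :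
    ∫⁻ ω in G, ENNReal.ofReal (quad N (a ω + C *ᵥ ν t ω)) ∂μ ≤
      ∫⁻ ω in G, ENNReal.ofReal (quad N (a ω)) ∂μ + ENNReal.ofReal b := by
  have hG0 := h.le t _ hG
  have hI : Measurable[F t] (G.indicator (1 : Ω → ℝ≥0∞)) :=
    Measurable.indicator (@measurable_const _ _ _ (_) _) hG
  have hf : Measurable (Function.uncurry fun (p : ℝ≥0∞ × (Fin n → ℝ)) (z : Fin m → ℝ) =>
      p.1 * ENNReal.ofReal (quad N (p.2 + C *ᵥ z))) := by
    have h1 : Measurable fun q : (ℝ≥0∞ × (Fin n → ℝ)) × (Fin m → ℝ) => q.1.2 + C *ᵥ q.2 :=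
      (measurable_snd.comp measurable_fst).add ((measurable_mulVec C).comp measurable_snd)
    exact (measurable_fst.comp measurable_fst).mul ((measurable_quad N).comp h1).ennreal_ofReal
  have h1 := h.lintegral t (hI.prodMk ha) hf
  have h2 : ∀ (g : Ω → ℝ≥0∞), ∫⁻ ω, G.indicator (1 : Ω → ℝ≥0∞) ω * g ω ∂μ = ∫⁻ ω in G, g ω ∂μ := by
    intro g
    rw [← lintegral_indicator hG0]
    refine lintegral_congr fun ω => ?_
    by_cases hω : ω ∈ G <;> simp [hω]
  have hm : ∀ ω, Measurable fun z => ENNReal.ofReal (quad N (a ω + C *ᵥ z)) := fun ω =>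
    ((measurable_quad N).comp ((measurable_mulVec C).const_add _)).ennreal_ofReal
  simp only at h1
  rw [h2] at h1
  rw [h1]
  simp_rw [lintegral_const_mul _ (hm _), lintegral_quad_add_isoGaussian hN]
  rw [h2]
  calc _ ≤ ∫⁻ ω in G, (ENNReal.ofReal (quad N (a ω)) + ENNReal.ofReal b) ∂μ := by
        refine lintegral_mono fun ω => ?_
        rw [← ENNReal.ofReal_add (quad_nonneg_of_posSemidef hN _)]
        · exact ENNReal.ofReal_le_ofReal (by linarith)
        · refine le_trans (mul_nonneg (sq_nonneg _) ?_) hb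
          exact trace_nonneg_of_quad fun x => quad_nonneg_of_posSemidef (posSemidef_conj hN C) x
    _ = ∫⁻ ω in G, ENNReal.ofReal (quad N (a ω)) ∂μ + ENNReal.ofReal b * μ G := by
        rw [lintegral_add_right _ measurable_const, lintegral_const, Measure.restrict_apply_univ]
    _ ≤ _ := by
        gcongr
        exact mul_le_of_le_one_right' prob_le_one

end SecondMoment

namespace Run.Valid

variable {n d : ℕ} {Ω : Type*} {r : Run n d Ω} [m0 : MeasurableSpace Ω] {μ : Measure Ω}
  [IsProbabilityMeasure μ] [NeZero n] (h : r.Valid μ)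
include h

/-- The bound is the fixed point of `y ↦ ρ̄² y + κ (1 + g)`, where `κ` bounds the contribution of
`w` and `κ g` that of `η`. Integrals over good events are used in place of conditional moments
because they only decrease when the event shrinks. -/
lemma lintegral_quad_X_le (t : ℕ) :
    ∫⁻ ω in r.good (r.ep t), ENNReal.ofReal (quad (r.W (r.ep t)) (r.X t ω)) ∂μ ≤
      ENNReal.ofReal (n * (r.Γ - 1) * r.sys.σw ^ 2 * (1 + (r.Γ - 1) ^ 2) / (1 - r.rho ^ 2)) := by
  set κ := n * (r.Γ - 1) * r.sys.σw ^ 2 with hκ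
  set g := (r.Γ - 1) ^ 2 with hg
  have hgap := h.prob.one_sub_rhoBar_sq_pos
  have hΓ := h.prob.one_lt_Gam
  have hκ0 : 0 ≤ κ := mul_nonneg (mul_nonneg (Nat.cast_nonneg _) (by linarith)) (sq_nonneg _)
  have hg0 : 0 ≤ g := sq_nonneg _
  induction t with
  | zero => simp [X_zero]
  | succ t ih =>
    have hGm := h.measurableSet_good_ep t
    have hep := r.ep_mono (Nat.le_succ t)
    have hle1 : past r.w r.η t ≤ pastInput r.w r.η t := le_sup_left
    have haη : Measurable[past r.w r.η t] fun ω => r.L t ω *ᵥ r.X t ω :=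
      measurable_mulVec_rand (h.measurable_L t) (h.measurable_X t)
    have haw : Measurable[pastInput r.w r.η t] fun ω =>
        r.L t ω *ᵥ r.X t ω + r.sys.B *ᵥ r.η t ω := by
      refine Measurable.add (haη.mono hle1 le_rfl) ((measurable_mulVec _).comp ?_)
      exact (comap_measurable (r.η t)).mono le_sup_right le_rfl
    have hN := h.W_posSemidef (r.ep t)
    have hbw : r.sys.σw ^ 2 * ((1 : Matrix (Fin n) (Fin n) ℝ)ᵀ * r.W (r.ep t) * 1).trace ≤ κ := by
      rw [Matrix.transpose_one, one_mul, mul_one, hκ, mul_comm (_ * _)]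
      exact mul_le_mul_of_nonneg_left (h.trace_W_le _) (sq_nonneg _)
    have hbη : sigEta r.sys r.α (r.ep t) ^ 2 * (r.sys.Bᵀ * r.W (r.ep t) * r.sys.B).trace ≤
        κ * g := by
      have h1 := trace_conj_le_trace hN r.sys.B
      have h2 : ‖r.sys.B‖ ^ 2 ≤ g := pow_le_pow_left₀ (norm_nonneg _) norms_le_Gam.2.1 2
      have h3 : 0 ≤ (r.W (r.ep t)).trace := trace_nonneg_of_quad (h.quad_W_nonneg _)
      calc _ ≤ r.sys.σw ^ 2 * (g * (n * (r.Γ - 1))) := by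
            refine mul_le_mul (h.sigEta_sq_le _) ?_ ?_ (sq_nonneg _)
            · exact h1.trans (mul_le_mul h2 (h.trace_W_le _) h3 hg0)
            · exact trace_nonneg_of_quad fun x =>
                quad_nonneg_of_posSemidef (posSemidef_conj hN _) x
        _ = _ := by rw [hκ]; ring
    -- If a new epoch starts at `t + 1`, both the weight and the event are replaced by larger ones,
    -- those of time `t`.
    calc _ ≤ ∫⁻ ω in r.good (r.ep t), ENNReal.ofReal (quad (r.W (r.ep t)) (r.X (t + 1) ω)) ∂μ := by
          refine (lintegral_mono fun ω => ENNReal.ofReal_le_ofReal (h.quad_W_anti hep _)).trans ?_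
          exact lintegral_mono_set (r.good_anti hep)
      _ = ∫⁻ ω in r.good (r.ep t), ENNReal.ofReal (quad (r.W (r.ep t))
            (r.L t ω *ᵥ r.X t ω + r.sys.B *ᵥ r.η t ω + (1 : Matrix (Fin n) (Fin n) ℝ) *ᵥ r.w t ω)) ∂μ := by
          simp only [h.X_succ, Matrix.one_mulVec]
      _ ≤ ∫⁻ ω in r.good (r.ep t), ENNReal.ofReal (quad (r.W (r.ep t)) (r.L t ω *ᵥ r.X t ω)) ∂μ +
            ENNReal.ofReal (κ * g) + ENNReal.ofReal κ := by
          refine (h.noise.drivenBy_w.lintegral_quad_add_le t (hle1 _ hGm) haw hN 1 hbw).trans ?_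
          gcongr
          exact h.noise.drivenBy_η.lintegral_quad_add_le t hGm haη hN r.sys.B hbη
      _ ≤ ∫⁻ ω in r.good (r.ep t), ENNReal.ofReal (r.rho ^ 2) *
            ENNReal.ofReal (quad (r.W (r.ep t)) (r.X t ω)) ∂μ +
            ENNReal.ofReal (κ * g) + ENNReal.ofReal κ := by
          gcongr 2
          refine setLIntegral_mono' (h.noise.past_le t _ hGm) fun ω hω => ?_
          rw [← ENNReal.ofReal_mul (sq_nonneg _)]
          exact ENNReal.ofReal_le_ofReal (h.contract hω _)
      _ ≤ ENNReal.ofReal (r.rho ^ 2) * ENNReal.ofReal (κ * (1 + g) / (1 - r.rho ^ 2)) +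
            ENNReal.ofReal (κ * g) + ENNReal.ofReal κ := by
          gcongr 2
          rw [lintegral_const_mul]
          · gcongr
          · exact ((measurable_quad _).comp ((h.measurable_X t).mono (h.noise.past_le t)
              le_rfl)).ennreal_ofReal
      _ = _ := by
          rw [← ENNReal.ofReal_mul (sq_nonneg _), ← ENNReal.ofReal_add (by positivity) (by positivity),
            ← ENNReal.ofReal_add (by positivity) (by positivity)]
          congr 1
          field_simp
          ring

/-- Half of `SigMax` is kept in reserve for conditioning on an event of probability at least one
half. -/
lemma lintegral_dot_X_le (t : ℕ) :
    ∫⁻ ω in r.good (r.ep t), ENNReal.ofReal (r.X t ω ⬝ᵥ r.X t ω) ∂μ ≤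
      ENNReal.ofReal (SigMax r.sys r.K0 r.Kstar / 2) := by
  have hl := h.prob.lam_pos
  have hΓ := h.prob.one_lt_Gam
  have hv := h.prob.v0_pos
  have hgap := h.prob.gap_rhoBar
  have hgap0 := h.prob.one_sub_rhoBar_sq_pos
  have h1 : ∀ ω, ENNReal.ofReal (r.X t ω ⬝ᵥ r.X t ω) ≤
      ENNReal.ofReal (1 / r.lam) * ENNReal.ofReal (quad (r.W (r.ep t)) (r.X t ω)) := fun ω => by
    rw [← ENNReal.ofReal_mul (by positivity)]
    refine ENNReal.ofReal_le_ofReal ?_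
    rw [one_div, inv_mul_eq_div, le_div_iff₀ hl, mul_comm]
    exact h.lam_le_quad_W _ _
  refine (lintegral_mono h1).trans ?_
  have hm : Measurable fun ω => quad (r.W (r.ep t)) (r.X t ω) :=
    (measurable_quad _).comp ((h.measurable_X t).mono (h.noise.past_le t) le_rfl)
  rw [lintegral_const_mul _ hm.ennreal_ofReal]
  refine (mul_le_mul_right (h.lintegral_quad_X_le t) _).trans ?_
  rw [← ENNReal.ofReal_mul (by positivity)]
  refine ENNReal.ofReal_le_ofReal ?_
  have h2 : 1 / (1 - r.rho ^ 2) ≤ 2 * (r.Γ - 1) / r.lam := by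
    rw [div_le_div_iff₀ hgap0 hl]
    rw [div_le_iff₀ (by positivity)] at hgap
    nlinarith [h.prob.v0_le]
  have hg : 0 ≤ r.Γ - 1 := by linarith
  have h3 : (r.Γ - 1) ^ 2 * (1 + (r.Γ - 1) ^ 2) ≤ r.Γ ^ 4 := by
    nlinarith [mul_nonneg hg hg, mul_nonneg hg (mul_nonneg hg hg), sq_nonneg (r.Γ - 1)]
  calc _ = 1 / r.lam * (n * (r.Γ - 1) * r.sys.σw ^ 2 * (1 + (r.Γ - 1) ^ 2)) *
        (1 / (1 - r.rho ^ 2)) := by ring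
    _ ≤ 1 / r.lam * (n * (r.Γ - 1) * r.sys.σw ^ 2 * (1 + (r.Γ - 1) ^ 2)) *
        (2 * (r.Γ - 1) / r.lam) := by gcongr
    _ = 2 * r.sys.σw ^ 2 * n * ((r.Γ - 1) ^ 2 * (1 + (r.Γ - 1) ^ 2)) / r.lam ^ 2 := by
        field_simp
    _ ≤ 2 * r.sys.σw ^ 2 * n * r.Γ ^ 4 / r.lam ^ 2 := by gcongr
    _ = _ := by rw [SigMax]; ring

/-- Square integrability of the state given an event of probability at least one half. -/
lemma memLp_initState (i : ℕ) (hG : (2 : ℝ≥0∞)⁻¹ ≤ μ (r.good i)) :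
    (∀ a, MemLp (fun ω => initState r.sys r.Est r.Tmult r.K0 r.w r.η i ω a) 2 (cond μ (r.good i))) ∧
    ‖condSecondMoment μ (r.good i) (initState r.sys r.Est r.Tmult r.K0 r.w r.η i)‖ ≤
      SigMax r.sys r.K0 r.Kstar := by
  set x := initState r.sys r.Est r.Tmult r.K0 r.w r.η i with hx
  have hxm : Measurable x := ((measurable_epoch h.est r.w r.η i).2).mono (h.noise.past_le _) le_rfl
  have hGm := h.noise.past_le _ _ (h.measurableSet_good i)
  have hS0 : 0 ≤ SigMax r.sys r.K0 r.Kstar := by rw [SigMax]; positivity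
  have hne : μ (r.good i) ≠ 0 := fun h0 => by simp [h0] at hG
  have := cond_isProbabilityMeasure hne
  have h1 := h.lintegral_dot_X_le (epochStart r.Tmult i)
  have hei : r.ep (epochStart r.Tmult i) = i := epochOf_epochStart h.Tmult_pos i
  simp only [hei, h.X_epochStart, ← hx] at h1
  have h2 : ∫⁻ ω, ENNReal.ofReal (x ω ⬝ᵥ x ω) ∂(cond μ (r.good i)) ≤
      ENNReal.ofReal (SigMax r.sys r.K0 r.Kstar) := by
    rw [ProbabilityTheory.cond, lintegral_smul_measure, smul_eq_mul]
    calc _ ≤ 2 * ENNReal.ofReal (SigMax r.sys r.K0 r.Kstar / 2) :=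
          mul_le_mul' (by simpa using ENNReal.inv_le_inv.2 hG) h1
      _ = _ := by
          rw [show (2 : ℝ≥0∞) = ENNReal.ofReal 2 by simp, ← ENNReal.ofReal_mul (by norm_num)]
          congr 1; ring
  have hmem : ∀ a, MemLp (fun ω => x ω a) 2 (cond μ (r.good i)) := fun a => by
    have hm : Measurable fun ω => x ω a := (measurable_pi_apply a).comp hxm
    rw [memLp_two_iff_integrable_sq hm.aestronglyMeasurable]
    refine ⟨(hm.pow_const 2).aestronglyMeasurable, ?_⟩
    rw [hasFiniteIntegral_iff_ofReal (ae_of_all _ fun ω => sq_nonneg _)]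
    refine lt_of_le_of_lt (lintegral_mono fun ω => ENNReal.ofReal_le_ofReal ?_)
      (h2.trans_lt ENNReal.ofReal_lt_top)
    rw [sq]
    exact Finset.single_le_sum (f := fun a => x ω a * x ω a) (fun b _ => mul_self_nonneg _)
      (Finset.mem_univ a)
  refine ⟨hmem, ?_⟩
  have hint : ∀ a b, Integrable (fun ω => x ω a * x ω b) (cond μ (r.good i)) := fun a b =>
    (hmem a).integrable_mul (hmem b)
  have hdot : ∀ y z : Fin n → ℝ, Integrable (fun ω => (y ⬝ᵥ x ω) * (z ⬝ᵥ x ω)) (cond μ (r.good i)) ∧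
      y ⬝ᵥ (condSecondMoment μ (r.good i) x *ᵥ z) =
        ∫ ω, (y ⬝ᵥ x ω) * (z ⬝ᵥ x ω) ∂(cond μ (r.good i)) := fun y z => by
    have h3 : ∀ ω, (y ⬝ᵥ x ω) * (z ⬝ᵥ x ω) = ∑ a, ∑ b, y a * z b * (x ω a * x ω b) := fun ω => by
      simp only [dotProduct, Finset.sum_mul_sum]
      exact Finset.sum_congr rfl fun a _ => Finset.sum_congr rfl fun b _ => by ring
    simp only [h3]
    have hi : ∀ a b, Integrable (fun ω => y a * z b * (x ω a * x ω b)) (cond μ (r.good i)) :=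
      fun a b => (hint a b).const_mul _
    refine ⟨integrable_finsetSum _ fun a _ => integrable_finsetSum _ fun b _ => hi a b, ?_⟩
    rw [integral_finsetSum _ fun a _ => integrable_finsetSum _ fun b _ => hi a b]
    simp only [dotProduct, Matrix.mulVec, condSecondMoment, Matrix.of_apply, Finset.mul_sum]
    refine Finset.sum_congr rfl fun a _ => ?_
    rw [integral_finsetSum _ fun b _ => hi a b]
    refine Finset.sum_congr rfl fun b _ => ?_
    rw [integral_const_mul]; ring
  have hxx : Integrable (fun ω => x ω ⬝ᵥ x ω) (cond μ (r.good i)) :=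
    integrable_finsetSum _ fun a _ => hint a a
  have hxle : ∫ ω, x ω ⬝ᵥ x ω ∂(cond μ (r.good i)) ≤ SigMax r.sys r.K0 r.Kstar := by
    rw [integral_eq_lintegral_of_nonneg_ae (ae_of_all _ fun ω => dot_self_nonneg _)
      hxx.aestronglyMeasurable]
    exact ENNReal.toReal_le_of_le_ofReal hS0 h2
  -- The operator norm of the second-moment matrix is at most `E |x|²`, by Cauchy–Schwarz for its
  -- bilinear form under the integral.
  refine norm_le_of_bilin_le _ hS0 fun y z => ?_
  rw [(hdot y z).2]
  calc _ ≤ ∫ ω, √(y ⬝ᵥ y) * √(z ⬝ᵥ z) * (x ω ⬝ᵥ x ω) ∂(cond μ (r.good i)) := by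
        refine integral_mono (hdot y z).1 (hxx.const_mul _) fun ω => ?_
        have e1 := abs_dot_le y (x ω)
        have e2 := abs_dot_le z (x ω)
        calc _ ≤ |y ⬝ᵥ x ω| * |z ⬝ᵥ x ω| := by rw [← abs_mul]; exact le_abs_self _
          _ ≤ (√(y ⬝ᵥ y) * √(x ω ⬝ᵥ x ω)) * (√(z ⬝ᵥ z) * √(x ω ⬝ᵥ x ω)) :=
              mul_le_mul e1 e2 (abs_nonneg _) (by positivity)
          _ = √(y ⬝ᵥ y) * √(z ⬝ᵥ z) * (√(x ω ⬝ᵥ x ω) * √(x ω ⬝ᵥ x ω)) := by ring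
          _ = _ := by rw [Real.mul_self_sqrt (dot_self_nonneg _)]
    _ = √(y ⬝ᵥ y) * √(z ⬝ᵥ z) * ∫ ω, x ω ⬝ᵥ x ω ∂(cond μ (r.good i)) := integral_const_mul _ _
    _ ≤ √(y ⬝ᵥ y) * √(z ⬝ᵥ z) * SigMax r.sys r.K0 r.Kstar := by gcongr
    _ = _ := by ring

end Run.Valid

end AdaptiveLQR

namespace AdaptiveLQR
open scoped Topology

/-! ### Numerical estimates for the accuracies -/

section Accuracy

/-- `2^{-i/(1+α)}`, the factor by which the exploration variance has decreased in epoch `i`. -/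
noncomputable def decay (α : ℝ) (i : ℕ) : ℝ := (1 / 2 ^ i : ℝ) ^ (1 / (1 + α))

lemma decay_pos (α : ℝ) (i : ℕ) : 0 < decay α i := by unfold decay; positivity

lemma decay_mul_rpow {α : ℝ} (hα : 0 < 1 + α) (i : ℕ) :
    decay α i * decay α i ^ α = 1 / 2 ^ i := by
  have h : (0 : ℝ) < 1 / 2 ^ i := by positivity
  rw [decay, ← Real.rpow_mul h.le, ← Real.rpow_add h]
  rw [show 1 / (1 + α) + 1 / (1 + α) * α = 1 by field_simp, Real.rpow_one]

lemma decay_le_one {α : ℝ} (hα : 0 < 1 + α) (i : ℕ) : decay α i ≤ 1 := by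
  refine Real.rpow_le_one (by positivity) ?_ (by positivity)
  rw [div_le_one (by positivity)]; exact one_le_pow₀ (by norm_num)

variable {n d : ℕ} (sys : System n d)

lemma sigEta_sq (α : ℝ) (i : ℕ) : sigEta sys α i ^ 2 = sys.σw ^ 2 * decay α i :=
  Real.sq_sqrt (by have := decay_pos α i; unfold decay at *; positivity)

variable {sys}

lemma sigEta_pos (hσ : 0 < sys.σw) (α : ℝ) (i : ℕ) : 0 < sigEta sys α i :=
  Real.sqrt_pos.2 (by positivity)

/-- The exponent `1 / (1 + α)` is chosen for this identity: the sample requirement `σ_η^(-2α)` then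
grows like `2^i decay`, exactly as the total exploration variance of the epoch does. -/
lemma one_div_sigEta_rpow (hσ : 0 < sys.σw) {α : ℝ} (hα : 0 < 1 + α) (i : ℕ) :
    1 / sigEta sys α i ^ (2 * α) = 1 / sys.σw ^ (2 * α) * (2 ^ i * decay α i) := by
  have h1 := decay_pos α i
  have h2 := sigEta_pos hσ α i
  have h3 : ∀ x : ℝ, 0 ≤ x → x ^ (2 * α) = (x ^ 2) ^ α := fun x hx => by
    rw [Real.rpow_mul hx]; norm_num
  rw [h3 _ h2.le, h3 _ hσ.le, sigEta_sq, Real.mul_rpow (by positivity) h1.le, one_div_mul_eq_div,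
    div_eq_div_iff (by positivity) (by positivity)]
  have h4 := decay_mul_rpow hα i
  calc _ = (sys.σw ^ 2) ^ α * (2 ^ i * (1 / 2 ^ i)) := by field_simp
    _ = _ := by rw [← h4]; ring

lemma one_div_sigEta_rpow_le (hσ : 0 < sys.σw) {α : ℝ} (hα : 0 < 1 + α) (i : ℕ) :
    1 / sigEta sys α i ^ α ≤ 1 / sys.σw ^ α * 2 ^ i := by
  have h1 := decay_pos α i
  have h2 := sigEta_pos hσ α i
  have h3 : ∀ x : ℝ, 0 ≤ x → x ^ (2 * α) = (x ^ α) ^ 2 := fun x hx => by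
    rw [mul_comm, Real.rpow_mul hx]; norm_num
  have h4 := one_div_sigEta_rpow hσ hα i
  rw [h3 _ h2.le, h3 _ hσ.le] at h4
  refine abs_le_of_sq_le_sq' ?_ (by positivity) |>.2
  have h5 := decay_le_one hα i
  have h6 : (1 : ℝ) ≤ 2 ^ i := one_le_pow₀ (by norm_num)
  calc _ = 1 / (sys.σw ^ α) ^ 2 * (2 ^ i * decay α i) := by rw [← h4]; ring
    _ ≤ 1 / (sys.σw ^ α) ^ 2 * (2 ^ i * 2 ^ i) := by gcongr; linarith
    _ = _ := by ring

variable (sys)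

/-- The logarithmic factor in the sample size that is required in epoch `i`. -/
noncomputable def logTerm (Tmult : ℕ) (α c : ℝ) (p : ℕ) (D : ℝ) (i : ℕ) : ℝ :=
  polylog c p [(epochLen Tmult i : ℝ), 1 / sigEta sys α i ^ α, D, √(epochLen Tmult i : ℝ)]

/-- The accuracy that the data of epoch `i` guarantee. -/
noncomputable def accuracy (Tmult : ℕ) (α c : ℝ) (p : ℕ) (D a : ℝ) (i : ℕ) : ℝ :=
  √((a / sigEta sys α i ^ (2 * α) * logTerm sys Tmult α c p D i + 1) / epochLen Tmult i)

variable {sys}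

lemma polylog_nonneg {c : ℝ} (hc : 0 ≤ c) (p : ℕ) (l : List ℝ) : 0 ≤ polylog c p l := by
  refine mul_nonneg hc (pow_nonneg (add_nonneg zero_le_one (List.sum_nonneg fun x hx => ?_)) p)
  obtain ⟨y, -, rfl⟩ := List.mem_map.1 hx
  exact Real.posLog_nonneg

variable {Tmult : ℕ} {α c D a : ℝ} {p : ℕ}

lemma logTerm_nonneg (hc : 0 ≤ c) (i : ℕ) : 0 ≤ logTerm sys Tmult α c p D i :=
  polylog_nonneg hc _ _

section
variable (hT : 0 < Tmult) (hσ : 0 < sys.σw) (hc : 0 ≤ c) (ha : 0 ≤ a)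
include hσ hc ha

lemma accuracy_sq (i : ℕ) : accuracy sys Tmult α c p D a i ^ 2 =
    (a / sigEta sys α i ^ (2 * α) * logTerm sys Tmult α c p D i + 1) / epochLen Tmult i := by
  have h1 := sigEta_pos hσ α i
  have h2 : 0 ≤ logTerm sys Tmult α c p D i := logTerm_nonneg hc i
  exact Real.sq_sqrt (by positivity)

include hT

lemma accuracy_pos (i : ℕ) : 0 < accuracy sys Tmult α c p D a i := by
  have h1 := sigEta_pos hσ α i
  have h2 : 0 ≤ logTerm sys Tmult α c p D i := logTerm_nonneg hc i
  have h3 : (0 : ℝ) < epochLen Tmult i := by exact_mod_cast epochLen_pos hT i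
  exact Real.sqrt_pos.2 (by positivity)

/-- The required sample size involves `1 / ε` inside a logarithm, so it is implicit in `ε`. The `+
1` in `accuracy` ensures `1 / ε ≤ √T_i`, and `logTerm` has `√T_i` in that slot, which removes the
circularity. -/
lemma accuracy_size (i : ℕ) {a' : ℝ} (ha' : a' ≤ a) :
    a' / accuracy sys Tmult α c p D a i ^ 2 * (1 / sigEta sys α i ^ (2 * α)) *
      polylog c p [(epochLen Tmult i : ℝ), 1 / sigEta sys α i ^ α, D,
        1 / accuracy sys Tmult α c p D a i] ≤ epochLen Tmult i := by
  have h1 := sigEta_pos hσ α i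
  have h2 : 0 ≤ logTerm sys Tmult α c p D i := logTerm_nonneg hc i
  have h3 : (0 : ℝ) < epochLen Tmult i := by exact_mod_cast epochLen_pos hT i
  have h4 : 0 < accuracy sys Tmult α c p D a i := accuracy_pos hT hσ hc ha i
  have h5 := accuracy_sq (Tmult := Tmult) (D := D) (p := p) hσ hc ha i (α := α)
  set e := accuracy sys Tmult α c p D a i with he
  set s := sigEta sys α i ^ (2 * α) with hs
  have hs0 : 0 < s := Real.rpow_pos_of_pos h1 _
  have h6 : 1 / e ≤ √(epochLen Tmult i : ℝ) := by
    refine Real.le_sqrt_of_sq_le ?_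
    rw [div_pow, one_pow, h5, one_div_div]
    exact div_le_self h3.le (le_add_of_nonneg_left (by positivity))
  have h7 : polylog c p [(epochLen Tmult i : ℝ), 1 / sigEta sys α i ^ α, D, 1 / e] ≤
      logTerm sys Tmult α c p D i := by
    have := Real.posLog_le_posLog (by positivity) h6
    have i1 := Real.posLog_nonneg (x := (epochLen Tmult i : ℝ))
    have i2 := Real.posLog_nonneg (x := 1 / sigEta sys α i ^ α)
    have i3 := Real.posLog_nonneg (x := D)
    have i4 := Real.posLog_nonneg (x := 1 / e)
    simp only [logTerm, polylog, List.map_cons, List.map_nil, List.sum_cons, List.sum_nil]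
    gcongr
  calc _ ≤ a / e ^ 2 * (1 / s) * logTerm sys Tmult α c p D i := by
        refine mul_le_mul ?_ h7 (polylog_nonneg hc _ _) (by positivity)
        gcongr
    _ = (a / s * logTerm sys Tmult α c p D i) / e ^ 2 := by field_simp
    _ ≤ (a / s * logTerm sys Tmult α c p D i + 1) / e ^ 2 := by gcongr; linarith
    _ = epochLen Tmult i := by
        rw [h5]
        have : 0 < a / s * logTerm sys Tmult α c p D i + 1 := by positivity
        field_simp
end

lemma logTerm_le (hσ : 0 < sys.σw) (hα : 0 < 1 + α) (hc : 0 ≤ c) (hT : 0 < Tmult) (i : ℕ) :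
    logTerm sys Tmult α c p D i ≤
      c * (1 + 2 * Real.log (epochLen Tmult i) + i + Real.posLog (1 / sys.σw ^ α) +
        Real.posLog D) ^ p := by
  have h3 : (1 : ℝ) ≤ epochLen Tmult i := by exact_mod_cast epochLen_pos hT i
  have h1 : Real.posLog (1 / sigEta sys α i ^ α) ≤ Real.posLog (1 / sys.σw ^ α) + i := by
    have := sigEta_pos hσ α i
    refine (Real.posLog_le_posLog (by positivity) (one_div_sigEta_rpow_le hσ hα i)).trans ?_
    refine Real.posLog_mul.trans (add_le_add_right ?_ _)
    rw [Real.posLog_pow, Real.posLog_eq_log (by norm_num)]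
    have := Real.log_two_lt_d9
    exact mul_le_of_le_one_right (Nat.cast_nonneg _) (by linarith)
  have h2 : Real.posLog √(epochLen Tmult i : ℝ) ≤ Real.posLog (epochLen Tmult i : ℝ) :=
    Real.posLog_le_posLog (Real.sqrt_nonneg _) (Real.sqrt_le_iff.2 ⟨by linarith, by nlinarith⟩)
  have h4 : Real.posLog (epochLen Tmult i : ℝ) = Real.log (epochLen Tmult i) := Real.posLog_eq_log
    (by rwa [abs_of_nonneg (by linarith)])
  have i1 := Real.posLog_nonneg (x := (epochLen Tmult i : ℝ))
  have i2 := Real.posLog_nonneg (x := 1 / sigEta sys α i ^ α)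
  have i3 := Real.posLog_nonneg (x := D)
  have i4 := Real.posLog_nonneg (x := √(epochLen Tmult i : ℝ))
  simp only [logTerm, polylog, List.map_cons, List.map_nil, List.sum_cons, List.sum_nil]
  refine mul_le_mul_of_nonneg_left (pow_le_pow_left₀ (by positivity) ?_ p) hc
  linarith

lemma pow_le_factorial_mul_exp {y : ℝ} (hy : 0 ≤ y) (p : ℕ) : y ^ p ≤ p.factorial * Real.exp y := by
  have := Real.pow_div_factorial_le_exp y hy p
  rwa [div_le_iff₀' (by positivity)] at this

/-- The decay rate per epoch is only `log 2 / (1 + α)`, so beating a polynomial in `i` costs a power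
of `α`. This contributes to the power of `α` required of `Tmult`. -/
lemma pow_mul_decay_le (hα : 1 ≤ α) (p i : ℕ) :
    (1 + i : ℝ) ^ p * decay α i ≤ 2 * p.factorial * (4 * α) ^ p := by
  have hl1 := Real.log_two_gt_d9
  have hl2 := Real.log_two_lt_d9
  set y := (1 + i : ℝ) * (Real.log 2 / (1 + α)) with hy
  have hd : decay α i = Real.exp (-(i * (Real.log 2 / (1 + α)))) := by
    rw [decay, Real.rpow_def_of_pos (by positivity), Real.log_div one_ne_zero (by positivity),
      Real.log_one, Real.log_pow]
    congr 1; ring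
  have h1 : (1 + i : ℝ) ≤ 4 * α * y := by
    rw [hy]
    have : 1 ≤ 4 * α * (Real.log 2 / (1 + α)) := by
      rw [mul_div_assoc', le_div_iff₀ (by linarith)]; nlinarith
    nlinarith [(Nat.cast_nonneg i : (0 : ℝ) ≤ i)]
  have hy0 : 0 ≤ y := by positivity
  have h2 : Real.exp (Real.log 2 / (1 + α)) ≤ 2 := by
    rw [← Real.le_log_iff_exp_le (by norm_num)]
    exact div_le_self (by linarith) (by linarith)
  calc _ ≤ (4 * α * y) ^ p * decay α i := by have := decay_pos α i; gcongr
    _ = (4 * α) ^ p * (y ^ p * decay α i) := by rw [mul_pow]; ring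
    _ ≤ (4 * α) ^ p * (p.factorial * Real.exp y * decay α i) := by
        have := decay_pos α i
        have := pow_le_factorial_mul_exp hy0 p
        gcongr
    _ = (4 * α) ^ p * (p.factorial * Real.exp (Real.log 2 / (1 + α))) := by
        rw [hd, mul_assoc _ (Real.exp _), ← Real.exp_add, hy]
        congr 4; ring
    _ ≤ (4 * α) ^ p * (p.factorial * 2) := by gcongr
    _ = _ := by ring

/-- The accuracies are small if `Tmult` is large. -/
lemma accuracy_small (p : ℕ) {c : ℝ} (hc : 0 < c) : ∃ C : ℝ, 0 < C ∧
    ∀ {n d : ℕ} (sys : System n d) (Tmult : ℕ) (α D Λ M a : ℝ), 0 < sys.σw → 1 ≤ α → 0 ≤ a →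
      1 + Real.posLog (1 / sys.σw) + Real.posLog D ≤ 3 * Λ → 1 ≤ Λ → 1 ≤ M →
      M * max 1 (a ^ 2 / sys.σw ^ (4 * α)) * α ^ (4 * p) * (C * Λ ^ (4 * p)) ≤ Tmult →
      ∀ i, (16 * accuracy sys Tmult α c p D a i ^ 2) ^ 4 ≤ 1 / M ^ 3 := by
  set C2 : ℝ := c * 9 ^ p * (2 * p.factorial * 4 ^ p) with hC2
  set C1 : ℝ := (C2 + 1) ^ 4 * ((4 * p).factorial * 3) with hC1
  have hC20 : 0 < C2 := by positivity
  have hC10 : 1 ≤ C1 := by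
    have h1 : (1 : ℝ) ≤ (4 * p).factorial := by exact_mod_cast (4 * p).factorial_pos
    have h2 : 1 ≤ (C2 + 1) ^ 4 := one_le_pow₀ (by linarith)
    nlinarith
  refine ⟨16 ^ 4 * C1, by positivity, ?_⟩
  intro n d sys Tmult α D Λ M a hσ hα ha hΛ hΛ1 hM hT i
  have hα0 : 0 < α := by linarith
  set M2 := max 1 (a ^ 2 / sys.σw ^ (4 * α)) with hM2
  have hM21 : 1 ≤ M2 := le_max_left _ _
  set Y := M2 * α ^ (4 * p) * Λ ^ (4 * p) with hY
  have hαp : 1 ≤ α ^ (4 * p) := one_le_pow₀ hα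
  have hΛp : 1 ≤ Λ ^ (4 * p) := one_le_pow₀ hΛ1
  have hY1 : 1 ≤ Y := one_le_mul_of_one_le_of_one_le
    (one_le_mul_of_one_le_of_one_le hM21 hαp) hΛp
  have hT' : M * (16 ^ 4 * C1) * Y ≤ Tmult := by rw [hY]; linarith
  have hT1 : (1 : ℝ) ≤ Tmult := by
    refine le_trans ?_ hT'
    refine one_le_mul_of_one_le_of_one_le (one_le_mul_of_one_le_of_one_le hM ?_) hY1
    nlinarith
  have hT0 : 0 < Tmult := by exact_mod_cast hT1
  set ℓ := 1 + Real.log Tmult with hℓ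
  have hlog : 0 ≤ Real.log Tmult := Real.log_nonneg hT1
  have hℓ1 : 1 ≤ ℓ := by linarith
  set b := a / sys.σw ^ (2 * α) with hb
  have hb0 : 0 ≤ b := by positivity
  have hbM : b ^ 2 ≤ M2 := by
    refine le_trans (le_of_eq ?_) (le_max_right _ _)
    rw [hb, div_pow]; congr 1
    rw [← Real.rpow_natCast, ← Real.rpow_mul hσ.le]; congr 1; push_cast; ring
  have hQ : logTerm sys Tmult α c p D i ≤ c * (9 * α * ((1 + i) * (ℓ * Λ))) ^ p := by
    refine (logTerm_le hσ (by linarith) hc.le hT0 i).trans ?_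
    have hl : Real.log (epochLen Tmult i) ≤ Real.log Tmult + i := by
      rw [epochLen, Nat.cast_mul, Real.log_mul (by positivity) (by positivity)]
      push_cast
      rw [Real.log_pow]
      have := Real.log_two_lt_d9
      have : (i : ℝ) * Real.log 2 ≤ i := mul_le_of_le_one_right (Nat.cast_nonneg _) (by linarith)
      linarith
    have hs : Real.posLog (1 / sys.σw ^ α) = α * Real.posLog (1 / sys.σw) := by
      rw [Real.posLog_apply, Real.posLog_apply, one_div, one_div, Real.log_inv, Real.log_inv,
        Real.log_rpow hσ, mul_max_of_nonneg _ _ hα0.le]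
      rw [mul_zero, mul_neg]
    have i1 := Real.posLog_nonneg (x := 1 / sys.σw)
    have i2 := Real.posLog_nonneg (x := D)
    have i3 : (0 : ℝ) ≤ i := Nat.cast_nonneg i
    have i4 : 0 ≤ Real.log (epochLen Tmult i) := Real.log_nonneg
      (by exact_mod_cast epochLen_pos hT0 i)
    refine mul_le_mul_of_nonneg_left (pow_le_pow_left₀ ?_ ?_ p) hc.le
    · have := Real.posLog_nonneg (x := 1 / sys.σw ^ α); positivity
    · rw [hs]
      have h3 : α * Real.posLog (1 / sys.σw) + Real.posLog D + 1 ≤ 3 * α * Λ := by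
        nlinarith [mul_nonneg (sub_nonneg.2 hα) i2, mul_le_mul_of_nonneg_left hΛ hα0.le]
      have j1 : (1 : ℝ) ≤ 1 + i := by linarith
      set Z := (1 + i : ℝ) * (ℓ * Λ) with hZ
      have j2 : Λ ≤ Z := by
        rw [hZ, ← mul_assoc]
        exact le_mul_of_one_le_left (by linarith) (one_le_mul_of_one_le_of_one_le j1 hℓ1)
      have j3 : ℓ ≤ Z := by
        rw [hZ, mul_left_comm]
        exact le_mul_of_one_le_right (by linarith) (one_le_mul_of_one_le_of_one_le j1 hΛ1)
      have j4 : 1 + (i : ℝ) ≤ Z :=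
        le_mul_of_one_le_right (by linarith) (one_le_mul_of_one_le_of_one_le hℓ1 hΛ1)
      have j5 : Z ≤ α * Z := le_mul_of_one_le_left (by linarith) hα
      have j6 : α * Λ ≤ α * Z := by gcongr
      linarith
  set e := accuracy sys Tmult α c p D a i ^ 2 with he
  have he0 : 0 ≤ e := sq_nonneg _
  -- The factor `2^i` of the epoch length cancels against the sample requirement, and the remaining
  -- decay absorbs the powers of `1 + i`; the bound is uniform in the epoch.
  have h16 : e * Tmult ≤ b * (C2 * α ^ (2 * p) * (ℓ * Λ) ^ p) + 1 := by
    rw [he, accuracy_sq hσ hc.le ha i, div_eq_mul_one_div a, one_div_sigEta_rpow hσ (by linarith), epochLen]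
    push_cast
    have h1 := decay_pos α i
    have h2 : 1 / (2 : ℝ) ^ i ≤ 1 := by
      rw [div_le_one (by positivity)]; exact one_le_pow₀ (by norm_num)
    have h3 := pow_mul_decay_le hα p i
    calc _ = b * (logTerm sys Tmult α c p D i * decay α i) + 1 / 2 ^ i := by
          rw [hb]; field_simp
      _ ≤ b * (c * (9 * α * ((1 + i) * (ℓ * Λ))) ^ p * decay α i) + 1 := by gcongr
      _ = b * (c * (9 * α) ^ p * (ℓ * Λ) ^ p * ((1 + i) ^ p * decay α i)) + 1 := by
          simp only [mul_pow]; ring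
      _ ≤ b * (c * (9 * α) ^ p * (ℓ * Λ) ^ p * (2 * p.factorial * (4 * α) ^ p)) + 1 := by gcongr
      _ = _ := by
          rw [hC2, two_mul p, pow_add]; simp only [mul_pow]; ring
  set U := α ^ (2 * p) * (ℓ * Λ) ^ p with hU
  have hU1 : 1 ≤ U := one_le_mul_of_one_le_of_one_le (one_le_pow₀ hα)
    (one_le_pow₀ (one_le_mul_of_one_le_of_one_le hℓ1 hΛ1))
  set B := max 1 b with hB
  have hB1 : 1 ≤ B := le_max_left _ _
  have hBM : B ^ 2 ≤ M2 := by
    rcases max_choice 1 b with h | h <;> rw [hB, h]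
    · simpa using hM21
    · exact hbM
  have h17 : e * Tmult ≤ B * (C2 + 1) * U := by
    have h1 : b * (C2 * U) ≤ B * (C2 * U) := by gcongr; exact le_max_right _ _
    have h2 : 1 ≤ B * U := one_le_mul_of_one_le_of_one_le hB1 hU1
    calc _ ≤ b * (C2 * U) + 1 := h16.trans (le_of_eq (by rw [hU]; ring))
      _ ≤ B * (C2 * U) + B * U := add_le_add h1 h2
      _ = _ := by ring
  -- The logarithm of `Tmult` is paid for by one factor `Tmult`. Raising the estimate to the fourth
  -- power leaves three such factors, enough for `Y²` and `M³`; since `B² ≤ M2`, the square of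
  -- `C_err` is what `Tmult` must dominate.
  have hℓp : ℓ ^ (4 * p) ≤ (4 * p).factorial * 3 * Tmult := by
    refine (pow_le_factorial_mul_exp (by linarith) _).trans ?_
    rw [hℓ, Real.exp_add, Real.exp_log (by linarith), mul_assoc]
    have := Real.exp_one_lt_d9
    gcongr; linarith
  have hUY : B ^ 4 * U ^ 4 ≤ Y ^ 2 * ((4 * p).factorial * 3 * Tmult) := by
    calc B ^ 4 * U ^ 4 = (B ^ 2) ^ 2 * (α ^ (4 * p)) ^ 2 * Λ ^ (4 * p) * ℓ ^ (4 * p) := by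
          rw [hU]; ring_nf
      _ ≤ M2 ^ 2 * (α ^ (4 * p)) ^ 2 * (Λ ^ (4 * p)) ^ 2 * ((4 * p).factorial * 3 * Tmult) := by
          gcongr
          exact le_self_pow₀ hΛp (by norm_num)
      _ = _ := by rw [hY]; ring
  have h18 : e ^ 4 * Tmult ^ 4 ≤ C1 * Y ^ 2 * Tmult := by
    calc _ = (e * Tmult) ^ 4 := by ring
      _ ≤ (B * (C2 + 1) * U) ^ 4 := by gcongr
      _ = (C2 + 1) ^ 4 * (B ^ 4 * U ^ 4) := by ring
      _ ≤ (C2 + 1) ^ 4 * (Y ^ 2 * ((4 * p).factorial * 3 * Tmult)) := by gcongr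
      _ = _ := by rw [hC1]; ring
  have h19 : e ^ 4 * Tmult ^ 3 ≤ C1 * Y ^ 2 := by
    refine le_of_mul_le_mul_right ?_ (show (0 : ℝ) < Tmult by linarith)
    calc _ = e ^ 4 * Tmult ^ 4 := by ring
      _ ≤ _ := h18
  have h20 : M ^ 3 * (16 ^ 4 * C1) * Y ^ 2 ≤ Tmult ^ 3 := by
    have h1 : 1 ≤ (16 ^ 4 * C1) := by linarith
    calc _ ≤ M ^ 3 * (16 ^ 4 * C1) ^ 3 * Y ^ 3 := by
          gcongr
          · exact le_self_pow₀ h1 (by norm_num)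
          · norm_num
      _ = (M * (16 ^ 4 * C1) * Y) ^ 3 := by ring
      _ ≤ _ := by gcongr
  rw [le_div_iff₀ (by positivity)]
  have hZ : 0 < C1 * Y ^ 2 := by positivity
  refine le_of_mul_le_mul_right ?_ hZ
  calc _ = e ^ 4 * (M ^ 3 * (16 ^ 4 * C1) * Y ^ 2) := by ring
    _ ≤ e ^ 4 * Tmult ^ 3 := by gcongr
    _ ≤ 1 * (C1 * Y ^ 2) := by rw [one_mul]; exact h19

end Accuracy

end AdaptiveLQR

namespace AdaptiveLQR
open scoped Topology

/-! ### The controllers stay accurate -/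

namespace Run.Valid

variable {n d : ℕ} {Ω : Type*} {r : Run n d Ω} [m0 : MeasurableSpace Ω] {μ : Measure Ω}
  [IsProbabilityMeasure μ] [NeZero n] (h : r.Valid μ)
include h

/-- Each epoch loses at most `δ`, by the assumption with `G = good i`. The condition `E δ ≤ 1/2`
keeps these events at probability at least one half, so the second moment given `good i` stays below
`SigMax`; monotonicity of `Creq` and `Cerr` then replaces the random arguments by the fixed ones. -/
lemma one_sub_le_measure_good {Creq : ℝ → ℝ} {Cerr : ℝ → ℝ → ℝ} {c : ℝ} {p : ℕ}
    (hA : EstimateKAssumption r.sys r.Est r.Tmult r.K0 r.Kstar μ r.w r.η Creq Cerr r.α c p)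
    (hc : 0 ≤ c) {E : ℕ} {δ : ℝ} (hδ : 0 < δ) (hδ1 : δ < 1) (hEδ : E * δ ≤ 1 / 2)
    (hreq : ∀ i, r.eps i < Creq (Vmax r.sys r.K0 r.Kstar))
    (heps : r.eps = accuracy r.sys r.Tmult r.α c p (1 / δ)
      (Cerr (Vmax r.sys r.K0 r.Kstar) (SigMax r.sys r.K0 r.Kstar))) {i : ℕ} (hi : i ≤ E) :
    1 - i * δ ≤ μ.real (r.good i) := by
  have hl := h.prob.lam_pos
  have hS0 : 0 ≤ SigMax r.sys r.K0 r.Kstar := by rw [SigMax]; positivity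
  have hV0 : 0 ≤ Vmax r.sys r.K0 r.Kstar := (norm_nonneg _).trans h.prob.norm_valueFn_zero_le
  induction i with
  | zero => simp [good_zero]
  | succ i ih =>
    have ih' := ih (Nat.le_of_succ_le hi)
    have hiE : (i : ℝ) * δ ≤ 1 / 2 := by
      refine le_trans ?_ hEδ
      have : (i : ℝ) ≤ E := by exact_mod_cast Nat.le_of_succ_le hi
      gcongr
    have hhalf : (2 : ℝ≥0∞)⁻¹ ≤ μ (r.good i) := by
      rw [← ENNReal.ofReal_toReal (measure_ne_top μ (r.good i)), show (2 : ℝ≥0∞) = ENNReal.ofReal 2 by simp,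
        ← ENNReal.ofReal_inv_of_pos (by norm_num)]
      refine ENNReal.ofReal_le_ofReal ?_
      change _ ≤ μ.real _
      linarith
    obtain ⟨hmem, hnorm⟩ := h.memLp_initState i hhalf
    have hne : μ (r.good i) ≠ 0 := fun h0 => by simp [h0] at hhalf
    have h1 := hA.guarantee i (r.good i) (h.measurableSet_good i) hne
      (fun ω hω => h.stabilizes hω) hmem (r.eps i) δ (h.eps_pos i) hδ hδ1 fun ω hω =>
        ⟨(hreq i).trans_le (hA.creq_anti _ _ (norm_nonneg _) (h.norm_valueFn_le hω)), by
          rw [heps]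
          exact accuracy_size h.Tmult_pos h.prob.sig_pos hc (hA.cerr_nonneg _ _ hV0 hS0) i
            (hA.cerr_mono _ _ _ _ (norm_nonneg _) (h.norm_valueFn_le hω) (norm_nonneg _) hnorm)⟩
    have h2 : r.good i ⊆ r.good (i + 1) ∪
        (r.good i ∩ {ω | r.eps i < ‖ctrl r.sys r.Est r.Tmult r.K0 r.w r.η (i + 1) ω - r.Kstar‖}) := by
      intro ω hω
      rw [good_succ]
      by_cases h3 : r.eps i < ‖r.gain (i + 1) ω - r.Kstar‖
      · exact Or.inr ⟨hω, h3⟩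
      · exact Or.inl ⟨hω, h3⟩
    have h3 := (measureReal_mono (μ := μ) h2).trans (measureReal_union_le _ _)
    push_cast
    linarith

end Run.Valid

end AdaptiveLQR

namespace AdaptiveLQR
open scoped Topology

/-! ### Pathwise decomposition of the regret -/

lemma quad_add_le_sq {m : ℕ} {M : Matrix (Fin m) (Fin m) ℝ} (hM : M.PosSemidef) {x y : Fin m → ℝ}
    {a b : ℝ} (ha : 0 ≤ a) (hb : 0 ≤ b) (hx : quad M x ≤ a ^ 2) (hy : quad M y ≤ b ^ 2) :
    quad M (x + y) ≤ (a + b) ^ 2 := by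
  have hMt := transpose_eq_of_posSemidef hM
  have h0 := quad_nonneg_of_posSemidef hM
  have h1 : (x ⬝ᵥ (M *ᵥ y)) ^ 2 ≤ (a * b) ^ 2 :=
    (sq_dot_mulVec_le hMt h0 x y).trans (by rw [mul_pow]; exact mul_le_mul hx hy (h0 y) (sq_nonneg a))
  have h2 := (abs_le_of_sq_le_sq' h1 (mul_nonneg ha hb)).2
  rw [quad_add_right hMt]
  nlinarith

namespace Run

variable {n d : ℕ} {Ω : Type*} (r : Run n d Ω)

/-- The weight `R + Bᵀ V_⋆ B`. -/
noncomputable abbrev M : Matrix (Fin d) (Fin d) ℝ := inputWeight r.sys r.Vs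

/-- The excess `V - V_⋆` of the value function at a time step, on the event that all is well. -/
noncomputable def P (t : ℕ) : Ω → Matrix (Fin n) (Fin n) ℝ :=
  (r.good (r.ep t)).indicator fun ω => valueFn r.sys (r.gain (r.ep t) ω) - r.Vs

/-- The expected next state. -/
def Y (t : ℕ) (ω : Ω) : Fin n → ℝ := r.L t ω *ᵥ r.X t ω + r.sys.B *ᵥ r.η t ω

/-- The coefficient of the process noise. -/
noncomputable def coefW (t : ℕ) (ω : Ω) : Fin n → ℝ :=
  (2 : ℝ) • (r.Vs *ᵥ r.Y t ω) + (4 : ℝ) • (r.P t ω *ᵥ (r.L t ω *ᵥ r.X t ω))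

/-- The coefficient of the exploration noise. -/
noncomputable def coefη (t : ℕ) (ω : Ω) : Fin d → ℝ :=
  (4 : ℝ) • (r.sys.Bᵀ *ᵥ (r.P t ω *ᵥ (r.L t ω *ᵥ r.X t ω)))

/-- The quadratic form in the process noise. -/
noncomputable def quadW (t : ℕ) (ω : Ω) : Matrix (Fin n) (Fin n) ℝ := r.Vs + (4 : ℝ) • r.P t ω

/-- The quadratic form in the exploration noise. -/
noncomputable def quadη (t : ℕ) (ω : Ω) : Matrix (Fin d) (Fin d) ℝ :=
  (2 : ℝ) • r.M + (4 : ℝ) • (r.sys.Bᵀ * r.P t ω * r.sys.B)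

variable {r}

lemma P_of_good {t : ℕ} {ω : Ω} (hω : ω ∈ r.good (r.ep t)) :
    r.P t ω = valueFn r.sys (r.gain (r.ep t) ω) - r.Vs := Set.indicator_of_mem hω _

lemma P_of_not_good {t : ℕ} {ω : Ω} (hω : ω ∉ r.good (r.ep t)) : r.P t ω = 0 :=
  Set.indicator_of_notMem hω _

variable (r) in
lemma norm_Vs_le : ‖r.Vs‖ ≤ r.Γ := by
  have := (norms_le_Gam (sys := r.sys) (K0 := r.K0) (Kstar := r.Kstar)).2.2.2.1
  linarith

variable (r) in
lemma norm_B_le : ‖r.sys.B‖ ≤ r.Γ := by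
  have := (norms_le_Gam (sys := r.sys) (K0 := r.K0) (Kstar := r.Kstar)).2.1
  linarith

variable (r) in
lemma quad_Vs_le_dot (x : Fin n → ℝ) : quad r.Vs x ≤ r.Γ * (x ⬝ᵥ x) :=
  (quad_le _ x).trans (mul_le_mul_of_nonneg_right r.norm_Vs_le (dot_self_nonneg x))

namespace Valid

variable [m0 : MeasurableSpace Ω] {μ : Measure Ω} [NeZero n] (h : r.Valid μ)
include h

omit [NeZero n] in
lemma Vs_transpose : r.Vsᵀ = r.Vs := transpose_eq_of_posSemidef h.Vs_posSemidef

omit [NeZero n] in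
lemma M_posDef : r.M.PosDef := inputWeight_posDef h.prob.posR h.Vs_posSemidef

lemma P_posSemidef (t : ℕ) (ω : Ω) : (r.P t ω).PosSemidef := by
  by_cases hω : ω ∈ r.good (r.ep t)
  · rw [P_of_good hω]
    have hst := h.stabilizes hω
    refine posSemidef_of_quad ?_ fun x =>
      quad_valueFn_sub_nonneg h.prob.posS h.prob.posR h.prob.sig_pos h.prob.opt hst x
    rw [Matrix.transpose_sub, h.Vs_transpose, valueFn_transpose h.prob.posS h.prob.posR hst]
  · rw [P_of_not_good hω]; exact Matrix.PosSemidef.zero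

lemma quad_P_nonneg (t : ℕ) (ω : Ω) (x : Fin n → ℝ) : 0 ≤ quad (r.P t ω) x :=
  quad_nonneg_of_posSemidef (h.P_posSemidef t ω) x

lemma P_transpose (t : ℕ) (ω : Ω) : (r.P t ω)ᵀ = r.P t ω :=
  transpose_eq_of_posSemidef (h.P_posSemidef t ω)

lemma quad_P_le (t : ℕ) (ω : Ω) (x : Fin n → ℝ) : quad (r.P t ω) x ≤ quad (r.W (r.ep t)) x := by
  by_cases hω : ω ∈ r.good (r.ep t)
  · rw [P_of_good hω]
    rcases (r.ep t).eq_zero_or_eq_succ_pred with hi | hi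
    · rw [hi, gain_zero, quad_sub_left, W, if_pos rfl]
      linarith [quad_nonneg_of_posSemidef h.Vs_posSemidef x]
    · rw [hi] at hω ⊢
      rw [W, if_neg (Nat.succ_ne_zero _)]
      exact h.prob.quad_valueFn_sub_near_le (h.near hω) x
  · rw [P_of_not_good hω, quad_zero_left]; exact h.quad_W_nonneg _ x

lemma quad_P_le_dot (t : ℕ) (ω : Ω) (x : Fin n → ℝ) : quad (r.P t ω) x ≤ r.Γ * (x ⬝ᵥ x) := by
  refine (h.quad_P_le t ω x).trans ((h.quad_W_le _ x).trans ?_)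
  exact mul_le_mul_of_nonneg_right (by linarith [h.prob.v0_le]) (dot_self_nonneg x)

lemma quad_Vs_le_W (i : ℕ) (x : Fin n → ℝ) : quad r.Vs x ≤ quad (r.W i) x := by
  have := h.quad_W_anti (Nat.le_succ i) x
  rwa [W, if_neg (Nat.succ_ne_zero _)] at this

/-- Bellman with `u - Kstar x = (K - Kstar) x + η`; splitting the form `M` gives twice each part.
The first part is `P(x) - P(L x)` by `quad_valueFn_sub`. Replacing `L x` by the true next state in
`P`, and the noiseless next state by the true one in `V⋆`, yields the linear and quadratic noise
terms; the coefficients `4` are this `2` times the `2` of a cross term or of a split square. -/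
lemma cost_le {t : ℕ} {ω : Ω} (hω : ω ∈ r.good (r.ep t)) :
    cost r.sys (r.X t ω) (r.gain (r.ep t) ω *ᵥ r.X t ω + r.η t ω) ≤
      quad r.Vs (r.X t ω) - quad r.Vs (r.X (t + 1) ω) +
        2 * (quad (r.P t ω) (r.X t ω) - quad (r.P t ω) (r.X (t + 1) ω)) +
        r.coefW t ω ⬝ᵥ r.w t ω + r.coefη t ω ⬝ᵥ r.η t ω +
        quad (r.quadW t ω) (r.w t ω) + quad (r.quadη t ω) (r.η t ω) := by
  set x := r.X t ω
  set K := r.gain (r.ep t) ω with hK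
  set w := r.w t ω
  set u := r.η t ω
  set P := r.P t ω with hP
  set l := r.L t ω *ᵥ x with hl
  have hPt : Pᵀ = P := h.P_transpose t ω
  have hMt : r.Mᵀ = r.M := transpose_eq_of_posDef h.M_posDef
  have hxs : r.X (t + 1) ω = l + r.sys.B *ᵥ u + w := h.X_succ t ω
  have hb := bellman h.prob.posS h.prob.posR h.prob.sig_pos h.prob.opt x (K *ᵥ x + u)
  have e1 : r.sys.A *ᵥ x + r.sys.B *ᵥ (K *ᵥ x + u) = l + r.sys.B *ᵥ u := by
    rw [hl, L, closedLoop_mulVec, Matrix.mulVec_add, add_assoc]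
  have e2 : K *ᵥ x + u - r.Kstar *ᵥ x = (K - r.Kstar) *ᵥ x + u := by
    rw [Matrix.sub_mulVec]; abel
  rw [e1, e2] at hb
  have hsub := quad_valueFn_sub h.prob.posS h.prob.posR h.prob.sig_pos h.prob.opt
    (h.stabilizes hω) x
  rw [← hK, ← P_of_good hω, ← hP] at hsub
  change quad P x = quad P l + _ at hsub
  have hM2 := quad_add_le hMt (quad_nonneg_of_posDef h.M_posDef) ((K - r.Kstar) *ᵥ x) u
  have hV := quad_add_right h.Vs_transpose (l + r.sys.B *ᵥ u) w
  have hP1 := quad_add_right hPt l (r.sys.B *ᵥ u + w)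
  have hP2 := quad_add_le hPt (h.quad_P_nonneg t ω) (r.sys.B *ᵥ u) w
  rw [← add_assoc, Matrix.mulVec_add, dotProduct_add] at hP1
  have c1 : r.coefW t ω ⬝ᵥ w = 2 * ((l + r.sys.B *ᵥ u) ⬝ᵥ (r.Vs *ᵥ w)) + 4 * (l ⬝ᵥ (P *ᵥ w)) := by
    rw [coefW, add_dotProduct, smul_dotProduct, smul_dotProduct, smul_eq_mul, smul_eq_mul,
      symm_dot h.Vs_transpose, symm_dot hPt, dotProduct_comm w, dotProduct_comm w]
    rfl
  have c2 : r.coefη t ω ⬝ᵥ u = 4 * (l ⬝ᵥ (P *ᵥ (r.sys.B *ᵥ u))) := by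
    rw [coefη, smul_dotProduct, smul_eq_mul, symm_dot hPt, ← dot_mulVec_comm, dotProduct_comm]
  have c3 : quad (r.quadW t ω) w = quad r.Vs w + 4 * quad P w := by
    rw [quadW, quad_add_left, quad_smul_left]
  have c4 : quad (r.quadη t ω) u = 2 * quad r.M u + 4 * quad P (r.sys.B *ᵥ u) := by
    rw [quadη, quad_add_left, quad_smul_left, quad_smul_left, quad_conj]
  have c5 : cost r.sys x (K *ᵥ x + u) = quad r.sys.S x + quad r.sys.R (K *ᵥ x + u) := rfl
  rw [c1, c2, c3, c4, c5, hxs]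
  linarith

/-- `P` is constant within an epoch, so the sum telescopes there. Each change of epoch costs at most
`m`, since `P ≤ W`. The final nonnegative term is kept on the right to carry the induction. -/
lemma sum_P_le {T : ℕ} {ω : Ω} {m : ℝ} (hm : ∀ t ≤ T, quad (r.W (r.ep t)) (r.X t ω) ≤ m)
    (hω : ω ∈ r.good (r.ep T)) :
    ∑ t ∈ Finset.range (T + 1), (quad (r.P t ω) (r.X t ω) - quad (r.P t ω) (r.X (t + 1) ω)) ≤
      r.ep T * m - quad (r.P T ω) (r.X (T + 1) ω) := by
  induction T with
  | zero => simp [X_zero, ep_zero]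
  | succ T ih =>
    have ih' := ih (fun t ht => hm t (ht.trans (Nat.le_succ T)))
      (r.good_anti (r.ep_mono (Nat.le_succ T)) hω)
    rw [Finset.sum_range_succ]
    have h1 := h.quad_P_nonneg T ω (r.X (T + 1) ω)
    have h2 := (h.quad_P_le (T + 1) ω _).trans (hm (T + 1) le_rfl)
    rcases epochOf_succ h.Tmult_pos T with h3 | ⟨h3, -⟩
    · change r.ep (T + 1) = r.ep T at h3
      have h4 : r.P (T + 1) ω = r.P T ω := by rw [P, P, h3]
      rw [h4, h3]
      linarith
    · change r.ep (T + 1) = r.ep T + 1 at h3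
      rw [h3]
      push_cast
      linarith

lemma Jstar_eq : Jstar r.sys = r.sys.σw ^ 2 * r.Vs.trace :=
  AdaptiveLQR.Jstar_eq h.prob.posS h.prob.posR h.prob.opt

lemma regret_le {T : ℕ} {ω : Ω} {m : ℝ} (hm : ∀ t ≤ T, quad (r.W (r.ep t)) (r.X t ω) ≤ m)
    (hω : ω ∈ r.good (r.ep T)) :
    regret r.sys r.Est r.Tmult r.K0 (fun t => r.w t ω) (fun t => r.η t ω) T ≤
      Jstar r.sys + 2 * (r.ep T * m) - (T + 1) * (r.sys.σw ^ 2 * r.Vs.trace) +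
        ∑ t ∈ Finset.range (T + 1), r.coefW t ω ⬝ᵥ r.w t ω +
        ∑ t ∈ Finset.range (T + 1), r.coefη t ω ⬝ᵥ r.η t ω +
        ∑ t ∈ Finset.range (T + 1), quad (r.quadW t ω) (r.w t ω) +
        ∑ t ∈ Finset.range (T + 1), quad (r.quadη t ω) (r.η t ω) := by
  set c : ℕ → ℝ := fun t => cost r.sys (r.X t ω) (r.gain (r.ep t) ω *ᵥ r.X t ω + r.η t ω) with hc
  have hc0 : 0 ≤ c 0 := add_nonneg (quad_nonneg_of_posDef h.prob.posS _)
    (quad_nonneg_of_posDef h.prob.posR _)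
  have h1 : regret r.sys r.Est r.Tmult r.K0 (fun t => r.w t ω) (fun t => r.η t ω) T =
      ∑ t ∈ Finset.Icc 1 T, c t - T * Jstar r.sys := rfl
  -- The sum is extended to time `0`, where `X = 0` makes the telescoping start from zero. There are
  -- now `T + 1` terms, which explains the additional `J⋆`.
  have h2 : ∑ t ∈ Finset.Icc 1 T, c t ≤ ∑ t ∈ Finset.range (T + 1), c t := by
    rw [Finset.sum_range_succ', Finset.range_eq_Ico, Finset.sum_Ico_add' c 0 T 1,
      ← Finset.Ico_add_one_right_eq_Icc, zero_add]
    linarith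
  have h3 : ∑ t ∈ Finset.range (T + 1), c t ≤ ∑ t ∈ Finset.range (T + 1), _ :=
    Finset.sum_le_sum fun t ht => h.cost_le
      (r.good_anti (r.ep_mono (Nat.lt_succ_iff.1 (Finset.mem_range.1 ht))) hω)
  simp only [Finset.sum_add_distrib, ← Finset.mul_sum] at h3
  have h4 := h.sum_P_le hm hω
  have h5 := h.quad_P_nonneg T ω (r.X (T + 1) ω)
  have h6 := Finset.sum_range_sub' (fun t => quad r.Vs (r.X t ω)) (T + 1)
  have h7 := quad_nonneg_of_posSemidef h.Vs_posSemidef (r.X (T + 1) ω)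
  simp only [X_zero, quad_zero_right] at h6
  have h8 := h.Jstar_eq
  rw [h1]
  rw [h6] at h3
  have h9 : (T + 1) * (r.sys.σw ^ 2 * r.Vs.trace) = T * Jstar r.sys + Jstar r.sys := by rw [h8]; ring
  linarith

/-- Bounded noise keeps the state bounded. -/
lemma quad_X_le {T : ℕ} {ω : Ω} {z : ℝ} (hω : ω ∈ r.good (r.ep T))
    (hz : ∀ t ≤ T, (r.sys.B *ᵥ r.η t ω + r.w t ω) ⬝ᵥ (r.sys.B *ᵥ r.η t ω + r.w t ω) ≤ z) {t : ℕ}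
    (ht : t ≤ T) : quad (r.W (r.ep t)) (r.X t ω) ≤ 16 * r.Γ ^ 3 / r.lam ^ 2 * z := by
  have hl := h.prob.lam_pos
  have hv := h.prob.v0_pos
  have hΓ := h.prob.Gam_pos
  have hz0 : 0 ≤ z := (dot_self_nonneg _).trans (hz 0 (Nat.zero_le T))
  have hgap : r.lam / (4 * ‖r.V0‖) ≤ 1 - r.rho := by
    refine h.prob.gap_rho0.trans (le_of_eq ?_)
    change _ = 1 - rhoBar _ _
    rw [rhoBar_eq]; ring
  have hgap0 : 0 < 1 - r.rho := lt_of_lt_of_le (by positivity) hgap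
  set b := √(r.Γ * z) with hb
  have hb2 : b ^ 2 = r.Γ * z := Real.sq_sqrt (by positivity)
  -- The fixed point of `s ↦ ρ̄ s + b`: in the norm of `W` a step contracts by `ρ̄` and the noise
  -- adds at most `b`.
  set s := b / (1 - r.rho) with hs
  have hs0 : 0 ≤ s := by positivity
  have hρ := h.prob.rhoBar_pos
  have key : ∀ t ≤ T, quad (r.W (r.ep t)) (r.X t ω) ≤ s ^ 2 := by
    intro t
    induction t with
    | zero => intro _; rw [X_zero, quad_zero_right]; positivity
    | succ t ih =>
      intro ht
      have ih' := ih (Nat.le_of_succ_le ht)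
      have hωt := r.good_anti (r.ep_mono (Nat.le_of_succ_le ht)) hω
      refine (h.quad_W_anti (r.ep_mono (Nat.le_succ t)) _).trans ?_
      rw [h.X_succ, add_assoc]
      have h1 : quad (r.W (r.ep t)) (r.L t ω *ᵥ r.X t ω) ≤ (r.rho * s) ^ 2 := by
        rw [mul_pow]
        exact (h.contract hωt _).trans (mul_le_mul_of_nonneg_left ih' (sq_nonneg _))
      have h2 : quad (r.W (r.ep t)) (r.sys.B *ᵥ r.η t ω + r.w t ω) ≤ b ^ 2 := by
        rw [hb2]
        refine (h.quad_W_le _ _).trans (mul_le_mul ?_ (hz t (Nat.le_of_succ_le ht))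
          (dot_self_nonneg _) hΓ.le)
        linarith [h.prob.v0_le]
      refine (quad_add_le_sq (h.W_posSemidef _) (by positivity) (Real.sqrt_nonneg _) h1 h2).trans
        (le_of_eq ?_)
      rw [hs]; field_simp; ring
  refine (key t ht).trans ?_
  have h3 : 1 / (1 - r.rho) ≤ 4 * r.Γ / r.lam := by
    rw [div_le_div_iff₀ hgap0 hl]
    rw [div_le_iff₀ (by positivity)] at hgap
    nlinarith [h.prob.v0_le]
  calc s ^ 2 = b ^ 2 * (1 / (1 - r.rho)) ^ 2 := by rw [hs]; ring
    _ ≤ (r.Γ * z) * (4 * r.Γ / r.lam) ^ 2 := by rw [hb2]; gcongr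
    _ = _ := by ring

lemma coefW_dot_le {t : ℕ} {ω : Ω} (hω : ω ∈ r.good (r.ep t)) :
    r.coefW t ω ⬝ᵥ r.coefW t ω ≤
      48 * r.Γ * quad (r.W (r.ep t)) (r.X t ω) + 16 * r.Γ ^ 4 * (r.η t ω ⬝ᵥ r.η t ω) := by
  have hΓ := h.prob.Gam_pos
  set l := r.L t ω *ᵥ r.X t ω with hl
  set q := quad (r.W (r.ep t)) (r.X t ω) with hq
  have hρ : r.rho ^ 2 ≤ 1 := by
    have := h.prob.rhoBar_pos; have := h.prob.rhoBar_lt_one; nlinarith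
  have hlq : quad (r.W (r.ep t)) l ≤ q :=
    (h.contract hω _).trans (mul_le_of_le_one_left (h.quad_W_nonneg _ _) hρ)
  have h1 : quad r.Vs (r.Y t ω) ≤ 2 * q + 2 * (r.Γ ^ 3 * (r.η t ω ⬝ᵥ r.η t ω)) := by
    refine (quad_add_le h.Vs_transpose (quad_nonneg_of_posSemidef h.Vs_posSemidef) _ _).trans ?_
    have i1 := (h.quad_Vs_le_W (r.ep t) l).trans hlq
    have i2 : quad r.Vs (r.sys.B *ᵥ r.η t ω) ≤ r.Γ ^ 3 * (r.η t ω ⬝ᵥ r.η t ω) := by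
      refine (r.quad_Vs_le_dot _).trans ?_
      calc _ ≤ r.Γ * (‖r.sys.B‖ ^ 2 * (r.η t ω ⬝ᵥ r.η t ω)) := by
            gcongr; exact mulVec_dot_self_le _ _
        _ ≤ r.Γ * (r.Γ ^ 2 * (r.η t ω ⬝ᵥ r.η t ω)) := by
            gcongr
            · exact dot_self_nonneg _
            · exact r.norm_B_le
        _ = _ := by ring
    linarith
  have h2 := mulVec_dot_self_le_quad h.Vs_transpose (quad_nonneg_of_posSemidef h.Vs_posSemidef)
    r.quad_Vs_le_dot (r.Y t ω)
  have h3 := mulVec_dot_self_le_quad (h.P_transpose t ω) (h.quad_P_nonneg t ω)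
    (h.quad_P_le_dot t ω) l
  have h4 := (h.quad_P_le t ω l).trans hlq
  have h5 := quad_add_le (M := (1 : Matrix (Fin n) (Fin n) ℝ)) Matrix.transpose_one
    (fun x => by rw [quad_one]; exact dot_self_nonneg x)
    ((2 : ℝ) • (r.Vs *ᵥ r.Y t ω)) ((4 : ℝ) • (r.P t ω *ᵥ l))
  simp only [quad_smul_right, quad_one] at h5
  calc _ ≤ 8 * (r.Γ * quad r.Vs (r.Y t ω)) + 32 * (r.Γ * quad (r.P t ω) l) := by
        refine h5.trans ?_; linarith
    _ ≤ 8 * (r.Γ * (2 * q + 2 * (r.Γ ^ 3 * (r.η t ω ⬝ᵥ r.η t ω)))) + 32 * (r.Γ * q) := by gcongr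
    _ = _ := by ring

lemma coefη_dot_le {t : ℕ} {ω : Ω} (hω : ω ∈ r.good (r.ep t)) :
    r.coefη t ω ⬝ᵥ r.coefη t ω ≤ 16 * r.Γ ^ 3 * quad (r.W (r.ep t)) (r.X t ω) := by
  have hΓ := h.prob.Gam_pos
  set l := r.L t ω *ᵥ r.X t ω with hl
  have hρ : r.rho ^ 2 ≤ 1 := by
    have := h.prob.rhoBar_pos; have := h.prob.rhoBar_lt_one; nlinarith
  have hlq : quad (r.W (r.ep t)) l ≤ quad (r.W (r.ep t)) (r.X t ω) :=
    (h.contract hω _).trans (mul_le_of_le_one_left (h.quad_W_nonneg _ _) hρ)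
  have h3 := mulVec_dot_self_le_quad (h.P_transpose t ω) (h.quad_P_nonneg t ω)
    (h.quad_P_le_dot t ω) l
  have h4 := (h.quad_P_le t ω l).trans hlq
  have h5 := mulVec_dot_self_le r.sys.Bᵀ (r.P t ω *ᵥ l)
  rw [norm_transpose] at h5
  rw [coefη, smul_dotProduct, dotProduct_smul, smul_eq_mul, smul_eq_mul]
  calc _ ≤ 4 * (4 * (r.Γ ^ 2 * (r.Γ * quad (r.W (r.ep t)) (r.X t ω)))) := by
        gcongr
        refine h5.trans (mul_le_mul ?_ ?_ (dot_self_nonneg _) (sq_nonneg _))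
        · exact pow_le_pow_left₀ (norm_nonneg _) r.norm_B_le 2
        · exact h3.trans (mul_le_mul_of_nonneg_left h4 hΓ.le)
    _ = _ := by ring

end Valid
end Run

end AdaptiveLQR

namespace AdaptiveLQR
open scoped Topology

/-! ### The typical event -/

section Tail

variable {Ω : Type*} {m : ℕ} {F : ℕ → MeasurableSpace Ω} [m0 : MeasurableSpace Ω] {μ : Measure Ω}
  {ν : ℕ → Ω → Fin m → ℝ} {σ : ℕ → ℝ}

lemma DrivenBy.shift (h : DrivenBy F μ ν σ) (s : ℕ) :
    DrivenBy (fun t => F (s + t)) μ (fun t => ν (s + t)) (fun t => σ (s + t)) :=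
  ⟨fun _ => h.le _, fun _ => h.mono _, fun _ => h.measurable_next _, fun _ => h.indep _,
    fun _ => h.law _⟩

variable [IsProbabilityMeasure μ]

lemma DrivenBy.norm_tail (h : DrivenBy F μ ν σ) {s : ℝ} (hs0 : 0 < s) (hs : ∀ t, σ t ^ 2 ≤ s ^ 2)
    {b : ℝ} (hb0 : 0 < b) (hb : (m : ℝ) ≤ b) {δ : ℝ} (hδ : 0 < δ) (t : ℕ) :
    μ {ω | s ^ 2 * b * (2 + 4 * Real.log (1 / δ)) < ν t ω ⬝ᵥ ν t ω} ≤ ENNReal.ofReal δ := by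
  -- A one-step sum with the identity form, started at time `t`; `θ` is the largest value that
  -- `quad_tail` allows for the trace bound `b`.
  have h1 := (h.shift t).quad_tail (fun j => hs (t + j)) (P := fun _ _ => 1)
    (fun _ _ _ => measurable_const) (fun _ _ => Matrix.PosSemidef.one) (b := b)
    (fun _ _ => by rw [Matrix.trace_one, Fintype.card_fin]; exact hb)
    (θ := 1 / (4 * (s ^ 2 * b))) (by positivity) (by field_simp; exact le_rfl) hδ 1
  refine (measure_mono fun ω hω => ?_).trans h1
  simp only [Set.mem_ofPred_eq, Finset.range_one, Finset.sum_singleton, add_zero, quad_one,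
    Matrix.trace_one, Fintype.card_fin, Nat.cast_one] at hω ⊢
  refine lt_of_le_of_lt ?_ hω
  have h2 : σ t ^ 2 * m ≤ s ^ 2 * b := mul_le_mul (hs t) hb (Nat.cast_nonneg _) (sq_nonneg s)
  have h3 : 2 * 1 * (1 / (4 * (s ^ 2 * b))) * (s ^ 2 * b) ^ 2 = s ^ 2 * b / 2 := by
    field_simp; ring
  have h4 : Real.log (1 / δ) / (1 / (4 * (s ^ 2 * b))) = 4 * (s ^ 2 * b) * Real.log (1 / δ) := by
    field_simp
  rw [h3, h4]
  have : 0 < s ^ 2 * b := by positivity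
  linarith

end Tail

namespace Run

variable {n d : ℕ} {Ω : Type*} (r : Run n d Ω)

/-- The event that the noise behaves as expected up to time `N`. -/
structure Typical (N : ℕ) (ℓ : ℝ) (ω : Ω) : Prop where
  w_le : ∀ t < N, r.w t ω ⬝ᵥ r.w t ω ≤ r.sys.σw ^ 2 * n * (2 + 4 * ℓ)
  η_le : ∀ t < N, r.η t ω ⬝ᵥ r.η t ω ≤ r.sys.σw ^ 2 * n * (2 + 4 * ℓ)
  sum_coefW : ∑ t ∈ Finset.range N, r.coefW t ω ⬝ᵥ r.w t ω ≤
    r.lam / (r.sys.σw ^ 2 * r.Γ ^ 3 * √N) * r.sys.σw ^ 2 / 2 *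
      ∑ t ∈ Finset.range N, r.coefW t ω ⬝ᵥ r.coefW t ω + ℓ / (r.lam / (r.sys.σw ^ 2 * r.Γ ^ 3 * √N))
  sum_coefη : ∑ t ∈ Finset.range N, r.coefη t ω ⬝ᵥ r.η t ω ≤
    r.lam / (r.sys.σw ^ 2 * r.Γ ^ 4 * √N) * r.sys.σw ^ 2 / 2 *
      ∑ t ∈ Finset.range N, r.coefη t ω ⬝ᵥ r.coefη t ω + ℓ / (r.lam / (r.sys.σw ^ 2 * r.Γ ^ 4 * √N))
  sum_quadW : ∑ t ∈ Finset.range N, quad (r.quadW t ω) (r.w t ω) ≤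
    ∑ t ∈ Finset.range N, r.sys.σw ^ 2 * (r.quadW t ω).trace +
      r.sys.σw ^ 2 * (5 * n * r.Γ) * √N * (1 + 4 * ℓ)
  sum_quadη : ∑ t ∈ Finset.range N, quad (r.quadη t ω) (r.η t ω) ≤
    ∑ t ∈ Finset.range N, sigEta r.sys r.α (r.ep t) ^ 2 * (r.quadη t ω).trace +
      r.sys.σw ^ 2 * (6 * n * r.Γ ^ 3) * √N * (1 + 4 * ℓ)

namespace Valid

variable {r} [m0 : MeasurableSpace Ω] {μ : Measure Ω} [NeZero n] (h : r.Valid μ)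
include h

/-- The value function is defined by choice, so measurability comes from writing it as the limit of
partial Lyapunov sums. These converge on the good event, where the closed loop is stable; elsewhere
the indicator gives zero. -/
lemma measurable_P (t : ℕ) (i j) : Measurable[past r.w r.η t] fun ω => r.P t ω i j := by
  set Q : Ω → Matrix (Fin n) (Fin n) ℝ := fun ω =>
    r.sys.S + (r.gain (r.ep t) ω)ᵀ * r.sys.R * r.gain (r.ep t) ω with hQ
  have hg := h.measurable_gain t
  have hQm : ∀ a b, Measurable[past r.w r.η t] fun ω => Q ω a b := fun a b => by
    simp only [hQ, Matrix.add_apply]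
    refine Measurable.const_add (measurable_mul_rand (M := fun ω => (r.gain (r.ep t) ω)ᵀ * r.sys.R)
      (measurable_mul_rand (M := fun ω => (r.gain (r.ep t) ω)ᵀ) (N := fun _ => r.sys.R)
        (fun a b => hg b a) fun a b => measurable_const) hg a b) _
  have hL := h.measurable_L t
  have hterm : ∀ (k : ℕ) (a b : Fin n), Measurable[past r.w r.η t] fun ω =>
      ((r.L t ω ^ k)ᵀ * Q ω * r.L t ω ^ k) a b := fun k =>
    measurable_mul_rand (M := fun ω => (r.L t ω ^ k)ᵀ * Q ω)
      (measurable_mul_rand (M := fun ω => (r.L t ω ^ k)ᵀ)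
        (fun a b => measurable_pow_rand hL k b a) hQm) (measurable_pow_rand hL k)
  have hG := h.measurableSet_good_ep t
  refine @measurable_of_tendsto_metrizable _ _ (past r.w r.η t) _ _ _ _
    (fun N => (r.good (r.ep t)).indicator fun ω =>
      ∑ k ∈ Finset.range N, ((r.L t ω ^ k)ᵀ * Q ω * r.L t ω ^ k) i j - r.Vs i j) _ (fun N => ?_) ?_
  · exact ((Finset.measurable_sum _ fun k _ => hterm k i j).sub_const _).indicator hG
  · refine tendsto_pi_nhds.2 fun ω => ?_
    by_cases hω : ω ∈ r.good (r.ep t)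
    · simp only [Set.indicator_of_mem hω, P_of_good hω, Matrix.sub_apply]
      have hst := h.stabilizes hω
      have h1 := tendsto_matrix_iff.1
        (tendsto_lyapunov_sum (valueFn_eq hst) (tendsto_pow_of_isStable hst)) i j
      simp only [Matrix.sum_apply] at h1
      exact h1.sub_const _
    · simp only [Set.indicator_of_notMem hω, P_of_not_good hω, Matrix.zero_apply]
      exact tendsto_const_nhds

omit [NeZero n] in
lemma measurable_LX (t : ℕ) : Measurable[past r.w r.η t] fun ω => r.L t ω *ᵥ r.X t ω :=
  measurable_mulVec_rand (h.measurable_L t) (h.measurable_X t)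

lemma measurable_PLX (t : ℕ) :
    Measurable[past r.w r.η t] fun ω => r.P t ω *ᵥ (r.L t ω *ᵥ r.X t ω) :=
  measurable_mulVec_rand (h.measurable_P t) (h.measurable_LX t)

lemma measurable_coefη (t : ℕ) : Measurable[past r.w r.η t] (r.coefη t) :=
  ((measurable_mulVec _).comp (h.measurable_PLX t)).const_smul (4 : ℝ)

lemma measurable_coefW (t : ℕ) : Measurable[pastInput r.w r.η t] (r.coefW t) := by
  have hle1 : past r.w r.η t ≤ pastInput r.w r.η t := le_sup_left
  have h1 : Measurable[pastInput r.w r.η t] (r.Y t) := by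
    refine Measurable.add ((h.measurable_LX t).mono hle1 le_rfl) ((measurable_mulVec _).comp ?_)
    exact (comap_measurable (r.η t)).mono le_sup_right le_rfl
  exact (((measurable_mulVec _).comp h1).const_smul (2 : ℝ)).add
    (((h.measurable_PLX t).mono hle1 le_rfl).const_smul (4 : ℝ))

lemma measurable_quadW (t : ℕ) (i j) :
    Measurable[pastInput r.w r.η t] fun ω => r.quadW t ω i j := by
  have hle1 : past r.w r.η t ≤ pastInput r.w r.η t := le_sup_left
  exact (((h.measurable_P t i j).mono hle1 le_rfl).const_mul 4).const_add _

lemma measurable_quadη (t : ℕ) (i j) : Measurable[past r.w r.η t] fun ω => r.quadη t ω i j := by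
  refine Measurable.const_add (Measurable.const_mul ?_ 4) _
  exact measurable_mul_rand (M := fun ω => r.sys.Bᵀ * r.P t ω) (N := fun _ => r.sys.B)
    (measurable_mul_rand (M := fun _ => r.sys.Bᵀ) (fun _ _ => measurable_const) (h.measurable_P t))
    (fun _ _ => measurable_const) i j

lemma quadW_posSemidef (t : ℕ) (ω : Ω) : (r.quadW t ω).PosSemidef :=
  h.Vs_posSemidef.add ((h.P_posSemidef t ω).smul (by norm_num))

lemma quadη_posSemidef (t : ℕ) (ω : Ω) : (r.quadη t ω).PosSemidef :=
  (h.M_posDef.posSemidef.smul (by norm_num)).add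
    ((posSemidef_conj (h.P_posSemidef t ω) _).smul (by norm_num))

lemma trace_P_le (t : ℕ) (ω : Ω) : (r.P t ω).trace ≤ n * r.Γ :=
  trace_le_of_quad_le fun x => h.quad_P_le_dot t ω x

lemma trace_P_nonneg (t : ℕ) (ω : Ω) : 0 ≤ (r.P t ω).trace :=
  trace_nonneg_of_quad (h.quad_P_nonneg t ω)

lemma trace_conj_P_le (t : ℕ) (ω : Ω) :
    (r.sys.Bᵀ * r.P t ω * r.sys.B).trace ≤ r.Γ ^ 2 * (r.P t ω).trace :=
  (trace_conj_le_trace (h.P_posSemidef t ω) _).trans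
    (mul_le_mul_of_nonneg_right (pow_le_pow_left₀ (norm_nonneg _) r.norm_B_le 2)
      (h.trace_P_nonneg t ω))

lemma trace_M_le (hdn : d ≤ n) : r.M.trace ≤ n * r.Γ ^ 3 := by
  refine (trace_le_norm _).trans (mul_le_mul (by exact_mod_cast hdn) h.prob.norm_inputWeight_le
    (norm_nonneg _) (Nat.cast_nonneg _))

lemma trace_quadW_le (t : ℕ) (ω : Ω) : (r.quadW t ω).trace ≤ 5 * n * r.Γ := by
  have h1 : (r.Vs).trace ≤ n * r.Γ := trace_le_of_quad_le r.quad_Vs_le_dot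
  have h2 := h.trace_P_le t ω
  rw [quadW, Matrix.trace_add, Matrix.trace_smul, smul_eq_mul]
  linarith

lemma trace_quadη_le (hdn : d ≤ n) (t : ℕ) (ω : Ω) : (r.quadη t ω).trace ≤ 6 * n * r.Γ ^ 3 := by
  have h1 := h.trace_M_le hdn
  have h2 := h.trace_conj_P_le t ω
  have h3 := mul_le_mul_of_nonneg_left (h.trace_P_le t ω) (sq_nonneg r.Γ)
  rw [quadη, Matrix.trace_add, Matrix.trace_smul, Matrix.trace_smul, smul_eq_mul, smul_eq_mul]
  linarith

variable [IsProbabilityMeasure μ]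

omit h [NeZero n] in
-- With `θ = 1 / (4 s² b √N)` the accumulated second-order term and the logarithmic term both scale
-- like `√N`.
lemma quad_tail_rate {m : ℕ} {F : ℕ → MeasurableSpace Ω} {ν : ℕ → Ω → Fin m → ℝ} {σ : ℕ → ℝ}
    (hd : DrivenBy F μ ν σ) {s : ℝ} (hs0 : 0 < s) (hs : ∀ t, σ t ^ 2 ≤ s ^ 2)
    {Q : ℕ → Ω → Matrix (Fin m) (Fin m) ℝ} (hQ : ∀ t i j, Measurable[F t] fun ω => Q t ω i j)
    (hpsd : ∀ t ω, (Q t ω).PosSemidef) {b : ℝ} (hb0 : 0 < b) (hb : ∀ t ω, (Q t ω).trace ≤ b)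
    {δ : ℝ} (hδ : 0 < δ) {N : ℕ} (hN : 0 < N) :
    μ {ω | ∑ t ∈ Finset.range N, σ t ^ 2 * (Q t ω).trace +
        s ^ 2 * b * √N * (1 + 4 * Real.log (1 / δ)) <
        ∑ t ∈ Finset.range N, quad (Q t ω) (ν t ω)} ≤ ENNReal.ofReal δ := by
  have hN1 : (1 : ℝ) ≤ N := by exact_mod_cast hN
  have hsq : 1 ≤ √(N : ℝ) := Real.one_le_sqrt.2 hN1
  have hsq2 : √(N : ℝ) ^ 2 = N := Real.sq_sqrt (by linarith)
  have hsb : 0 < s ^ 2 * b := by positivity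
  refine (measure_mono fun ω hω => ?_).trans
    (hd.quad_tail hs hQ hpsd hb (θ := 1 / (4 * (s ^ 2 * b) * √N)) (by positivity) ?_ hδ N)
  · simp only [Set.mem_ofPred_eq] at hω ⊢
    refine lt_of_le_of_lt ?_ hω
    have h1 : 2 * N * (1 / (4 * (s ^ 2 * b) * √N)) * (s ^ 2 * b) ^ 2 = s ^ 2 * b * √N / 2 := by
      field_simp; rw [hsq2]; ring
    have h2 : Real.log (1 / δ) / (1 / (4 * (s ^ 2 * b) * √N)) =
        s ^ 2 * b * √N * (4 * Real.log (1 / δ)) := by field_simp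
    rw [h1, h2]
    have : 0 < s ^ 2 * b * √N := by positivity
    linarith
  · rw [one_div_mul_eq_div, div_le_div_iff₀ (by positivity) (by norm_num)]
    nlinarith

/-- Six failure events of probability `δ / 8` each; the two pointwise noise bounds are unions of `N`
events of probability `δ / (8 N)`. The single logarithm `log (8 N / δ)` dominates all that occur. -/
lemma measure_not_typical_le (hdn : d ≤ n) {N : ℕ} (hN : 0 < N) {δ : ℝ} (hδ : 0 < δ) :
    μ {ω | ¬ r.Typical N (Real.log (8 * N / δ)) ω} ≤ ENNReal.ofReal (3 * δ / 4) := by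
  have hn : (0 : ℝ) < n := by exact_mod_cast Nat.pos_of_ne_zero (NeZero.ne n)
  have hσ := h.prob.sig_pos
  have hl := h.prob.lam_pos
  have hΓ := h.prob.Gam_pos
  have hNp : (0 : ℝ) < N := by exact_mod_cast hN
  have hN1 : (1 : ℝ) ≤ N := by exact_mod_cast hN
  set ℓ := Real.log (8 * N / δ) with hℓ
  have hW := h.noise.drivenBy_w
  have hE := h.noise.drivenBy_η
  have hsW : ∀ t : ℕ, (fun _ => r.sys.σw : ℕ → ℝ) t ^ 2 ≤ r.sys.σw ^ 2 := fun t => le_rfl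
  have hsE : ∀ t : ℕ, sigEta r.sys r.α (epochOf r.Tmult t) ^ 2 ≤ r.sys.σw ^ 2 := fun t =>
    h.sigEta_sq_le _
  have hlog : ∀ {x : ℝ}, 0 < x → x ≤ N → Real.log (1 / (δ / (8 * x))) ≤ ℓ := fun {x} hx hxN => by
    rw [one_div_div]
    refine Real.log_le_log (by positivity) ?_
    gcongr
  set δ1 := δ / (8 * N) with hδ1
  have hδ1p : 0 < δ1 := by positivity
  have hℓ1 : Real.log (1 / δ1) ≤ ℓ := hlog hNp le_rfl
  have hδ8 : 0 < δ / (8 * 1) := by positivity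
  have hℓ8 : Real.log (1 / (δ / (8 * 1))) ≤ ℓ := hlog one_pos hN1
  set B1 := ⋃ t ∈ Finset.range N, {ω | r.sys.σw ^ 2 * n * (2 + 4 * Real.log (1 / δ1)) <
    r.w t ω ⬝ᵥ r.w t ω}
  set B2 := ⋃ t ∈ Finset.range N, {ω | r.sys.σw ^ 2 * n * (2 + 4 * Real.log (1 / δ1)) <
    r.η t ω ⬝ᵥ r.η t ω}
  have hunion : ∀ {A : ℕ → Set Ω}, (∀ t, μ (A t) ≤ ENNReal.ofReal δ1) →
      μ (⋃ t ∈ Finset.range N, A t) ≤ ENNReal.ofReal (δ / 8) := fun {A} hA => by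
    refine (measure_biUnion_finset_le _ _).trans ((Finset.sum_le_sum fun t _ => hA t).trans ?_)
    rw [Finset.sum_const, Finset.card_range, nsmul_eq_mul, ← ENNReal.ofReal_natCast,
      ← ENNReal.ofReal_mul (Nat.cast_nonneg _)]
    refine ENNReal.ofReal_le_ofReal (le_of_eq ?_)
    rw [hδ1]; field_simp
  have h1 : μ B1 ≤ ENNReal.ofReal (δ / 8) := hunion fun t => hW.norm_tail hσ hsW hn le_rfl hδ1p t
  have h2 : μ B2 ≤ ENNReal.ofReal (δ / 8) :=
    hunion fun t => hE.norm_tail hσ hsE hn (by exact_mod_cast hdn) hδ1p t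
  have hsq : 0 < √(N : ℝ) := Real.sqrt_pos.2 hNp
  -- On bounded states the squared coefficients sum to order `N Γ⁶ / λ²` for `w` and `N Γ⁸ / λ²` for
  -- `η`, times the noise scale. These values of `θ` balance the variance term against `ℓ / θ` in
  -- `N`, `Γ` and `λ`.
  have hθ1 : 0 < r.lam / (r.sys.σw ^ 2 * r.Γ ^ 3 * √N) := by positivity
  have hθ2 : 0 < r.lam / (r.sys.σw ^ 2 * r.Γ ^ 4 * √N) := by positivity
  have h3 := hW.linear_tail hsW h.measurable_coefW hθ1 hδ8 N
  have h4 := hE.linear_tail hsE h.measurable_coefη hθ2 hδ8 N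
  have h5 := quad_tail_rate hW hσ hsW h.measurable_quadW h.quadW_posSemidef
    (b := 5 * n * r.Γ) (by positivity) h.trace_quadW_le hδ8 hN
  have h6 := quad_tail_rate hE hσ hsE h.measurable_quadη h.quadη_posSemidef
    (b := 6 * n * r.Γ ^ 3) (by positivity) (h.trace_quadη_le hdn) hδ8 hN
  set B3 := {ω | _ < ∑ t ∈ Finset.range N, r.coefW t ω ⬝ᵥ r.w t ω}
  set B4 := {ω | _ < ∑ t ∈ Finset.range N, r.coefη t ω ⬝ᵥ r.η t ω}
  set B5 := {ω | _ < ∑ t ∈ Finset.range N, quad (r.quadW t ω) (r.w t ω)}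
  set B6 := {ω | _ < ∑ t ∈ Finset.range N, quad (r.quadη t ω) (r.η t ω)}
  have hsub : {ω | ¬ r.Typical N ℓ ω} ⊆ B1 ∪ B2 ∪ B3 ∪ B4 ∪ B5 ∪ B6 := by
    intro ω hω
    by_contra hnot
    simp only [Set.mem_union, not_or] at hnot
    obtain ⟨⟨⟨⟨⟨n1, n2⟩, n3⟩, n4⟩, n5⟩, n6⟩ := hnot
    refine hω ⟨fun t ht => ?_, fun t ht => ?_, ?_, ?_, ?_, ?_⟩
    · refine (not_lt.1 fun hlt => n1 ?_ : r.w t ω ⬝ᵥ r.w t ω ≤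
        r.sys.σw ^ 2 * n * (2 + 4 * Real.log (1 / δ1))).trans ?_
      · exact Set.mem_biUnion (Finset.mem_coe.2 (Finset.mem_range.2 ht)) (Set.mem_ofPred_eq ▸ hlt)
      gcongr
    · refine (not_lt.1 fun hlt => n2 ?_ : r.η t ω ⬝ᵥ r.η t ω ≤
        r.sys.σw ^ 2 * n * (2 + 4 * Real.log (1 / δ1))).trans ?_
      · exact Set.mem_biUnion (Finset.mem_coe.2 (Finset.mem_range.2 ht)) (Set.mem_ofPred_eq ▸ hlt)
      gcongr
    · refine (not_lt.1 n3).trans ?_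
      gcongr
    · refine (not_lt.1 n4).trans ?_
      gcongr
    · refine (not_lt.1 n5).trans ?_
      gcongr
    · refine (not_lt.1 n6).trans (add_le_add le_rfl ?_)
      gcongr
  rw [mul_one] at h3 h4 h5 h6
  calc _ ≤ μ (B1 ∪ B2 ∪ B3 ∪ B4 ∪ B5 ∪ B6) := measure_mono hsub
    _ ≤ μ B1 + μ B2 + μ B3 + μ B4 + μ B5 + μ B6 := by
        refine (measure_union_le _ _).trans (add_le_add_left ?_ _)
        refine (measure_union_le _ _).trans (add_le_add_left ?_ _)
        refine (measure_union_le _ _).trans (add_le_add_left ?_ _)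
        refine (measure_union_le _ _).trans (add_le_add_left ?_ _)
        exact measure_union_le _ _
    _ ≤ ENNReal.ofReal (δ / 8) + ENNReal.ofReal (δ / 8) + ENNReal.ofReal (δ / 8) +
          ENNReal.ofReal (δ / 8) + ENNReal.ofReal (δ / 8) + ENNReal.ofReal (δ / 8) := by
        gcongr
    _ = _ := by
        have : 0 ≤ δ / 8 := by positivity
        rw [← ENNReal.ofReal_add this this, ← ENNReal.ofReal_add (by positivity) this,
          ← ENNReal.ofReal_add (by positivity) this, ← ENNReal.ofReal_add (by positivity) this,
          ← ENNReal.ofReal_add (by positivity) this]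
        congr 1; ring

end Valid
end Run

end AdaptiveLQR

namespace AdaptiveLQR
open scoped Topology

/-! ### The regret on the typical event -/

/-- Multiplying by powers of `G / l ≥ 1` and `G ≥ 1` brings every error term to the common factor
`Γ⁹ / λ⁴`. -/
lemma pow_div_pow_le_pow_div_pow {G l : ℝ} (hl : 0 < l) (hlG : l ≤ G) (hG : 1 ≤ G) {a b A B : ℕ}
    (hb : b ≤ B) (hab : a + (B - b) ≤ A) : G ^ a / l ^ b ≤ G ^ A / l ^ B := by
  rw [div_le_div_iff₀ (by positivity) (by positivity)]
  have hG0 : 0 < G := hl.trans_le hlG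
  calc G ^ a * l ^ B = G ^ a * (l ^ (B - b) * l ^ b) := by rw [← pow_add, Nat.sub_add_cancel hb]
    _ ≤ G ^ a * (G ^ (B - b) * l ^ b) := by gcongr
    _ = G ^ (a + (B - b)) * l ^ b := by rw [pow_add]; ring
    _ ≤ G ^ A * l ^ b := by gcongr

lemma sum_range_le_mul {N : ℕ} {f : ℕ → ℝ} {c : ℝ} (hf : ∀ t < N, f t ≤ c) :
    ∑ t ∈ Finset.range N, f t ≤ N * c := by
  refine (Finset.sum_le_sum fun t ht => hf t (Finset.mem_range.1 ht)).trans (le_of_eq ?_)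
  rw [Finset.sum_const, Finset.card_range, nsmul_eq_mul]

namespace Run.Valid

variable {n d : ℕ} {Ω : Type*} {r : Run n d Ω} [m0 : MeasurableSpace Ω] {μ : Measure Ω} [NeZero n]
  (h : r.Valid μ)
include h

/-- All fluctuations and epoch jumps are collected in the last term. The sum over time is the drift:
excess values of inaccurate controllers and the price of exploration. -/
lemma regret_le_of_typical {T : ℕ} {ω : Ω} {ℓ : ℝ} (hℓ : 0 ≤ ℓ) (hω : ω ∈ r.good (r.ep T))
    (htyp : r.Typical (T + 1) ℓ ω) (hep : (r.ep T : ℝ) ≤ 2 * √((T + 1 : ℕ) : ℝ)) :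
    regret r.sys r.Est r.Tmult r.K0 (fun t => r.w t ω) (fun t => r.η t ω) T ≤
      Jstar r.sys +
        ∑ t ∈ Finset.range (T + 1), (8 * r.Γ ^ 2 * r.sys.σw ^ 2 * (r.P t ω).trace +
          2 * sigEta r.sys r.α (r.ep t) ^ 2 * r.M.trace) +
        10000 * (n * √((T + 1 : ℕ) : ℝ) * r.sys.σw ^ 2 * (1 + ℓ)) * (r.Γ ^ 9 / r.lam ^ 4) := by
  have hn : (0 : ℝ) < n := by exact_mod_cast Nat.pos_of_ne_zero (NeZero.ne n)
  have hn1 : (1 : ℝ) ≤ n := by exact_mod_cast Nat.pos_of_ne_zero (NeZero.ne n)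
  have hσ := h.prob.sig_pos
  have hl := h.prob.lam_pos
  have hΓ := h.prob.Gam_pos
  have hΓ1 := h.prob.one_lt_Gam.le
  have hlΓ := h.prob.lam_lt_Gam.le
  set G := r.Γ with hG
  set l := r.lam with hldef
  set σ := r.sys.σw with hσdef
  set N := T + 1 with hN
  set q := √(N : ℝ) with hq
  have hN0 : (0 : ℝ) < N := by exact_mod_cast Nat.succ_pos T
  have hq0 : 0 < q := Real.sqrt_pos.2 hN0
  have hq2 : q ^ 2 = N := Real.sq_sqrt hN0.le
  set U := n * q * σ ^ 2 * (1 + ℓ) with hU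
  have hU0 : 0 < U := by positivity
  set Z := σ ^ 2 * n * (2 + 4 * ℓ) with hZ
  have hZ0 : 0 < Z := by positivity
  have hZU : q * Z ≤ 4 * U := by
    rw [hZ, hU]
    have : 0 < σ ^ 2 * n * q := by positivity
    nlinarith
  have hdom : ∀ {a b : ℕ}, b ≤ 4 → a + (4 - b) ≤ 9 → G ^ a / l ^ b ≤ G ^ 9 / l ^ 4 := fun hb hab =>
    pow_div_pow_le_pow_div_pow hl hlΓ hΓ1 hb hab
  have hgood : ∀ t ≤ T, ω ∈ r.good (r.ep t) := fun t ht => r.good_anti (r.ep_mono ht) hω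
  -- the state is bounded
  have hξ : ∀ t ≤ T, (r.sys.B *ᵥ r.η t ω + r.w t ω) ⬝ᵥ (r.sys.B *ᵥ r.η t ω + r.w t ω) ≤
      4 * G ^ 2 * Z := fun t ht => by
    have h1 := quad_add_le (M := (1 : Matrix (Fin n) (Fin n) ℝ)) Matrix.transpose_one
      (fun x => by rw [quad_one]; exact dot_self_nonneg x) (r.sys.B *ᵥ r.η t ω) (r.w t ω)
    simp only [quad_one] at h1
    have h2 := htyp.w_le t (Nat.lt_succ_of_le ht)
    have h3 : (r.sys.B *ᵥ r.η t ω) ⬝ᵥ (r.sys.B *ᵥ r.η t ω) ≤ G ^ 2 * Z := by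
      refine (mulVec_dot_self_le _ _).trans (mul_le_mul ?_ (htyp.η_le t (Nat.lt_succ_of_le ht))
        (dot_self_nonneg _) (sq_nonneg _))
      exact pow_le_pow_left₀ (norm_nonneg _) r.norm_B_le 2
    have h4 : Z ≤ G ^ 2 * Z := le_mul_of_one_le_left hZ0.le (one_le_pow₀ hΓ1)
    linarith
  set m := 64 * (G ^ 5 / l ^ 2) * Z with hm
  have hX : ∀ t ≤ T, quad (r.W (r.ep t)) (r.X t ω) ≤ m := fun t ht => by
    refine (h.quad_X_le hω hξ ht).trans (le_of_eq ?_)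
    rw [hm]; ring
  have hreg := h.regret_le hX hω
  -- The number of epochs is at most `2 √N`, so even paying `m` at every change stays of order `√N`.
  have htel : 2 * (r.ep T * m) ≤ 1024 * (G ^ 5 / l ^ 2) * U := by
    calc _ ≤ 2 * (2 * q * m) := by gcongr
      _ = 256 * (G ^ 5 / l ^ 2) * (q * Z) := by rw [hm]; ring
      _ ≤ 256 * (G ^ 5 / l ^ 2) * (4 * U) := by gcongr
      _ = _ := by ring
  have hℓU : ℓ * σ ^ 2 * q ≤ U := by
    rw [hU]
    have : 0 < σ ^ 2 * q := by positivity
    calc _ = 1 * (σ ^ 2 * q) * ℓ := by ring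
      _ ≤ n * (σ ^ 2 * q) * (1 + ℓ) := by gcongr; linarith
      _ = _ := by ring
  have hW : ∑ t ∈ Finset.range N, r.coefW t ω ⬝ᵥ r.w t ω ≤ 6177 * (G ^ 3 / l) * U := by
    have h1 : ∑ t ∈ Finset.range N, r.coefW t ω ⬝ᵥ r.coefW t ω ≤
        N * (3088 * (G ^ 6 / l ^ 2) * Z) := by
      refine sum_range_le_mul fun t ht => ?_
      have ht' := Nat.lt_succ_iff.1 ht
      refine (h.coefW_dot_le (hgood t ht')).trans ?_
      have i1 := hX t ht'
      have i2 := htyp.η_le t ht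
      have i3 : G ^ 4 ≤ G ^ 6 / l ^ 2 := by
        simpa using pow_div_pow_le_pow_div_pow hl hlΓ hΓ1 (Nat.zero_le 2) (a := 4) (A := 6) le_rfl
      calc _ ≤ 48 * G * m + 16 * G ^ 4 * Z := by gcongr
        _ ≤ 48 * G * m + 16 * (G ^ 6 / l ^ 2) * Z := by gcongr
        _ = _ := by rw [hm]; ring
    calc _ ≤ l / (σ ^ 2 * G ^ 3 * q) * σ ^ 2 / 2 * (N * (3088 * (G ^ 6 / l ^ 2) * Z)) +
          ℓ / (l / (σ ^ 2 * G ^ 3 * q)) := by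
          refine htyp.sum_coefW.trans (add_le_add_left ?_ _)
          gcongr
      _ = (G ^ 3 / l) * (1544 * (q * Z) + ℓ * σ ^ 2 * q) := by
          rw [← hq2]; field_simp; ring
      _ ≤ (G ^ 3 / l) * (1544 * (4 * U) + U) := by gcongr
      _ = _ := by ring
  have hE : ∑ t ∈ Finset.range N, r.coefη t ω ⬝ᵥ r.η t ω ≤ 2049 * (G ^ 4 / l) * U := by
    have h1 : ∑ t ∈ Finset.range N, r.coefη t ω ⬝ᵥ r.coefη t ω ≤
        N * (1024 * (G ^ 8 / l ^ 2) * Z) := by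
      refine sum_range_le_mul fun t ht => ?_
      have ht' := Nat.lt_succ_iff.1 ht
      refine (h.coefη_dot_le (hgood t ht')).trans ?_
      have i1 := hX t ht'
      calc _ ≤ 16 * G ^ 3 * m := by gcongr
        _ = _ := by rw [hm]; ring
    calc _ ≤ l / (σ ^ 2 * G ^ 4 * q) * σ ^ 2 / 2 * (N * (1024 * (G ^ 8 / l ^ 2) * Z)) +
          ℓ / (l / (σ ^ 2 * G ^ 4 * q)) := by
          refine htyp.sum_coefη.trans (add_le_add_left ?_ _)
          gcongr
      _ = (G ^ 4 / l) * (512 * (q * Z) + ℓ * σ ^ 2 * q) := by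
          rw [← hq2]; field_simp; ring
      _ ≤ (G ^ 4 / l) * (512 * (4 * U) + U) := by gcongr
      _ = _ := by ring
  have hQW : σ ^ 2 * (5 * n * G) * q * (1 + 4 * ℓ) ≤ 20 * G * U := by
    calc _ = 5 * G * (n * q * σ ^ 2 * (1 + 4 * ℓ)) := by ring
      _ ≤ 5 * G * (n * q * σ ^ 2 * (4 * (1 + ℓ))) := by gcongr; linarith
      _ = _ := by rw [hU]; ring
  have hQE : σ ^ 2 * (6 * n * G ^ 3) * q * (1 + 4 * ℓ) ≤ 24 * G ^ 3 * U := by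
    calc _ = 6 * G ^ 3 * (n * q * σ ^ 2 * (1 + 4 * ℓ)) := by ring
      _ ≤ 6 * G ^ 3 * (n * q * σ ^ 2 * (4 * (1 + ℓ))) := by gcongr; linarith
      _ = _ := by rw [hU]; ring
  -- The mean of the form `V⋆` in the process noise cancels the subtracted `J⋆` exactly. The two
  -- traces of `P`, one of them conjugated by `B`, contribute `4 Γ² σ²` each.
  have htr : ∑ t ∈ Finset.range N, σ ^ 2 * (r.quadW t ω).trace +
      ∑ t ∈ Finset.range N, sigEta r.sys r.α (r.ep t) ^ 2 * (r.quadη t ω).trace ≤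
      (T + 1) * (σ ^ 2 * r.Vs.trace) +
      ∑ t ∈ Finset.range N, (8 * G ^ 2 * σ ^ 2 * (r.P t ω).trace +
          2 * sigEta r.sys r.α (r.ep t) ^ 2 * r.M.trace) := by
    have e1 : (T + 1) * (σ ^ 2 * r.Vs.trace) = ∑ t ∈ Finset.range N, σ ^ 2 * r.Vs.trace := by
      rw [Finset.sum_const, Finset.card_range, nsmul_eq_mul, hN]; push_cast; ring
    rw [e1, ← Finset.sum_add_distrib, ← Finset.sum_add_distrib]
    refine Finset.sum_le_sum fun t _ => ?_
    have h1 := h.trace_P_nonneg t ω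
    have h2 := h.trace_conj_P_le t ω
    have h3 := h.sigEta_sq_le (r.ep t)
    have h4 : sigEta r.sys r.α (r.ep t) ^ 2 * (r.sys.Bᵀ * r.P t ω * r.sys.B).trace ≤
        σ ^ 2 * (G ^ 2 * (r.P t ω).trace) := by
      refine mul_le_mul h3 h2 ?_ (sq_nonneg _)
      exact trace_nonneg_of_quad fun x =>
        quad_nonneg_of_posSemidef (posSemidef_conj (h.P_posSemidef t ω) _) x
    have h5 : σ ^ 2 * (r.P t ω).trace ≤ σ ^ 2 * (G ^ 2 * (r.P t ω).trace) := by
      gcongr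
      exact le_mul_of_one_le_left h1 (one_le_pow₀ hΓ1)
    rw [quadW, quadη, Matrix.trace_add, Matrix.trace_add, Matrix.trace_smul, Matrix.trace_smul,
      Matrix.trace_smul, smul_eq_mul, smul_eq_mul, smul_eq_mul]
    linarith
  have d1 := mul_le_mul_of_nonneg_right (hdom (a := 5) (b := 2) (by norm_num) (by norm_num)) hU0.le
  have d2 := mul_le_mul_of_nonneg_right (hdom (a := 3) (b := 1) (by norm_num) (by norm_num)) hU0.le
  have d3 := mul_le_mul_of_nonneg_right (hdom (a := 4) (b := 1) (by norm_num) (by norm_num)) hU0.le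
  have d4 := mul_le_mul_of_nonneg_right (hdom (a := 1) (b := 0) (by norm_num) (by norm_num)) hU0.le
  have d5 := mul_le_mul_of_nonneg_right (hdom (a := 3) (b := 0) (by norm_num) (by norm_num)) hU0.le
  simp only [pow_one, pow_zero, div_one] at d2 d3 d4 d5
  have d6 : 0 < G ^ 9 / l ^ 4 * U := by positivity
  have s1 := htyp.sum_quadW
  have s2 := htyp.sum_quadη
  linarith

end Run.Valid

end AdaptiveLQR

namespace AdaptiveLQR
open scoped Topology

/-! ### Summation over the epochs -/

section Sums

/-- The growth ratio is `2 · 2^(-1/(1+α))`, at least `√2` because `α ≥ 1`. Any ratio `4/3` or larger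
makes the geometric sum at most four times its last term, uniformly in `α`. -/
lemma four_thirds_mul_growth_le {α : ℝ} (hα : 1 ≤ α) (i : ℕ) :
    4 / 3 * (2 ^ i * decay α i) ≤ 2 ^ (i + 1) * decay α (i + 1) := by
  have h1 : decay α (i + 1) = decay α i * (1 / 2 : ℝ) ^ (1 / (1 + α)) := by
    rw [decay, decay, ← Real.mul_rpow (by positivity) (by positivity)]
    congr 1; rw [pow_succ]; field_simp
  have h2 : (2 / 3 : ℝ) ≤ (1 / 2 : ℝ) ^ (1 / (1 + α)) := by
    calc (2 / 3 : ℝ) ≤ √(1 / 2) := Real.le_sqrt_of_sq_le (by norm_num)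
      _ = (1 / 2 : ℝ) ^ (1 / 2 : ℝ) := Real.sqrt_eq_rpow _
      _ ≤ _ := by
          refine Real.rpow_le_rpow_of_exponent_ge (by norm_num) (by norm_num) ?_
          rw [div_le_div_iff₀ (by linarith) (by norm_num)]; linarith
  have h3 := decay_pos α i
  rw [h1, pow_succ]
  have h4 : 0 < 2 ^ i * decay α i := by positivity
  nlinarith

lemma sum_growth_le {α : ℝ} (hα : 1 ≤ α) (e : ℕ) :
    ∑ i ∈ Finset.range (e + 1), 2 ^ i * decay α i ≤ 4 * (2 ^ e * decay α e) := by
  induction e with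
  | zero => have := decay_pos α 0; simp; linarith
  | succ e ih =>
    rw [Finset.sum_range_succ]
    have := four_thirds_mul_growth_le hα e
    linarith

lemma growth_eq {α : ℝ} (hα : 1 ≤ α) (e : ℕ) :
    2 ^ e * decay α e = ((2 : ℝ) ^ e) ^ (α / (α + 1)) := by
  have h : (0 : ℝ) < 2 ^ e := by positivity
  rw [decay, one_div, Real.inv_rpow h.le, ← Real.rpow_neg h.le]
  nth_rewrite 1 [← Real.rpow_one ((2 : ℝ) ^ e)]
  rw [← Real.rpow_add h]
  congr 1
  field_simp; ring

variable {Tmult : ℕ}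

lemma two_pow_epochOf_le (hT : 0 < Tmult) (T : ℕ) :
    Tmult * (2 ^ epochOf Tmult T - 1) ≤ T := epochStart_epochOf_le hT T

/-- Once an epoch has been completed, `2^e ≤ 2 (T + 1) / Tmult`. The unshifted sum serves the
estimation errors, since epoch `i + 1` runs with the accuracy of epoch `i`; the shifted one serves
the exploration. -/
lemma sum_growth_epochOf_le (hT : 0 < Tmult) {α : ℝ} (hα : 1 ≤ α) (T : ℕ) :
    ∑ i ∈ Finset.range (epochOf Tmult T), 2 ^ i * decay α i ≤
        8 * (((T : ℝ) + 1) / Tmult) ^ (α / (α + 1)) ∧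
      ∑ i ∈ Finset.range (epochOf Tmult T), 2 ^ (i + 1) * decay α (i + 1) ≤
        8 * (((T : ℝ) + 1) / Tmult) ^ (α / (α + 1)) := by
  have hT0 : (0 : ℝ) < Tmult := by exact_mod_cast hT
  have hR : 0 ≤ (((T : ℝ) + 1) / Tmult) ^ (α / (α + 1)) := by positivity
  have hg : ∀ i, 0 ≤ 2 ^ i * decay α i := fun i => by have := decay_pos α i; positivity
  set e := epochOf Tmult T with he
  rcases Nat.eq_zero_or_pos e with h0 | hpos
  · rw [h0]; simp only [Finset.range_zero, Finset.sum_empty]; exact ⟨by positivity, by positivity⟩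
  have h1 : (2 : ℝ) ^ e ≤ 2 * (((T : ℝ) + 1) / Tmult) := by
    rw [mul_div_assoc', le_div_iff₀ hT0]
    have h2 := two_pow_epochOf_le hT T
    rw [← he] at h2
    have h3 : 2 ≤ 2 ^ e := by
      calc 2 = 2 ^ 1 := rfl
        _ ≤ 2 ^ e := Nat.pow_le_pow_right two_pos hpos
    have h4 : 2 ^ e * Tmult ≤ 2 * (Tmult * (2 ^ e - 1)) := by
      rw [mul_comm (2 ^ e), mul_left_comm]
      exact Nat.mul_le_mul_left _ (by omega)
    have h5 : ((2 ^ e * Tmult : ℕ) : ℝ) ≤ ((2 * T : ℕ) : ℝ) := by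
      exact_mod_cast h4.trans (Nat.mul_le_mul_left 2 h2)
    push_cast at h5
    linarith
  have ha : 0 ≤ α / (α + 1) := by positivity
  have h6 : 2 ^ e * decay α e ≤ 2 * (((T : ℝ) + 1) / Tmult) ^ (α / (α + 1)) := by
    rw [growth_eq hα]
    refine (Real.rpow_le_rpow (by positivity) h1 ha).trans ?_
    rw [Real.mul_rpow (by norm_num) (by positivity)]
    gcongr
    calc (2 : ℝ) ^ (α / (α + 1)) ≤ 2 ^ (1 : ℝ) := by
          refine Real.rpow_le_rpow_of_exponent_le (by norm_num) ?_
          rw [div_le_one (by linarith)]; linarith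
      _ = 2 := Real.rpow_one 2
  have h7 := sum_growth_le hα e
  constructor
  · rw [Finset.sum_range_succ] at h7
    linarith [hg e]
  · rw [Finset.sum_range_succ'] at h7
    linarith [hg 0]

/-- Lets the single leftover `J⋆` be absorbed by the exploration term. -/
lemma one_le_mul_rpow (hT : 0 < Tmult) {α : ℝ} (hα : 1 ≤ α) (T : ℕ) :
    1 ≤ (Tmult : ℝ) * (((T : ℝ) + 1) / Tmult) ^ (α / (α + 1)) := by
  have hT1 : (1 : ℝ) ≤ Tmult := by exact_mod_cast hT
  have hT0 : (0 : ℝ) < Tmult := by linarith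
  have ha : 0 ≤ α / (α + 1) := by positivity
  have ha1 : α / (α + 1) ≤ 1 := by rw [div_le_one (by linarith)]; linarith
  rw [Real.div_rpow (by positivity) hT0.le, mul_div_assoc', le_div_iff₀ (by positivity), one_mul]
  calc (Tmult : ℝ) ^ (α / (α + 1)) ≤ (Tmult : ℝ) ^ (1 : ℝ) :=
        Real.rpow_le_rpow_of_exponent_le hT1 ha1
    _ = Tmult * 1 := by rw [Real.rpow_one, mul_one]
    _ ≤ Tmult * ((T : ℝ) + 1) ^ (α / (α + 1)) := by
        gcongr
        exact Real.one_le_rpow (by linarith [(Nat.cast_nonneg T : (0 : ℝ) ≤ T)]) ha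

lemma epochOf_le_two_mul_sqrt (hT : 0 < Tmult) (T : ℕ) :
    (epochOf Tmult T : ℝ) ≤ 2 * √((T + 1 : ℕ) : ℝ) := by
  have h1 : ∀ e : ℕ, e ^ 2 + 2 * e + 3 ≤ 4 * 2 ^ e := fun e => by
    induction e with
    | zero => norm_num
    | succ e ih => rw [pow_succ 2 e]; nlinarith
  set e := epochOf Tmult T with he
  have h2 : 2 ^ e ≤ T + 1 := by
    have := two_pow_epochOf_le hT T
    rw [← he] at this
    have := (Nat.le_mul_of_pos_left (2 ^ e - 1) hT).trans this
    omega
  have h3 : ((e ^ 2 : ℕ) : ℝ) ≤ ((4 * (T + 1) : ℕ) : ℝ) := by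
    have := h1 e
    exact_mod_cast (by omega : e ^ 2 ≤ 4 * (T + 1))
  refine abs_le_of_sq_le_sq' ?_ (by positivity) |>.2
  rw [mul_pow, Real.sq_sqrt (Nat.cast_nonneg _)]
  push_cast at h3 ⊢
  linarith

variable {n d : ℕ} {sys : System n d}

/-- For a completed epoch both `T_i` and `2^i` are at most `T`, and so is `E`; every logarithm
except that of `1 / σw^α` is therefore a multiple of `log (T / δ)` plus a constant. -/
lemma logTerm_le_of_lt (hσ : 0 < sys.σw) {α c : ℝ} (hα : 1 ≤ α) (hc : 0 ≤ c) (hT : 0 < Tmult)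
    (p : ℕ) {T E i : ℕ} {δ : ℝ} (hδ : 0 < δ) (hδ1 : δ < 1) (hE : 1 ≤ E) (hET : E ≤ T)
    (hi : i < epochOf Tmult T) :
    logTerm sys Tmult α c p (1 / (δ / (4 * E))) i ≤
      c * 5 ^ p * (1 + (Real.posLog (T / δ) + Real.posLog (1 / sys.σw ^ α))) ^ p := by
  have hE0 : (0 : ℝ) < E := by exact_mod_cast hE
  have hT1 : (1 : ℝ) ≤ T := by exact_mod_cast hE.trans hET
  refine (logTerm_le hσ (by linarith) hc hT i).trans ?_
  have h2 : 2 ^ i ≤ 2 ^ epochOf Tmult T - 1 := by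
    have : 2 ^ (i + 1) ≤ 2 ^ epochOf Tmult T := Nat.pow_le_pow_right two_pos hi
    rw [pow_succ] at this
    have : 1 ≤ 2 ^ i := Nat.one_le_two_pow
    omega
  have h3 : epochLen Tmult i ≤ T := (Nat.mul_le_mul_left _ h2).trans (two_pow_epochOf_le hT T)
  have h4 : 2 ^ i ≤ T := (Nat.le_mul_of_pos_left _ hT).trans h3
  have hTδ : (T : ℝ) ≤ T / δ := by rw [le_div_iff₀ hδ]; nlinarith
  have hlog : Real.posLog (T / δ) = Real.log (T / δ) := Real.posLog_eq_log (by
    rw [abs_of_nonneg (by positivity)]; linarith)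
  have h5 : Real.log (epochLen Tmult i) ≤ Real.posLog (T / δ) := by
    rw [hlog]
    refine Real.log_le_log (by exact_mod_cast epochLen_pos hT i) ?_
    exact le_trans (by exact_mod_cast h3) hTδ
  have h6 : (i : ℝ) ≤ 2 * Real.posLog (T / δ) := by
    have h7 : Real.log ((2 : ℝ) ^ i) ≤ Real.posLog (T / δ) := by
      rw [hlog]
      refine Real.log_le_log (by positivity) ?_
      exact le_trans (by exact_mod_cast h4) hTδ
    rw [Real.log_pow] at h7
    have := Real.log_two_gt_d9
    nlinarith [(Nat.cast_nonneg i : (0 : ℝ) ≤ i)]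
  have h8 : Real.posLog (1 / (δ / (4 * E))) ≤ 2 + Real.posLog (T / δ) := by
    have h9 : 1 / (δ / (4 * E)) ≤ 4 * (T / δ) := by
      rw [one_div_div, mul_div_assoc]
      have : (E : ℝ) ≤ T := by exact_mod_cast hET
      gcongr
    refine (Real.posLog_le_posLog (by positivity) h9).trans (Real.posLog_mul.trans ?_)
    have h10 : Real.posLog 4 ≤ 2 := by
      rw [Real.posLog_eq_log (by norm_num), show (4 : ℝ) = 2 ^ 2 by norm_num, Real.log_pow]
      have := Real.log_two_lt_d9
      push_cast; linarith
    linarith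
  have i1 := Real.posLog_nonneg (x := T / δ)
  have i2 := Real.posLog_nonneg (x := 1 / sys.σw ^ α)
  have i3 := Real.posLog_nonneg (x := 1 / (δ / (4 * E)))
  have i4 : 0 ≤ Real.log (epochLen Tmult i) := Real.log_nonneg
    (by exact_mod_cast epochLen_pos hT i)
  rw [mul_assoc, ← mul_pow]
  refine mul_le_mul_of_nonneg_left (pow_le_pow_left₀ (by positivity) ?_ p) hc
  linarith

end Sums

namespace Run.Valid

variable {n d : ℕ} {Ω : Type*} {r : Run n d Ω} [m0 : MeasurableSpace Ω] {μ : Measure Ω} [NeZero n]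
  (h : r.Valid μ)
include h

lemma trace_P_succ_le {t i : ℕ} {ω : Ω} (hω : ω ∈ r.good (r.ep t)) (hi : r.ep t = i + 1) :
    (r.P t ω).trace ≤ 2 * d * (r.Γ ^ 5 / r.lam ^ 2) * r.eps i ^ 2 := by
  have hΓ := h.prob.Gam_pos
  have hl := h.prob.lam_pos
  rw [P_of_good hω, hi]
  rw [hi] at hω
  refine (h.prob.trace_valueFn_sub_near_le (h.near hω)).trans ?_
  have := hω i (Nat.lt_succ_self i)
  gcongr

/-- Grouping by epochs. The initial epoch has no accuracy guarantee and is charged the crude trace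
bound, which gives the term proportional to `Tmult`. Later epochs are charged `ε²` of the preceding
one, and the epoch lengths cancel the denominator of `accuracy`. -/
lemma sum_trace_le {T : ℕ} {ω : Ω} (hα : 1 ≤ r.α) (hdn : d ≤ n) (hω : ω ∈ r.good (r.ep T))
    {a c D Q : ℝ} {p : ℕ} (ha : 0 ≤ a) (hc : 0 ≤ c)
    (heps : r.eps = accuracy r.sys r.Tmult r.α c p D a)
    (hQ : ∀ i < r.ep T, logTerm r.sys r.Tmult r.α c p D i ≤ Q) (hQ0 : 0 ≤ Q) :
    ∑ t ∈ Finset.range (T + 1), (8 * r.Γ ^ 2 * r.sys.σw ^ 2 * (r.P t ω).trace +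
        2 * sigEta r.sys r.α (r.ep t) ^ 2 * r.M.trace) ≤
      10 * r.Tmult * r.sys.σw ^ 2 * n * r.Γ ^ 3 +
      256 * (r.sys.σw ^ (2 * (1 - r.α)) * d * (r.Γ ^ 7 / r.lam ^ 2) * a *
        (((T : ℝ) + 1) / r.Tmult) ^ (r.α / (r.α + 1)) * Q) +
      32 * d * r.sys.σw ^ 2 * (r.Γ ^ 7 / r.lam ^ 2) * r.ep T +
      16 * r.Tmult * (r.Γ ^ 2 * Jstar r.sys + r.sys.σw ^ 2 * r.sys.R.trace) *
        (((T : ℝ) + 1) / r.Tmult) ^ (r.α / (r.α + 1)) := by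
  have hσ := h.prob.sig_pos
  have hl := h.prob.lam_pos
  have hΓ := h.prob.Gam_pos
  have hT0 : (0 : ℝ) < r.Tmult := by exact_mod_cast h.Tmult_pos
  set G := r.Γ
  set l := r.lam
  set σ := r.sys.σw
  set R := (((T : ℝ) + 1) / r.Tmult) ^ (r.α / (r.α + 1)) with hR
  have hR0 : 0 ≤ R := by positivity
  have hM0 : 0 ≤ r.M.trace := trace_nonneg_of_quad (quad_nonneg_of_posDef h.M_posDef)
  have hJ := h.Jstar_eq
  have hV0 : 0 ≤ (r.Vs).trace := trace_nonneg_of_quad (quad_nonneg_of_posSemidef h.Vs_posSemidef)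
  have hMtr : σ ^ 2 * r.M.trace ≤ G ^ 2 * Jstar r.sys + σ ^ 2 * r.sys.R.trace := by
    have h1 := trace_conj_le_trace h.Vs_posSemidef r.sys.B
    have h2 : ‖r.sys.B‖ ^ 2 * (r.Vs).trace ≤ G ^ 2 * (r.Vs).trace :=
      mul_le_mul_of_nonneg_right (pow_le_pow_left₀ (norm_nonneg _) r.norm_B_le 2) hV0
    have h3 := mul_le_mul_of_nonneg_left (h1.trans h2) (sq_nonneg σ)
    rw [hJ, M, inputWeight, Matrix.trace_add]
    linarith
  set f : ℕ → ℝ := fun i => 8 * G ^ 2 * σ ^ 2 *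
      (if i = 0 then n * G else 2 * d * (G ^ 5 / l ^ 2) * r.eps (i - 1) ^ 2) +
      2 * (σ ^ 2 * decay r.α i) * r.M.trace with hf
  have hf0 : ∀ i, 0 ≤ f i := fun i => by
    have := decay_pos r.α i
    simp only [hf]; split_ifs <;> positivity
  have h1 : ∑ t ∈ Finset.range (T + 1), (8 * G ^ 2 * σ ^ 2 * (r.P t ω).trace +
        2 * sigEta r.sys r.α (r.ep t) ^ 2 * r.M.trace) ≤
      ∑ i ∈ Finset.range (r.ep T + 1), epochLen r.Tmult i * f i := by
    refine le_trans (Finset.sum_le_sum fun t ht => ?_) (sum_epochOf_le h.Tmult_pos hf0 T)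
    have hωt := r.good_anti (r.ep_mono (Nat.lt_succ_iff.1 (Finset.mem_range.1 ht))) hω
    change _ ≤ f (r.ep t)
    simp only [hf, AdaptiveLQR.sigEta_sq]
    gcongr
    split_ifs with h0
    · exact h.trace_P_le t ω
    · exact h.trace_P_succ_le hωt (Nat.succ_pred_eq_of_ne_zero h0).symm
  refine h1.trans ?_
  rw [Finset.sum_range_succ']
  have h2 : (epochLen r.Tmult 0 : ℝ) * f 0 ≤ 10 * r.Tmult * σ ^ 2 * n * G ^ 3 := by
    have e1 : decay r.α 0 = 1 := by simp [decay]
    simp only [hf, if_true, e1, epochLen, pow_zero, mul_one]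
    have := h.trace_M_le hdn
    calc _ ≤ (r.Tmult : ℝ) * (8 * G ^ 2 * σ ^ 2 * (n * G) + 2 * σ ^ 2 * (n * G ^ 3)) := by gcongr
      _ = _ := by ring
  -- Epoch `i + 1` is twice as long as epoch `i`, whose data fixed `ε_i`; hence `T_{i+1} ε_i² = 2
  -- T_i ε_i²`. The summand `1` is the `+ 1` in `accuracy` and adds up to the number of epochs.
  have h3 : ∀ i, (epochLen r.Tmult (i + 1) : ℝ) * f (i + 1) =
      32 * d * σ ^ 2 * (G ^ 7 / l ^ 2) *
        (a / σ ^ (2 * r.α) * (2 ^ i * decay r.α i) * logTerm r.sys r.Tmult r.α c p D i + 1) +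
      2 * (σ ^ 2 * r.M.trace) * r.Tmult * (2 ^ (i + 1) * decay r.α (i + 1)) := fun i => by
    have e1 : (epochLen r.Tmult i : ℝ) * r.eps i ^ 2 =
        a / σ ^ (2 * r.α) * (2 ^ i * decay r.α i) * logTerm r.sys r.Tmult r.α c p D i + 1 := by
      have h5 : (0 : ℝ) < epochLen r.Tmult i := by exact_mod_cast epochLen_pos h.Tmult_pos i
      rw [heps, accuracy_sq hσ hc ha, mul_div_cancel₀ _ h5.ne', div_eq_mul_one_div a,
        one_div_sigEta_rpow hσ (by linarith)]
      ring
    have e2 : (epochLen r.Tmult (i + 1) : ℝ) = 2 * epochLen r.Tmult i := by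
      simp only [epochLen, pow_succ]; push_cast; ring
    have e3 : (epochLen r.Tmult (i + 1) : ℝ) = r.Tmult * 2 ^ (i + 1) := by
      simp only [epochLen]; push_cast; ring
    rw [← e1]
    simp only [hf, if_neg (Nat.succ_ne_zero i), Nat.add_sub_cancel]
    rw [mul_add]
    congr 1
    · rw [e2]; ring
    · rw [e3]; ring
  obtain ⟨g1, g2⟩ := sum_growth_epochOf_le h.Tmult_pos hα T
  change ∑ i ∈ Finset.range (r.ep T), _ ≤ 8 * R at g1
  change ∑ i ∈ Finset.range (r.ep T), _ ≤ 8 * R at g2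
  have h4 : ∑ i ∈ Finset.range (r.ep T), (a / σ ^ (2 * r.α) * (2 ^ i * decay r.α i) *
      logTerm r.sys r.Tmult r.α c p D i + 1) ≤ a / σ ^ (2 * r.α) * (8 * R) * Q + r.ep T := by
    rw [Finset.sum_add_distrib]
    have e1 : ∑ i ∈ Finset.range (r.ep T), (1 : ℝ) = r.ep T := by simp
    rw [e1]
    refine add_le_add_left ?_ _
    calc _ ≤ ∑ i ∈ Finset.range (r.ep T), a / σ ^ (2 * r.α) * Q * (2 ^ i * decay r.α i) := by
          refine Finset.sum_le_sum fun i hi => ?_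
          have := decay_pos r.α i
          calc _ ≤ a / σ ^ (2 * r.α) * (2 ^ i * decay r.α i) * Q := by
                gcongr; exact hQ i (Finset.mem_range.1 hi)
            _ = _ := by ring
      _ = a / σ ^ (2 * r.α) * Q * ∑ i ∈ Finset.range (r.ep T), 2 ^ i * decay r.α i := by
          rw [Finset.mul_sum]
      _ ≤ a / σ ^ (2 * r.α) * Q * (8 * R) := by gcongr
      _ = _ := by ring
  have h5 : ∑ i ∈ Finset.range (r.ep T), (epochLen r.Tmult (i + 1) : ℝ) * f (i + 1) ≤
      32 * d * σ ^ 2 * (G ^ 7 / l ^ 2) * (a / σ ^ (2 * r.α) * (8 * R) * Q + r.ep T) +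
      2 * (G ^ 2 * Jstar r.sys + σ ^ 2 * r.sys.R.trace) * r.Tmult * (8 * R) := by
    simp only [h3]
    rw [Finset.sum_add_distrib, ← Finset.mul_sum, ← Finset.mul_sum]
    have hMn : 0 ≤ σ ^ 2 * r.M.trace := by positivity
    have hsum0 : 0 ≤ ∑ i ∈ Finset.range (r.ep T), 2 ^ (i + 1) * decay r.α (i + 1) :=
      Finset.sum_nonneg fun i _ => by have := decay_pos r.α (i + 1); positivity
    refine add_le_add (mul_le_mul_of_nonneg_left h4 (by positivity)) ?_
    refine mul_le_mul ?_ g2 hsum0 ?_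
    · gcongr
    · have := hMn.trans hMtr; positivity
  have h6 : σ ^ (2 * (1 - r.α)) = σ ^ 2 / σ ^ (2 * r.α) := by
    rw [mul_sub, mul_one, Real.rpow_sub hσ, Real.rpow_two]
  calc _ ≤ (32 * d * σ ^ 2 * (G ^ 7 / l ^ 2) * (a / σ ^ (2 * r.α) * (8 * R) * Q + r.ep T) +
      2 * (G ^ 2 * Jstar r.sys + σ ^ 2 * r.sys.R.trace) * r.Tmult * (8 * R)) +
      10 * r.Tmult * σ ^ 2 * n * G ^ 3 := add_le_add h5 h2
    _ = _ := by rw [h6]; ring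

end Run.Valid

end AdaptiveLQR

namespace AdaptiveLQR
open scoped Topology

/-! ### The regret bound -/

namespace Run.Valid

variable {n d : ℕ} {Ω : Type*} {r : Run n d Ω} [m0 : MeasurableSpace Ω] {μ : Measure Ω} [NeZero n]
  (h : r.Valid μ)
include h

lemma regret_bound {T E : ℕ} {ω : Ω} {δ a c C : ℝ} {p : ℕ} (hα : 1 ≤ r.α) (hdn : d ≤ n)
    (hδ : 0 < δ) (hδ1 : δ < 1) (hE : 1 ≤ E) (hET : E ≤ T)
    (hω : ω ∈ r.good (r.ep T)) (htyp : r.Typical (T + 1) (Real.log (8 * (T + 1 : ℕ) / δ)) ω)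
    (ha : 0 ≤ a) (hc : 0 ≤ c)
    (heps : r.eps = accuracy r.sys r.Tmult r.α c p (1 / (δ / (4 * E))) a)
    (hC : 256 * (c * 5 ^ p) + 90000 ≤ C) :
    regret r.sys r.Est r.Tmult r.K0 (fun t => r.w t ω) (fun t => r.η t ω) T ≤
      r.sys.σw ^ (2 * (1 - r.α)) * d * (r.Γ ^ 7 / r.lam ^ 2) * a *
        (((T : ℝ) + 1) / r.Tmult) ^ (r.α / (r.α + 1)) *
        polylog C (4 * p) [(T : ℝ) / δ, 1 / r.sys.σw ^ r.α] +
      C * r.Tmult * (r.Γ ^ 2 * Jstar r.sys + r.sys.σw ^ 2 * r.sys.R.trace) *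
        (((T : ℝ) + 1) / r.Tmult) ^ (r.α / (r.α + 1)) +
      C * (n : ℝ) ^ ((3 : ℝ) / 2) * √T * r.sys.σw ^ 2 * (r.Γ ^ 9 / r.lam ^ 4) *
        (1 + Real.log ((T : ℝ) / δ)) +
      C * r.Tmult * r.sys.σw ^ 2 * n * r.Γ ^ 3 := by
  have hn1 : (1 : ℝ) ≤ n := by exact_mod_cast Nat.pos_of_ne_zero (NeZero.ne n)
  have hσ := h.prob.sig_pos
  have hl := h.prob.lam_pos
  have hΓ := h.prob.Gam_pos
  have hΓ1 := h.prob.one_lt_Gam.le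
  have hlΓ := h.prob.lam_lt_Gam.le
  have hT0 : (0 : ℝ) < r.Tmult := by exact_mod_cast h.Tmult_pos
  have hT1 : (1 : ℝ) ≤ T := by exact_mod_cast hE.trans hET
  have hJ0 : 0 ≤ Jstar r.sys := ENNReal.toReal_nonneg
  have hc5 : 0 ≤ c * 5 ^ p := by positivity
  have hCpos : 0 ≤ C := by linarith
  have hTδ : 1 ≤ (T : ℝ) / δ := by rw [le_div_iff₀ hδ]; linarith
  have hlog0 : 0 ≤ Real.log ((T : ℝ) / δ) := Real.log_nonneg hTδ
  set ℓ := Real.log (8 * (T + 1 : ℕ) / δ) with hℓ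
  have hℓ0 : 0 ≤ ℓ := Real.log_nonneg (by rw [le_div_iff₀ hδ]; push_cast; linarith)
  have hℓ1 : 1 + ℓ ≤ 4 * (1 + Real.log ((T : ℝ) / δ)) := by
    have h1 : ℓ ≤ Real.log (16 * ((T : ℝ) / δ)) := by
      refine Real.log_le_log (by positivity) ?_
      rw [mul_div_assoc']
      refine div_le_div_of_nonneg_right ?_ hδ.le
      push_cast; linarith
    rw [Real.log_mul (by norm_num) (by positivity), show (16 : ℝ) = 2 ^ 4 by norm_num,
      Real.log_pow] at h1
    have := Real.log_two_lt_d9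
    push_cast at h1
    linarith
  have hq : √((T + 1 : ℕ) : ℝ) ≤ 2 * √T := by
    refine Real.sqrt_le_iff.2 ⟨by positivity, ?_⟩
    rw [mul_pow, Real.sq_sqrt (by positivity)]
    push_cast; linarith
  -- The argument yields the factor `n`; the claimed `n^(3/2)` is weaker.
  have hn32 : (n : ℝ) ≤ (n : ℝ) ^ ((3 : ℝ) / 2) := by
    calc (n : ℝ) = (n : ℝ) ^ (1 : ℝ) := (Real.rpow_one _).symm
      _ ≤ _ := Real.rpow_le_rpow_of_exponent_le hn1 (by norm_num)
  set R := (((T : ℝ) + 1) / r.Tmult) ^ (r.α / (r.α + 1)) with hR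
  have hR0 : 0 ≤ R := by positivity
  have hTR : 1 ≤ r.Tmult * R := one_le_mul_rpow h.Tmult_pos hα T
  set Λ := 1 + (Real.posLog ((T : ℝ) / δ) + Real.posLog (1 / r.sys.σw ^ r.α)) with hΛ
  have hΛ1 : 1 ≤ Λ := le_add_of_nonneg_right (add_nonneg Real.posLog_nonneg Real.posLog_nonneg)
  have hpoly : polylog C (4 * p) [(T : ℝ) / δ, 1 / r.sys.σw ^ r.α] = C * Λ ^ (4 * p) := by
    simp [polylog, hΛ]
  have hep := epochOf_le_two_mul_sqrt h.Tmult_pos T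
  have h1 := h.regret_le_of_typical hℓ0 hω htyp hep
  have h2 := h.sum_trace_le hα hdn hω ha hc heps (Q := c * 5 ^ p * Λ ^ p)
    (fun i hi => logTerm_le_of_lt hσ hα hc h.Tmult_pos p hδ hδ1 hE hET hi) (by positivity)
  have hM0 : 0 ≤ r.sys.R.trace := trace_nonneg_of_quad (quad_nonneg_of_posDef h.prob.posR)
  set B := r.Γ ^ 2 * Jstar r.sys + r.sys.σw ^ 2 * r.sys.R.trace with hB
  have hB0 : 0 ≤ B := by positivity
  have t1 : 256 * (r.sys.σw ^ (2 * (1 - r.α)) * d * (r.Γ ^ 7 / r.lam ^ 2) * a * R *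
      (c * 5 ^ p * Λ ^ p)) ≤ r.sys.σw ^ (2 * (1 - r.α)) * d * (r.Γ ^ 7 / r.lam ^ 2) * a * R *
        (C * Λ ^ (4 * p)) := by
    have hpow : Λ ^ p ≤ Λ ^ (4 * p) := pow_le_pow_right₀ hΛ1 (by omega)
    calc _ = r.sys.σw ^ (2 * (1 - r.α)) * d * (r.Γ ^ 7 / r.lam ^ 2) * a * R *
          (256 * (c * 5 ^ p) * Λ ^ p) := by ring
      _ ≤ _ := by gcongr; linarith
  have t2 : Jstar r.sys + 16 * r.Tmult * B * R ≤ C * r.Tmult * B * R := by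
    have e1 : Jstar r.sys ≤ B * (r.Tmult * R) := by
      calc Jstar r.sys ≤ r.Γ ^ 2 * Jstar r.sys := le_mul_of_one_le_left hJ0 (one_le_pow₀ hΓ1)
        _ ≤ B := le_add_of_nonneg_right (by positivity)
        _ ≤ _ := le_mul_of_one_le_right hB0 hTR
    have e2 : 17 * (B * (r.Tmult * R)) ≤ C * (B * (r.Tmult * R)) := by
      gcongr; linarith
    linarith
  set V := n * √T * r.sys.σw ^ 2 * (r.Γ ^ 9 / r.lam ^ 4) * (1 + Real.log ((T : ℝ) / δ)) with hV
  have hV0 : 0 ≤ V := by positivity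
  have t3 : 32 * d * r.sys.σw ^ 2 * (r.Γ ^ 7 / r.lam ^ 2) * r.ep T ≤ 128 * V := by
    have e1 : r.Γ ^ 7 / r.lam ^ 2 ≤ r.Γ ^ 9 / r.lam ^ 4 :=
      pow_div_pow_le_pow_div_pow hl hlΓ hΓ1 (by norm_num) (by norm_num)
    have e2 : (r.ep T : ℝ) ≤ 4 * √T := by
      have : (r.ep T : ℝ) ≤ 2 * √((T + 1 : ℕ) : ℝ) := hep
      linarith
    have e3 : (d : ℝ) ≤ n := by exact_mod_cast hdn
    calc _ ≤ 32 * n * r.sys.σw ^ 2 * (r.Γ ^ 9 / r.lam ^ 4) * (4 * √T) := by gcongr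
      _ = 128 * (n * √T * r.sys.σw ^ 2 * (r.Γ ^ 9 / r.lam ^ 4) * 1) := by ring
      _ ≤ 128 * V := by rw [hV]; gcongr; linarith
  -- The factor `8` is `2` from `√(T + 1) ≤ 2 √T` times `4` from comparing the logarithms.
  have t4 : 10000 * (n * √((T + 1 : ℕ) : ℝ) * r.sys.σw ^ 2 * (1 + ℓ)) * (r.Γ ^ 9 / r.lam ^ 4) ≤
      80000 * V := by
    calc _ ≤ 10000 * (n * (2 * √T) * r.sys.σw ^ 2 * (4 * (1 + Real.log ((T : ℝ) / δ)))) *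
          (r.Γ ^ 9 / r.lam ^ 4) := by gcongr
      _ = _ := by rw [hV]; ring
  have t5 : 80128 * V ≤ C * (n : ℝ) ^ ((3 : ℝ) / 2) * √T * r.sys.σw ^ 2 *
      (r.Γ ^ 9 / r.lam ^ 4) * (1 + Real.log ((T : ℝ) / δ)) := by
    calc _ ≤ C * V := by gcongr; linarith
      _ = C * n * √T * r.sys.σw ^ 2 * (r.Γ ^ 9 / r.lam ^ 4) * (1 + Real.log ((T : ℝ) / δ)) := by
          rw [hV]; ring
      _ ≤ _ := by gcongr
  have t6 : 10 * r.Tmult * r.sys.σw ^ 2 * n * r.Γ ^ 3 ≤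
      C * r.Tmult * r.sys.σw ^ 2 * n * r.Γ ^ 3 := by
    gcongr; linarith
  rw [hpoly]
  linarith

end Run.Valid

lemma le_of_pow_four_le {x y : ℝ} (hy : 0 ≤ y) (h : x ^ 4 ≤ y ^ 4) : x ≤ y :=
  le_of_pow_le_pow_left₀ four_ne_zero hy h

/-- The cube of `Γ⁸ / λ⁴` is the fourth power of `Γ⁶ / λ³`, so the power `M³` reproduces the
threshold in `Near`; for `C_req` the power `M²` would already do. -/
lemma accuracy_bounds {e M G l v : ℝ} (he0 : 0 < e) (hl : 0 < l) (hG : 0 < G) (hv : 0 < v)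
    (hM : M = max 1 (max (G ^ 8 / l ^ 4) (1 / v ^ 4))) (h : (16 * e ^ 2) ^ 4 ≤ 1 / M ^ 3) :
    e ^ 2 ≤ l ^ 3 / (16 * G ^ 6) ∧ e < v := by
  have hM1 : 1 ≤ M := hM ▸ le_max_left _ _
  have hMG : G ^ 8 / l ^ 4 ≤ M := hM ▸ (le_max_left _ _).trans (le_max_right _ _)
  have hMv : 1 / v ^ 4 ≤ M := hM ▸ (le_max_right _ _).trans (le_max_right _ _)
  have hM0 : 0 < M := by linarith
  constructor
  · have h1 : 16 * e ^ 2 ≤ l ^ 3 / G ^ 6 := by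
      refine le_of_pow_four_le (by positivity) (h.trans ?_)
      calc 1 / M ^ 3 ≤ 1 / (G ^ 8 / l ^ 4) ^ 3 := by gcongr
        _ = _ := by field_simp
    rw [le_div_iff₀ (by positivity)]
    rw [le_div_iff₀ (by positivity)] at h1
    linarith
  · have h1 : 16 * e ^ 2 ≤ v ^ 2 := by
      refine le_of_pow_four_le (by positivity) (h.trans ?_)
      calc 1 / M ^ 3 ≤ 1 / M ^ 2 :=
            one_div_le_one_div_of_le (by positivity) (pow_le_pow_right₀ hM1 (by norm_num))
        _ ≤ 1 / (1 / v ^ 4) ^ 2 := by gcongr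
        _ = _ := by field_simp
    nlinarith

/-- Allows the logarithm of the number of epochs to be absorbed into that of `T / δ`. -/
lemma lt_epochStart_of_lt {Tmult E T : ℕ} (hT : 0 < Tmult) (h : epochStart Tmult (E - 1) < T)
    (hE : 1 ≤ E) : E ≤ T := by
  have h1 : 2 ^ (E - 1) - 1 ≤ epochStart Tmult (E - 1) := Nat.le_mul_of_pos_left _ hT
  have h2 : E - 1 < 2 ^ (E - 1) := Nat.lt_two_pow_self
  omega

end AdaptiveLQR

open AdaptiveLQR in
theorem mainTheorem4 (c : ℝ) (hc : 0 < c) (p : ℕ) :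
    ∃ (C : ℝ) (k q : ℕ), 0 < C ∧
      ∀ (n d : ℕ) (_hd : 0 < d) (_hdn : d ≤ n) (sys : System n d)
        (_hS : sys.S.PosDef) (_hR : sys.R.PosDef) (_hσ : 0 < sys.σw)
        (K0 Kstar : Matrix (Fin d) (Fin n) ℝ)
        (_hK0 : Stabilizes sys K0) (_hKstar : IsOptimalController sys Kstar)
        (Est : Estimator n d) (_hEst : Est.IsMeasurable)
        (Ω : Type*) (_ : MeasurableSpace Ω) (μ : Measure Ω) (_ : IsProbabilityMeasure μ)
        (Tmult : ℕ) (α : ℝ) (w : ℕ → Ω → Fin n → ℝ) (η : ℕ → Ω → Fin d → ℝ)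
        (_hnoise : IsNoise sys μ Tmult α w η)
        (Creq : ℝ → ℝ) (Cerr : ℝ → ℝ → ℝ)
        (_hassume : EstimateKAssumption sys Est Tmult K0 Kstar μ w η Creq Cerr α c p)
        (δ : ℝ) (_hδ0 : 0 < δ) (_hδ1 : δ < 1) (E : ℕ) (_hE : 1 ≤ E)
        (T : ℕ) (_hTlow : epochStart Tmult (E - 1) < T) (_hThigh : T ≤ epochStart Tmult E)
        (_hTmult :
          max 1 (max (Gam sys K0 Kstar ^ 8 / lamMin sys.S ^ 4)
              (1 / Creq (Vmax sys K0 Kstar) ^ 4))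
            * max 1 (Cerr (Vmax sys K0 Kstar) (SigMax sys K0 Kstar) ^ 2 / sys.σw ^ (4 * α))
            * α ^ k * polylog C q [1 / sys.σw, (E : ℝ) / δ]
            ≤ (Tmult : ℝ)),
        1 - δ ≤ μ.real {ω |
          (∀ i ≤ E, TauRhoStable (tau0 sys K0) (rhoBar sys K0)
            (closedLoop sys (ctrl sys Est Tmult K0 w η i ω))) ∧
          regret sys Est Tmult K0 (fun t => w t ω) (fun t => η t ω) T ≤
            sys.σw ^ (2 * (1 - α)) * d * (Gam sys K0 Kstar ^ 7 / lamMin sys.S ^ 2)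
                * Cerr (Vmax sys K0 Kstar) (SigMax sys K0 Kstar)
                * (((T : ℝ) + 1) / Tmult) ^ (α / (α + 1))
                * polylog C q [(T : ℝ) / δ, 1 / sys.σw ^ α]
              + C * Tmult
                * (Gam sys K0 Kstar ^ 2 * Jstar sys + sys.σw ^ 2 * sys.R.trace)
                * (((T : ℝ) + 1) / Tmult) ^ (α / (α + 1))
              + C * (n : ℝ) ^ ((3 : ℝ) / 2) * Real.sqrt T * sys.σw ^ 2
                * (Gam sys K0 Kstar ^ 9 / lamMin sys.S ^ 4) * (1 + Real.log ((T : ℝ) / δ))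
              + C * Tmult * sys.σw ^ 2 * n * Gam sys K0 Kstar ^ 3} := by
  obtain ⟨C0, hC0, hacc⟩ := accuracy_small p hc
  have hc5 : 0 ≤ c * 5 ^ p := by positivity
  -- `C0` meets the requirement on `Tmult` and the rest the regret constants. Both exponents are `4
  -- * p` because `accuracy_small` works with a fourth power.
  refine ⟨C0 + (256 * (c * 5 ^ p) + 90000), 4 * p, 4 * p, by linarith, ?_⟩
  intro n d hd hdn sys hS hR hσ K0 Kstar hK0 hKstar Est hEst Ω _ μ _ Tmult α w η hnoise Creq Cerr
    hassume δ hδ0 hδ1 E hE T hTlow hThigh hTmult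
  have : NeZero n := ⟨(hd.trans_le hdn).ne'⟩
  set C := C0 + (256 * (c * 5 ^ p) + 90000) with hC
  have prob : Problem sys K0 Kstar := ⟨hS, hR, hσ, hK0, hKstar⟩
  have hα := hassume.one_le_alpha
  have hV0 : 0 ≤ Vmax sys K0 Kstar := (norm_nonneg _).trans prob.norm_valueFn_zero_le
  have hS0 : 0 ≤ SigMax sys K0 Kstar := by
    have := prob.lam_pos; rw [SigMax]; positivity
  set a := Cerr (Vmax sys K0 Kstar) (SigMax sys K0 Kstar) with ha
  have ha0 : 0 ≤ a := hassume.cerr_nonneg _ _ hV0 hS0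
  have hreq : 0 < Creq (Vmax sys K0 Kstar) := hassume.creq_pos _ hV0
  set M := max 1 (max (Gam sys K0 Kstar ^ 8 / lamMin sys.S ^ 4)
    (1 / Creq (Vmax sys K0 Kstar) ^ 4)) with hM
  have hM1 : 1 ≤ M := le_max_left _ _
  set Λ := 1 + (Real.posLog (1 / sys.σw) + Real.posLog ((E : ℝ) / δ)) with hΛ
  have hp1 := Real.posLog_nonneg (x := 1 / sys.σw)
  have hp2 := Real.posLog_nonneg (x := (E : ℝ) / δ)
  have hΛ1 : 1 ≤ Λ := le_add_of_nonneg_right (add_nonneg hp1 hp2)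
  have hpoly : polylog C (4 * p) [1 / sys.σw, (E : ℝ) / δ] = C * Λ ^ (4 * p) := by
    simp [polylog, hΛ]
  rw [hpoly] at hTmult
  have hE0 : (0 : ℝ) < E := by exact_mod_cast hE
  -- The inverse failure probability per epoch: `E` estimates may together fail with probability `δ
  -- / 4`, leaving `3 δ / 4` for the noise.
  set D := 1 / (δ / (4 * E)) with hD
  have hΛD : 1 + Real.posLog (1 / sys.σw) + Real.posLog D ≤ 3 * Λ := by
    have h1 : D = 4 * (E / δ) := by rw [hD, one_div_div, mul_div_assoc]
    have h2 : Real.posLog D ≤ Real.posLog 4 + Real.posLog (E / δ) := by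
      rw [h1]; exact Real.posLog_mul
    have h3 : Real.posLog 4 ≤ 2 := by
      rw [Real.posLog_eq_log (by norm_num), show (4 : ℝ) = 2 ^ 2 by norm_num, Real.log_pow]
      have := Real.log_two_lt_d9
      push_cast; linarith
    linarith
  have hmax : 0 < max 1 (a ^ 2 / sys.σw ^ (4 * α)) := lt_max_of_lt_left one_pos
  have hTm0 : M * max 1 (a ^ 2 / sys.σw ^ (4 * α)) * α ^ (4 * p) * (C0 * Λ ^ (4 * p)) ≤ Tmult := by
    refine le_trans ?_ hTmult
    gcongr
    linarith
  have hTpos : 0 < Tmult := by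
    have h1 : 0 < M * max 1 (a ^ 2 / sys.σw ^ (4 * α)) * α ^ (4 * p) * (C0 * Λ ^ (4 * p)) := by
      positivity
    exact_mod_cast h1.trans_le hTm0
  have hbounds := fun i => accuracy_bounds
    (accuracy_pos (α := α) (D := D) (p := p) hTpos hσ hc.le ha0 i) prob.lam_pos prob.Gam_pos hreq hM
    (hacc sys Tmult α D Λ M a hσ hα ha0 hΛD hΛ1 hM1 hTm0 i)
  let r : Run n d Ω := ⟨sys, Est, Tmult, K0, Kstar, α, w, η, accuracy sys Tmult α c p D a⟩
  have hr : r.Valid μ := ⟨prob, hEst, hTpos, by linarith, hnoise,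
    fun i => accuracy_pos hTpos hσ hc.le ha0 i, fun i => (hbounds i).1⟩
  have hδE : 0 < δ / (4 * E) := by positivity
  have hE1 : (1 : ℝ) ≤ E := by exact_mod_cast hE
  have hEδ : E * (δ / (4 * E)) = δ / 4 := by field_simp
  have hgood : 1 - δ / 4 ≤ μ.real (r.good E) := by
    have h1 := hr.one_sub_le_measure_good hassume hc.le hδE
      (by rw [div_lt_one (by positivity)]; linarith) (by rw [hEδ]; linarith)
      (fun i => (hbounds i).2) rfl (le_refl E)
    rwa [hEδ] at h1
  have htyp := hr.measure_not_typical_le hdn (Nat.succ_pos T) hδ0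
  -- At the endpoint `T = epochStart Tmult E` the time step already has index in epoch `E`, so the
  -- controller `K^(E)` may be in use and all of `good E` is needed.
  have hep : r.ep T ≤ E := by
    have h1 : epochOf Tmult T ≤ epochOf Tmult (epochStart Tmult E) := epochOf_mono hThigh
    rwa [epochOf_epochStart hTpos] at h1
  set bad := {ω | ¬ r.Typical (T + 1) (Real.log (8 * (T + 1 : ℕ) / δ)) ω} with hbad
  have hbadr : μ.real bad ≤ 3 * δ / 4 := ENNReal.toReal_le_of_le_ofReal (by positivity) htyp
  have key : ∀ A : Set Ω, r.good E ⊆ A ∪ bad → 1 - δ ≤ μ.real A := fun A hA => by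
    have h1 := (measureReal_mono (μ := μ) hA).trans (measureReal_union_le _ _)
    linarith
  refine key _ fun ω hω => ?_
  by_cases hb : ω ∈ bad
  · exact Or.inr hb
  · refine Or.inl ⟨fun i hi => hr.tauRhoStable (r.good_anti hi hω), ?_⟩
    exact hr.regret_bound hα hdn hδ0 hδ1 hE (lt_epochStart_of_lt hTpos hTlow hE)
      (r.good_anti hep hω) (not_not.1 hb) ha0 hc.le rfl (le_add_of_nonneg_left hC0.le)
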